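/- Let $d\in\mathbb N$ and let $K\langle d\rangle$ be the unital $*$-algebra over $\mathbb C$ generated by non-commuting indeterminates $x_{kl}$, $x_{kl}^*$ ($1\le k,l\le d$) subject to the relations $XX^*=E$, $X^*X=E$, where $X=(x_{kl})$, $(X^*)_{kl}=x_{lk}^*$ and $E$ is the identity matrix. It is a dual semigroup with counit $\delta(x_{kl})=\delta_{kl}$ and comultiplication $\Delta:K\langle d\rangle\to K\langle d\rangle\sqcup_1 K\langle d\rangle$, $\Delta(x_{kl})=\sum_n x_{kn}^{(1)}x_{nl}^{(2)}$ (unital free product); for unital $*$-homomorphisms $f,g:K\langle d\rangle\to A$ put $f\star g=(f\sqcup_1 g)\circ\Delta$. A quantum probability space $(A,\Phi)$ is a unital $*$-algebra $A$ with a positive linear functional $\Phi$, $\Phi(1)=1$. A free Lévy process over $K\langle d\rangle$ on $(A,\Phi)$ is a family $(f_{r,s})_{0\le r\le s}$ of unital $*$-homomorphisms $K\langle d\rangle\to A$ such that (i) $f_{r,t}=f_{r,s}\star f_{s,t}$ for $r<s<t$, and $f_{r,r}=\delta(\cdot)1$; (ii) for $n>1$ and $0\le t_1<\dots<t_{n+1}$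 the homomorphisms $f_{t_1,t_2},\dots,f_{t_n,t_{n+1}}$ are free, i.e. $\Phi\circ(f_{t_1,t_2}\sqcup_1\cdots\sqcup_1 f_{t_n,t_{n+1}})$ is the free product of the functionals $\Phi\circ f_{t_i,t_{i+1}}$; (iii) $\Phi\circ f_{r,s}=\Phi\circ f_{0,s-r}$ for $r<s$; (iv) $\lim_{t\to0}\Phi(f_{0,t}(b))=\delta(b)$ for all $b$. Its generator is $\Psi(b)=\lim_{t\downarrow0}\frac1t\bigl(\Phi(f_{0,t}(b))-\delta(b)\bigr)$. Let $(\rho,\eta,\Psi)$ be a Schürmann triple of $(K\langle d\rangle,\delta)$ on a pre-Hilbert space $D$: $\rho$ is a unital $*$-representation on the completion $\overline D$ by bounded operators; $\eta:K\langle d\rangle\to D$ is linear and surjective with $\eta(ab)=\rho(a)\eta(b)+\eta(a)\delta(b)$; $\Psi$ is a linear functional with $\Psi(1)=0$, $\Psi(b^*)=\overline{\Psi(b)}$, $\Psi(b^*b)\ge0$ for $b\in\ker\delta$; and $\langle\eta(a),\eta(b)\rangle=\Psi\bigl((a-\delta(a)1)^*(b-\delta(b)1)\bigr)$. Assume $\rho(x_{kl})=\delta_{kl}\,\mathrm{id}$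 for all $k,l$. Let $\Gamma$ be the full Fock space over $L^2(\mathbb R_+,\overline D)$, with vacuum vector $\Omega$ and creation and annihilation operators $A^*(\cdot)$, $A(\cdot)$. For $0\le r\le s$ let $g_{r,s}$ be the $d\times d$ matrix over $B(\Gamma)$ with entries $$(g_{r,s})_{kl}=\delta_{kl}\,\mathrm{id}+A^*(\chi_{[r,s]}\otimes\eta(x_{kl}))+A(\chi_{[r,s]}\otimes\eta(x_{kl}^*))+(s-r)\Psi(x_{kl})\,\mathrm{id}.$$ For a partition $\alpha=\{r=t_1<\dots<t_{n+1}=s\}$ put $\Theta_\alpha=g_{t_1,t_2}\cdots g_{t_n,t_{n+1}}$. Then the net $(\Theta_\alpha)_\alpha$, over the partitions of $[r,s]$ ordered by inclusion, converges entrywise in operator norm to a matrix $U_{r,s}$ for all $0\le r\le s$; there are unital $*$-homomorphisms $f_{r,s}:K\langle d\rangle\to B(\Gamma)$ with $f_{r,s}(x_{kl})=(U_{r,s})_{kl}$; the family $(f_{r,s})_{0\le r\le s}$ is a free Lévy process on $(B(\Gamma),\langle\Omega,\cdot\,\Omega\rangle)$ with generator $\Psi$; and every free Lévy process $(j_{r,s})_{0\le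 r\le s}$ over $K\langle d\rangle$ with generator $\Psi$, on any quantum probability space $(A,\Phi)$, is stochastically equivalent to it: their distributions coincide, i.e. $$\Phi\bigl(j_{r_1,s_1}(b_1)\cdots j_{r_m,s_m}(b_m)\bigr)=\bigl\langle\Omega,f_{r_1,s_1}(b_1)\cdots f_{r_m,s_m}(b_m)\,\Omega\bigr\rangle$$ for all $m\in\mathbb N$, $0\le r_i\le s_i$ and $b_i\in K\langle d\rangle$. -/

import Mathlib

open scoped NNReal ENNReal TensorProduct ComplexOrder
open Filter Topology MeasureTheory UniformSpace

universe u v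

namespace FreeLevy

noncomputable section

/-! ### The dual group K⟨d⟩ -/

/-- The non-commuting indeterminates `x_{kl}` and `x_{kl}^*`, for `k, l = 1, …, d`. -/
inductive KGen (d : ℕ) : Type
  | x (k l : Fin d) : KGen d
  | xs (k l : Fin d) : KGen d

/-- The relations `X X^* = E` and `X^* X = E`, where `(X^*)_{kl} = x_{lk}^*`. -/
inductive KRel (d : ℕ) : FreeAlgebra ℂ (KGen d) → FreeAlgebra ℂ (KGen d) → Prop
  | mul_star (k l : Fin d) :
      KRel d (∑ p, FreeAlgebra.ι ℂ (KGen.x k p) * FreeAlgebra.ι ℂ (KGen.xs l p))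
        (if k = l then 1 else 0)
  | star_mul (k l : Fin d) :
      KRel d (∑ p, FreeAlgebra.ι ℂ (KGen.xs p k) * FreeAlgebra.ι ℂ (KGen.x p l))
        (if k = l then 1 else 0)

/-- The algebra `K⟨d⟩` of polynomials in the non-commuting `x_{kl}`, `x_{kl}^*` modulo the
unitarity relations. -/
def K (d : ℕ) : Type := RingQuot (KRel d)

instance (d : ℕ) : Ring (K d) := inferInstanceAs (Ring (RingQuot (KRel d)))
instance (d : ℕ) : Algebra ℂ (K d) := inferInstanceAs (Algebra ℂ (RingQuot (KRel d)))

/-- The class of an indeterminate in `K⟨d⟩`. -/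
def K.gen {d : ℕ} (g : KGen d) : K d :=
  RingQuot.mkAlgHom ℂ (KRel d) (FreeAlgebra.ι ℂ g)

/-- The generator `x_{kl}` of `K⟨d⟩`. -/
def K.x {d : ℕ} (k l : Fin d) : K d := K.gen (KGen.x k l)

theorem K.mul_star_rel {d : ℕ} (k l : Fin d) :
    ∑ p, K.gen (KGen.x k p) * K.gen (KGen.xs l p) = if k = l then (1 : K d) else 0 := by
  have h := RingQuot.mkAlgHom_rel ℂ (KRel.mul_star k l)
  simp only [map_sum, map_mul] at h
  refine h.trans ?_
  split_ifs
  · exact map_one _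
  · exact map_zero _

theorem K.star_mul_rel {d : ℕ} (k l : Fin d) :
    ∑ p, K.gen (KGen.xs p k) * K.gen (KGen.x p l) = if k = l then (1 : K d) else 0 := by
  have h := RingQuot.mkAlgHom_rel ℂ (KRel.star_mul k l)
  simp only [map_sum, map_mul] at h
  refine h.trans ?_
  split_ifs
  · exact map_one _
  · exact map_zero _

/-- Algebra homomorphisms out of `K⟨d⟩` from values on the indeterminates that satisfy the
relations. -/
def K.lift {d : ℕ} {A : Type*} [Semiring A] [Algebra ℂ A] (f : KGen d → A)
    (h₁ : ∀ k l, ∑ p, f (KGen.x k p) * f (KGen.xs l p) = if k = l then 1 else 0)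
    (h₂ : ∀ k l, ∑ p, f (KGen.xs p k) * f (KGen.x p l) = if k = l then 1 else 0) :
    K d →ₐ[ℂ] A :=
  RingQuot.liftAlgHom ℂ ⟨FreeAlgebra.lift ℂ f, by
    intro a b hab
    cases hab with
    | mul_star k l =>
      simp only [map_sum, map_mul, FreeAlgebra.lift_ι_apply, h₁]
      split_ifs <;> simp
    | star_mul k l =>
      simp only [map_sum, map_mul, FreeAlgebra.lift_ι_apply, h₂]
      split_ifs <;> simp⟩

theorem K.lift_gen {d : ℕ} {A : Type*} [Semiring A] [Algebra ℂ A] (f : KGen d → A)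
    (h₁ : ∀ k l, ∑ p, f (KGen.x k p) * f (KGen.xs l p) = if k = l then 1 else 0)
    (h₂ : ∀ k l, ∑ p, f (KGen.xs p k) * f (KGen.x p l) = if k = l then 1 else 0)
    (g : KGen d) : K.lift f h₁ h₂ (K.gen g) = f g := by
  have h := RingQuot.liftAlgHom_mkAlgHom_apply ℂ (FreeAlgebra.lift ℂ f) (s := KRel d) (by
    intro a b hab
    cases hab with
    | mul_star k l =>
      simp only [map_sum, map_mul, FreeAlgebra.lift_ι_apply, h₁]
      split_ifs <;> simp
    | star_mul k l =>
      simp only [map_sum, map_mul, FreeAlgebra.lift_ι_apply, h₂]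
      split_ifs <;> simp) (FreeAlgebra.ι ℂ g)
  rw [FreeAlgebra.lift_ι_apply] at h
  exact h

theorem K.induction {d : ℕ} {C : K d → Prop} (h0 : ∀ c : ℂ, C (algebraMap ℂ (K d) c))
    (hg : ∀ g, C (K.gen g)) (hm : ∀ a b, C a → C b → C (a * b))
    (ha : ∀ a b, C a → C b → C (a + b)) (a : K d) : C a := by
  obtain ⟨b, rfl⟩ := RingQuot.mkAlgHom_surjective ℂ (KRel d) a
  induction b using FreeAlgebra.induction with
  | grade0 r => rw [AlgHom.commutes]; exact h0 r
  | grade1 g => exact hg g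
  | mul a b iha ihb => rw [map_mul]; exact hm _ _ iha ihb
  | add a b iha ihb => rw [map_add]; exact ha _ _ iha ihb

/-- The opposite ring of `A`, with scalars acting through complex conjugation; algebra
homomorphisms into it are the conjugate-linear anti-homomorphisms into `A`. -/
def ConjOp (A : Type*) : Type _ := Aᵐᵒᵖ

instance (A : Type*) [Ring A] : Ring (ConjOp A) := inferInstanceAs (Ring Aᵐᵒᵖ)

instance (A : Type*) [Ring A] [Algebra ℂ A] : Algebra ℂ (ConjOp A) :=
  RingHom.toAlgebra' ((algebraMap ℂ Aᵐᵒᵖ).comp (starRingEnd ℂ))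
    (fun c (x : Aᵐᵒᵖ) => Algebra.commutes (starRingEnd ℂ c) x)

/-- The indeterminate adjoint to a given one. -/
def KGen.swap {d : ℕ} : KGen d → KGen d
  | KGen.x k l => KGen.xs k l
  | KGen.xs k l => KGen.x k l

/-- The conjugate-linear anti-homomorphism of `K⟨d⟩` with `x_{kl} ↦ x_{kl}^*`, `x_{kl}^* ↦ x_{kl}`. -/
def K.starHom (d : ℕ) : K d →ₐ[ℂ] ConjOp (K d) :=
  K.lift (A := ConjOp (K d)) (fun g => (MulOpposite.op (K.gen g.swap) : (K d)ᵐᵒᵖ))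
    (by
      intro k l
      have h := congrArg MulOpposite.op (K.mul_star_rel (d := d) l k)
      refine Eq.trans ?_ (h.trans ?_)
      · exact (Finset.op_sum _ _).symm
      · by_cases hkl : k = l
        · subst hkl; simp; rfl
        · simp [hkl, Ne.symm hkl]; rfl)
    (by
      intro k l
      have h := congrArg MulOpposite.op (K.star_mul_rel (d := d) l k)
      refine Eq.trans ?_ (h.trans ?_)
      · exact (Finset.op_sum _ _).symm
      · by_cases hkl : k = l
        · subst hkl; simp; rfl
        · simp [hkl, Ne.symm hkl]; rfl)

instance (d : ℕ) : Star (K d) := ⟨fun a => MulOpposite.unop (K.starHom d a)⟩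

theorem K.star_gen {d : ℕ} (g : KGen d) : star (K.gen g) = K.gen g.swap :=
  congrArg MulOpposite.unop (K.lift_gen (A := ConjOp (K d)) _ _ _ g)

theorem K.star_algebraMap {d : ℕ} (c : ℂ) :
    star (algebraMap ℂ (K d) c) = algebraMap ℂ (K d) (star c) :=
  congrArg MulOpposite.unop ((K.starHom d).commutes c)

theorem K.star_mul' {d : ℕ} (a b : K d) : star (a * b) = star b * star a :=
  congrArg MulOpposite.unop (map_mul (K.starHom d) a b)

theorem K.star_add' {d : ℕ} (a b : K d) : star (a + b) = star a + star b :=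
  congrArg MulOpposite.unop (map_add (K.starHom d) a b)

instance (d : ℕ) : StarRing (K d) where
  star_involutive a := by
    induction a using K.induction with
    | h0 c => rw [K.star_algebraMap, K.star_algebraMap, star_star]
    | hg g => rw [K.star_gen, K.star_gen]; cases g <;> rfl
    | hm a b iha ihb => rw [K.star_mul', K.star_mul', iha, ihb]
    | ha a b iha ihb => rw [K.star_add', K.star_add', iha, ihb]
  star_mul := K.star_mul'
  star_add := K.star_add'

instance (d : ℕ) : StarModule ℂ (K d) where
  star_smul c a := by
    rw [Algebra.smul_def, Algebra.smul_def, K.star_mul', K.star_algebraMap, Algebra.commutes]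

/-- The counit `δ : K⟨d⟩ → ℂ`, `δ(x_{kl}) = δ_{kl}` (hence `δ(x_{kl}^*) = δ_{kl}`). -/
def K.counit (d : ℕ) : K d →ₐ[ℂ] ℂ :=
  K.lift (fun g => match g with
    | KGen.x k l => if k = l then 1 else 0
    | KGen.xs k l => if k = l then 1 else 0)
    (by intro k l; simp)
    (by intro k l; simp [eq_comm])

/-! ### Free products of algebras and of functionals -/

/-- The unital free product `K⟨d⟩ ⊔₁ K⟨d⟩`. -/
abbrev KK (d : ℕ) : Type := LinearAlgebra.FreeProduct ℂ (fun _ : Fin 2 => K d)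

/-- The canonical embeddings of `K⟨d⟩` in `K⟨d⟩ ⊔₁ K⟨d⟩`. -/
def KK.inj (d : ℕ) (i : Fin 2) : K d →ₐ[ℂ] KK d :=
  LinearAlgebra.FreeProduct.ι ℂ (fun _ : Fin 2 => K d) i

theorem KK.mul_star_rel (d : ℕ) (i : Fin 2) (k l : Fin d) :
    ∑ p, KK.inj d i (K.gen (KGen.x k p)) * KK.inj d i (K.gen (KGen.xs l p)) =
      if k = l then 1 else 0 := by
  simp only [← map_mul, ← map_sum, K.mul_star_rel]
  split_ifs <;> simp

theorem KK.star_mul_rel (d : ℕ) (i : Fin 2) (k l : Fin d) :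
    ∑ p, KK.inj d i (K.gen (KGen.xs p k)) * KK.inj d i (K.gen (KGen.x p l)) =
      if k = l then 1 else 0 := by
  simp only [← map_mul, ← map_sum, K.star_mul_rel]
  split_ifs <;> simp

/-- If `B Bs = E` and `A As = E`, then `(A B) (Bs As) = E`, where `(As)_{pl} = as l p`. -/
theorem comul_rel {d : ℕ} {R : Type*} [Semiring R] (a b as bs : Fin d → Fin d → R)
    (hb : ∀ k l, ∑ p, b k p * bs l p = if k = l then 1 else 0)
    (ha : ∀ k l, ∑ p, a k p * as l p = if k = l then 1 else 0) (k l : Fin d) :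
    ∑ p, (∑ n, a k n * b n p) * (∑ n, bs n p * as l n) = if k = l then 1 else 0 := by
  have hB : Matrix.of b * (Matrix.of bs).transpose = 1 := by
    ext i j; simpa [Matrix.mul_apply, Matrix.one_apply] using hb i j
  have hA : Matrix.of a * (Matrix.of as).transpose = 1 := by
    ext i j; simpa [Matrix.mul_apply, Matrix.one_apply] using ha i j
  have h : (Matrix.of a * Matrix.of b) *
      ((Matrix.of bs).transpose * (Matrix.of as).transpose) = 1 := by
    rw [Matrix.mul_assoc, ← Matrix.mul_assoc (Matrix.of b), hB, Matrix.one_mul, hA]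
  simpa [Matrix.mul_apply, Matrix.one_apply] using congrFun (congrFun h k) l

/-- The comultiplication `Δ(x_{kl}) = (X^{(1)} X^{(2)})_{kl} = ∑ₙ x_{kn}^{(1)} x_{nl}^{(2)}`, hence
`Δ(x_{kl}^*) = ∑ₙ (x_{nl}^*)^{(2)} (x_{kn}^*)^{(1)}`. -/
def K.comul (d : ℕ) : K d →ₐ[ℂ] KK d :=
  K.lift (fun g => match g with
    | KGen.x k l => ∑ n, KK.inj d 0 (K.gen (KGen.x k n)) * KK.inj d 1 (K.gen (KGen.x n l))
    | KGen.xs k l => ∑ n, KK.inj d 1 (K.gen (KGen.xs n l)) * KK.inj d 0 (K.gen (KGen.xs k n)))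
    (comul_rel _ _ _ _ (KK.mul_star_rel d 1) (KK.mul_star_rel d 0))
    (fun k l => comul_rel (fun k n => KK.inj d 1 (K.gen (KGen.xs n k)))
      (fun n l => KK.inj d 0 (K.gen (KGen.xs l n))) (fun n l => KK.inj d 1 (K.gen (KGen.x l n)))
      (fun k n => KK.inj d 0 (K.gen (KGen.x n k)))
      (KK.star_mul_rel d 0) (KK.star_mul_rel d 1) k l)

/-- The homomorphism `⊔₁ᵢ fᵢ` on the unital free product induced by a family of homomorphisms. -/
def freeLift {I : Type*} [DecidableEq I] {d : ℕ} {A : Type*} [Semiring A] [Algebra ℂ A]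
    (f : I → (K d →ₐ[ℂ] A)) : LinearAlgebra.FreeProduct ℂ (fun _ : I => K d) →ₐ[ℂ] A :=
  LinearAlgebra.FreeProduct.lift ℂ (fun _ : I => K d) (fun {i} => f i)

/-- The convolution `f ⋆ g = (f ⊔₁ g) ∘ Δ`. -/
def conv {d : ℕ} {A : Type*} [Semiring A] [Algebra ℂ A] (f g : K d →ₐ[ℂ] A) : K d →ₐ[ℂ] A :=
  (freeLift ![f, g]).comp (K.comul d)

/-- `Θ` is the free product `⊙ᵢ φᵢ` of the functionals `φᵢ`: the linear functional on the unital
free product that extends every `φᵢ` and vanishes on alternating products of elements that are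
centred (consecutive factors come from different copies of `K⟨d⟩`). -/
def IsFreeProduct {I : Type*} [DecidableEq I] {d : ℕ} (φ : I → (K d →ₗ[ℂ] ℂ))
    (Θ : LinearAlgebra.FreeProduct ℂ (fun _ : I => K d) →ₗ[ℂ] ℂ) : Prop :=
  (∀ i b, Θ (LinearAlgebra.FreeProduct.ι ℂ (fun _ : I => K d) i b) = φ i b) ∧
  ∀ w : List (I × K d), w ≠ [] → w.IsChain (fun p q => p.1 ≠ q.1) → (∀ p ∈ w, φ p.1 p.2 = 0) →
    Θ (w.map fun p => LinearAlgebra.FreeProduct.ι ℂ (fun _ : I => K d) p.1 p.2).prod = 0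

/-! ### Free Lévy processes on quantum probability spaces -/

/-- A state on a unital `*`-algebra: a positive linear functional with `Φ(1) = 1`. -/
structure IsState {A : Type*} [Ring A] [Algebra ℂ A] [StarRing A] (Φ : A →ₗ[ℂ] ℂ) : Prop where
  map_one : Φ 1 = 1
  nonneg : ∀ a, 0 ≤ Φ (star a * a)

/-- The family `(f_{r,s})_{0 ≤ r ≤ s}` is a free Lévy process over `K⟨d⟩` on the quantum probability
space `(A, Φ)`. The values `f r s` with `s < r` are irrelevant. -/
structure IsFreeLevy {d : ℕ} {A : Type*} [Ring A] [Algebra ℂ A] [StarRing A]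
    (Φ : A →ₗ[ℂ] ℂ) (f : ℝ≥0 → ℝ≥0 → (K d →⋆ₐ[ℂ] A)) : Prop where
  isState : IsState Φ
  evolution : ∀ r s t, r < s → s < t →
    (f r t).toAlgHom = conv (f r s).toAlgHom (f s t).toAlgHom
  evolution_self : ∀ r b, f r r b = algebraMap ℂ A (K.counit d b)
  freeness : ∀ (n : ℕ) (t : Fin (n + 1) → ℝ≥0), 1 < n → StrictMono t →
    IsFreeProduct (fun i : Fin n => Φ ∘ₗ (f (t i.castSucc) (t i.succ)).toAlgHom.toLinearMap)
      (Φ ∘ₗ (freeLift fun i : Fin n => (f (t i.castSucc) (t i.succ)).toAlgHom).toLinearMap)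
  stationary : ∀ r s, r < s → ∀ b, Φ (f r s b) = Φ (f 0 (s - r) b)
  continuous : ∀ b, Tendsto (fun t => Φ (f 0 t b)) (𝓝 0) (𝓝 (K.counit d b))

/-- `Ψ` is the generator of the marginal distributions `φ_t = Φ ∘ f_{0,t}`:
`Ψ(b) = lim_{t → 0} (φ_t(b) - δ(b)) / t`. -/
def HasGenerator {d : ℕ} {A : Type*} [Ring A] [Algebra ℂ A] [StarRing A]
    (Φ : A →ₗ[ℂ] ℂ) (f : ℝ≥0 → ℝ≥0 → (K d →⋆ₐ[ℂ] A)) (Ψ : K d →ₗ[ℂ] ℂ) : Prop :=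
  ∀ b, Tendsto (fun t : ℝ≥0 => (1 / ((t : ℝ) : ℂ)) * (Φ (f 0 t b) - K.counit d b))
    (𝓝[>] 0) (𝓝 (Ψ b))

/-- The distribution `Φ ∘ (⊔_{r ≤ s} f_{r,s})` of a process, a linear functional on the free product
of copies of `K⟨d⟩` indexed by all pairs `r ≤ s`. -/
def distribution {d : ℕ} {A : Type*} [Ring A] [Algebra ℂ A] [StarRing A]
    (Φ : A →ₗ[ℂ] ℂ) (f : ℝ≥0 → ℝ≥0 → (K d →⋆ₐ[ℂ] A)) :
    LinearAlgebra.FreeProduct ℂ (fun _ : {p : ℝ≥0 × ℝ≥0 // p.1 ≤ p.2} => K d) →ₗ[ℂ] ℂ :=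
  Φ ∘ₗ (freeLift fun p : {p : ℝ≥0 × ℝ≥0 // p.1 ≤ p.2} =>
    (f p.1.1 p.1.2).toAlgHom).toLinearMap

/-- Two processes are stochastically equivalent if their distributions coincide. -/
def StochasticallyEquivalent {d : ℕ} {A A' : Type*}
    [Ring A] [Algebra ℂ A] [StarRing A] [Ring A'] [Algebra ℂ A'] [StarRing A']
    (Φ : A →ₗ[ℂ] ℂ) (f : ℝ≥0 → ℝ≥0 → (K d →⋆ₐ[ℂ] A))
    (Φ' : A' →ₗ[ℂ] ℂ) (f' : ℝ≥0 → ℝ≥0 → (K d →⋆ₐ[ℂ] A')) : Prop :=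
  distribution Φ f = distribution Φ' f'

/-! ### Generators and Schürmann triples -/

/-- A generator on `(K⟨d⟩, δ)`: hermitian, zero at `1`, and positive on the kernel of `δ`. -/
structure IsGenerator {d : ℕ} (Ψ : K d →ₗ[ℂ] ℂ) : Prop where
  map_star : ∀ b, Ψ (star b) = star (Ψ b)
  map_one : Ψ 1 = 0
  nonneg : ∀ b, K.counit d b = 0 → 0 ≤ Ψ (star b * b)

/-- A Schürmann triple `(ρ, η, Ψ)` of `(K⟨d⟩, δ)` on the pre-Hilbert space `D`. The everywhere defined
adjointable operators on the Hilbert space `Completion D` are its bounded operators. -/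
structure SchurmannTriple (d : ℕ) (D : Type*) [NormedAddCommGroup D] [InnerProductSpace ℂ D] where
  ρ : K d →⋆ₐ[ℂ] (Completion D →L[ℂ] Completion D)
  η : K d →ₗ[ℂ] D
  Ψ : K d →ₗ[ℂ] ℂ
  η_surjective : Function.Surjective η
  η_mul : ∀ a b, (η (a * b) : Completion D) =
    ρ a (η b : Completion D) + K.counit d b • (η a : Completion D)
  isGenerator : IsGenerator Ψ
  inner_η : ∀ a b, inner ℂ (η a) (η b) =
    Ψ (star (a - algebraMap ℂ (K d) (K.counit d a)) * (b - algebraMap ℂ (K d) (K.counit d b)))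

/-! ### The full Fock space -/

/-- A complex pre-Hilbert space, bundled. -/
structure PreHilb : Type (u + 1) where
  carrier : Type u
  [group : NormedAddCommGroup carrier]
  [innerSpace : InnerProductSpace ℂ carrier]

attribute [instance] PreHilb.group PreHilb.innerSpace

/-- The algebraic tensor powers of `H` as pre-Hilbert spaces: `H^{⊗0} = ℂ` (written as the
one-dimensional Euclidean space for reasons of universes) and `H^{⊗(n+1)} = H ⊗ H^{⊗n}`. -/
def tensorPow (H : Type u) [NormedAddCommGroup H] [InnerProductSpace ℂ H] : ℕ → PreHilb.{u}
  | 0 => ⟨EuclideanSpace ℂ PUnit.{u + 1}⟩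
  | n + 1 => ⟨H ⊗[ℂ] (tensorPow H n).carrier⟩

/-- The full Fock space `Γ(H)`, the Hilbert space direct sum of the Hilbert space tensor powers
of `H`. -/
abbrev Fock (H : Type u) [NormedAddCommGroup H] [InnerProductSpace ℂ H] : Type u :=
  lp (fun n => Completion (tensorPow H n).carrier) 2

section Fock

variable {H : Type u} [NormedAddCommGroup H] [InnerProductSpace ℂ H]

/-- The unit `1` of `H^{⊗0} = ℂ`. -/
def unitVec : (tensorPow H 0).carrier :=
  (EuclideanSpace.single PUnit.unit (1 : ℂ) : EuclideanSpace ℂ PUnit.{u + 1})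

/-- The vacuum vector `Ω = (1, 0, 0, …)`. -/
def vacuum : Fock H :=
  lp.single 2 0 ((unitVec : (tensorPow H 0).carrier) : Completion (tensorPow H 0).carrier)

/-- The map `H^{⊗n} → H^{⊗(n+1)}`, `ξ ↦ h ⊗ ξ`, on algebraic tensor powers. -/
def tensorLeftAlg (h : H) (n : ℕ) : (tensorPow H n).carrier →L[ℂ] (tensorPow H (n + 1)).carrier :=
  TensorProduct.mkL ℂ H (tensorPow H n).carrier h

theorem norm_tensorLeftAlg (h : H) (n : ℕ) (x : (tensorPow H n).carrier) :
    ‖tensorLeftAlg h n x‖ = ‖h‖ * ‖x‖ :=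
  TensorProduct.norm_tmul h x

/-- The map `ξ ↦ h ⊗ ξ` on Hilbert space tensor powers. -/
def tensorLeft (h : H) (n : ℕ) :
    Completion (tensorPow H n).carrier →L[ℂ] Completion (tensorPow H (n + 1)).carrier :=
  (tensorLeftAlg h n).completion

theorem norm_tensorLeft_apply_le (h : H) (n : ℕ) (x : Completion (tensorPow H n).carrier) :
    ‖tensorLeft h n x‖ ≤ ‖h‖ * ‖x‖ := by
  induction x using Completion.induction_on with
  | hp => exact isClosed_le (by fun_prop) (by fun_prop)
  | ih x =>
    rw [tensorLeft, ContinuousLinearMap.completion_apply_coe, Completion.norm_coe,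
      Completion.norm_coe, norm_tensorLeftAlg]

/-- The components of `A^*(h) x`: `(A^*(h) x)_0 = 0` and `(A^*(h) x)_{n+1} = h ⊗ x_n`. -/
def creationFun (h : H) (x : ∀ n, Completion (tensorPow H n).carrier) :
    ∀ n, Completion (tensorPow H n).carrier
  | 0 => 0
  | n + 1 => tensorLeft h n (x n)

theorem norm_creationFun_succ (h : H) (x : Fock H) (n : ℕ) :
    ‖creationFun h x (n + 1)‖ ^ (2 : ℝ≥0∞).toReal ≤
      ‖h‖ ^ (2 : ℝ≥0∞).toReal * ‖x n‖ ^ (2 : ℝ≥0∞).toReal := by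
  rw [← Real.mul_rpow (norm_nonneg _) (norm_nonneg _)]
  exact Real.rpow_le_rpow (norm_nonneg _) (norm_tensorLeft_apply_le h n (x n)) (by simp)

theorem creationFun_memℓp (h : H) (x : Fock H) : Memℓp (creationFun h x) 2 := by
  refine memℓp_gen ((summable_nat_add_iff 1).1 ?_)
  exact Summable.of_nonneg_of_le (fun n => by positivity) (norm_creationFun_succ h x)
    (((lp.memℓp x).summable (by simp)).mul_left _)

/-- The creation operator `A^*(h)`: `A^*(h) Ω = h`, `A^*(h)(h₁ ⊗ ⋯ ⊗ hₙ) = h ⊗ h₁ ⊗ ⋯ ⊗ hₙ`. -/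
def creation (h : H) : Fock H →L[ℂ] Fock H :=
  LinearMap.mkContinuous
    { toFun := fun x => ⟨creationFun h x, creationFun_memℓp h x⟩
      map_add' := by
        intro x y
        refine lp.ext (funext fun n => ?_)
        cases n with
        | zero => exact (add_zero (0 : Completion (tensorPow H 0).carrier)).symm
        | succ n => exact map_add (tensorLeft h n) (x n) (y n)
      map_smul' := by
        intro c x
        refine lp.ext (funext fun n => ?_)
        cases n with
        | zero => exact (smul_zero (A := Completion (tensorPow H 0).carrier) c).symm
        | succ n => exact map_smul (tensorLeft h n) c (x n) } ‖h‖ (by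
    intro x
    have h2 : 0 < (2 : ℝ≥0∞).toReal := by simp
    refine lp.norm_le_of_tsum_le h2 (by positivity) ?_
    have hs := (creationFun_memℓp h x).summable h2
    have hx := (lp.memℓp x).summable h2
    refine (hs.tsum_eq_zero_add).trans_le ?_
    have h0 : ‖creationFun h x 0‖ ^ (2 : ℝ≥0∞).toReal = 0 := by simp [creationFun]
    rw [h0, zero_add, Real.mul_rpow (norm_nonneg _) (norm_nonneg _),
      lp.norm_rpow_eq_tsum h2, ← tsum_mul_left]
    exact ((summable_nat_add_iff 1).2 hs).tsum_le_tsum (norm_creationFun_succ h x)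
      (hx.mul_left _))

/-- The annihilation operator `A(h)`, the adjoint of `A^*(h)`: `A(h) Ω = 0` and
`A(h)(h₁ ⊗ ⋯ ⊗ hₙ) = ⟨h, h₁⟩ h₂ ⊗ ⋯ ⊗ hₙ`. -/
def annihilation (h : H) : Fock H →L[ℂ] Fock H :=
  ContinuousLinearMap.adjoint (creation h)

variable (H) in
/-- The vacuum state `g ↦ ⟨Ω, g Ω⟩` on the bounded operators of the full Fock space. -/
def vacuumState : (Fock H →L[ℂ] Fock H) →ₗ[ℂ] ℂ where
  toFun g := inner ℂ vacuum (g vacuum)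
  map_add' g g' := by simp
  map_smul' c g := by simp

end Fock

/-! ### The process on the full Fock space -/

/-- The Hilbert space `L²(ℝ₊, D)` (with values in the completion of `D`). -/
abbrev L2 (D : Type*) [NormedAddCommGroup D] [InnerProductSpace ℂ D] : Type _ :=
  Lp (Completion D) 2 (volume.restrict (Set.Ici (0 : ℝ)))

/-- The vector `χ_{[r,s]} ⊗ v` of `L²(ℝ₊, D)`. -/
def chi {D : Type*} [NormedAddCommGroup D] [InnerProductSpace ℂ D] (r s : ℝ≥0) (v : D) : L2 D :=
  indicatorConstLp 2 (measurableSet_Icc (a := (r : ℝ)) (b := (s : ℝ)))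
    (isCompact_Icc.measure_lt_top.ne) (v : Completion D)

/-- The partitions `{R = t₁ < ⋯ < t_{n+1} = S}` of `[R, S]`, ordered by inclusion. -/
abbrev Partition (R S : ℝ≥0) : Type :=
  {α : Finset ℝ≥0 // R ∈ α ∧ S ∈ α ∧ ∀ t ∈ α, R ≤ t ∧ t ≤ S}

namespace SchurmannTriple

variable {d : ℕ} {D : Type u} [NormedAddCommGroup D] [InnerProductSpace ℂ D]

/-- The matrix `g_{r,s} = (h_{r,s}(x_{kl}))_{kl}` of operators on `Γ(L²(ℝ₊, D))`, where
`h_{r,s}(x_{kl}) = δ_{kl} id + A^*(χ_{[r,s]} ⊗ η(x_{kl})) + A(χ_{[r,s]} ⊗ η(x_{kl}^*))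
+ (s - r) Ψ(x_{kl}) id`. -/
def increment (T : SchurmannTriple d D) (r s : ℝ≥0) :
    Matrix (Fin d) (Fin d) (Fock (L2 D) →L[ℂ] Fock (L2 D)) :=
  fun k l => (if k = l then 1 else 0) + creation (chi r s (T.η (K.x k l))) +
    annihilation (chi r s (T.η (star (K.x k l)))) +
    ((((s : ℝ) - (r : ℝ) : ℝ) : ℂ) * T.Ψ (K.x k l)) • (1 : Fock (L2 D) →L[ℂ] Fock (L2 D))

/-- The product `Θ_α = g_{t₁,t₂} ⋯ g_{tₙ,tₙ₊₁}` over a partition `α = {t₁ < ⋯ < tₙ₊₁}`. -/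
def partitionProd (T : SchurmannTriple d D) {R S : ℝ≥0} (α : Partition R S) :
    Matrix (Fin d) (Fin d) (Fock (L2 D) →L[ℂ] Fock (L2 D)) :=
  (List.zipWith T.increment (α.1.sort (· ≤ ·)) (α.1.sort (· ≤ ·)).tail).prod

/-- `(f_{r,s})_{0 ≤ r ≤ s}` is the process on the full Fock space constructed from the triple:
`f_{r,s}(x_{kl}) = (U_{r,s})_{kl}`, where the matrix `U_{r,s}` is the limit in operator norm of the
net `(Θ_α)` over the partitions of `[r, s]`. This determines `f_{r,s}` for `r ≤ s`. -/
def IsFockConstruction (T : SchurmannTriple d D)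
    (f : ℝ≥0 → ℝ≥0 → (K d →⋆ₐ[ℂ] (Fock (L2 D) →L[ℂ] Fock (L2 D)))) : Prop :=
  ∀ r s, r ≤ s → ∀ k l,
    Tendsto (fun α : Partition r s => T.partitionProd α k l) atTop (𝓝 (f r s (K.x k l)))

end SchurmannTriple

end

end FreeLevy

namespace FreeLevy

noncomputable section

/-! ### Products of nearly orthogonal perturbations in a `C*`-algebra -/

section Abstract

variable {M : Type*} [CStarAlgebra M]

/-! Existence. Work in the C*-algebra of d×d matrices over B(Γ). Since ρ is trivial, η is a
δ-derivation and η(x_kl^*) = -η(x_lk) (`SchurmannTriple.η_xs`), so the increment over an interval i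
of length τ_i is g_i = 1 + X_i with X_i = a_i - a_i^* + τ_i L. Here a_i is a matrix of creation
operators and L is the matrix of the Ψ(x_kl). Applying Ψ to X^*X = E gives the Itô relation a_i^*
a_i = -τ_i (L + L^*) (`SchurmannTriple.sum_inner_η`). As ‖X_i‖ is only of order √τ_i, the triangle
inequality is too weak. What helps is that creators over disjoint intervals have orthogonal ranges,
with projections P_i, and that compressing g_i by 1 - P_i leaves 1 + τ_i L, which commutes with
every P_j. A local error e of size O(τ) is split as P e + (1-P) e P + (1-P) e (1-P). The first
blocks, taken over all intervals, add up in squares (`norm_sq_add_mul_le`), the second ones do so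
after passing to adjoints, and the third are O(τ²). On a mesh δ the total error is therefore O(√δ).
Applied to refinements (`Noise.norm_blocks_sub_Theta_le`), this makes the products Cauchy; applied
to the defects g g^* - 1 (`Noise.norm_Theta_mul_star_sub_one_le`) and to their duals, it makes the
limit U unitary. A unitary matrix is the same thing as a *-homomorphism on K⟨d⟩, and U_{r,s} U_{s,t}
= U_{r,t} is the convolution identity.

Freeness. By normal ordering, an operator x built from creators and annihilators of vectors in S
maps a vector ξ orthogonal to the range of these creators to ⟨Ω, x Ω⟩ ξ plus a vector in that range
(`fockAlg_le_shiftSpace`). Hence an alternating centred product moves Ω from one creation range to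
the next, and every such range is orthogonal to Ω.

Generator. The elements b for which f(b) equals δ(b) + (creation and annihilation part) + τΨ(b), up
to O(τ) in norm and O(τ^{3/2}) in the vacuum state, are closed under sums, products and adjoints
(`SchurmannTriple.HasExpansion`) and contain the indeterminates.

Uniqueness. Under a free product of functionals, the expectation of a word is a smooth function of
finitely many moments of the marginals (`smoothAt_word`). Since Δ does not raise the degree in
either leg, the moments of degree at most N of a free evolution satisfy a closed composition law,
and therefore an ODE determined by Ψ. States of K⟨d⟩ are bounded by 1 on monomials, so ODE
uniqueness applies (`IsEvolution.eq`). It yields equality of the marginals and also stationarity of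
the Fock process. Joint distributions then agree because finitely many increments factor, through
iterated comultiplication, over one common grid of free increments (`exists_gridHom`). -/

theorem norm_sq_add_le_of_star_mul_eq_zero {y z : M} (h : star y * z = 0) :
    ‖y + z‖ ^ 2 ≤ ‖y‖ ^ 2 + ‖z‖ ^ 2 := by
  have h' : star z * y = 0 := by
    have := congrArg star h
    simpa using this
  have e : star (y + z) * (y + z) = star y * y + star z * z := by
    rw [star_add, add_mul, mul_add, mul_add, h, h']; abel
  have := norm_add_le (star y * y) (star z * z)
  rw [← e] at this
  simp only [CStarRing.norm_star_mul_self] at this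
  nlinarith

/-- Since y^* R = 0, the cross term y^* B R equals y^* (B - 1) R, which is small when B is near 1,
and the arithmetic-geometric inequality distributes it over ‖y‖² and ‖B - 1‖² ‖R‖². If ‖B‖² ≤ 1 + cτ
and ‖B - 1‖² ≤ cτ, the factor of ‖R‖² is at most 1 + 2cτ, so iterating over a subdivision costs only
a bounded exponential while the terms y contribute in squares. -/
theorem norm_sq_add_mul_le {P y R B : M} (hP : star P = P) (hy : P * y = y) (hR : P * R = 0) :
    ‖y + B * R‖ ^ 2 ≤ 2 * ‖y‖ ^ 2 + (‖B‖ ^ 2 + ‖B - 1‖ ^ 2) * ‖R‖ ^ 2 := by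
  have h0 : star y * R = 0 := by
    rw [← hy, star_mul, hP, mul_assoc, hR, mul_zero]
  have h1 : star y * (B * R) = star y * ((B - 1) * R) := by
    rw [sub_mul, one_mul, mul_sub, h0, sub_zero]
  have e : star (y + B * R) * (y + B * R) = star y * y + star y * ((B - 1) * R) +
      star (star y * ((B - 1) * R)) + star (B * R) * (B * R) := by
    rw [← h1, star_mul, star_star, star_add, add_mul, mul_add, mul_add]; abel
  have h2 : ‖star y * ((B - 1) * R)‖ ≤ ‖y‖ * (‖B - 1‖ * ‖R‖) := by
    refine (norm_mul_le _ _).trans ?_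
    rw [norm_star]
    gcongr
    exact norm_mul_le _ _
  have h3 : ‖star (y + B * R) * (y + B * R)‖ ≤ ‖star y * y‖ + ‖star y * ((B - 1) * R)‖ +
      ‖star (star y * ((B - 1) * R))‖ + ‖star (B * R) * (B * R)‖ := by
    rw [e]; exact norm_add₄_le
  simp only [CStarRing.norm_star_mul_self, norm_star (star y * ((B - 1) * R))] at h3
  have h4 : ‖B * R‖ * ‖B * R‖ ≤ (‖B‖ * ‖R‖) * (‖B‖ * ‖R‖) := by
    gcongr <;> exact norm_mul_le _ _
  nlinarith [sq_nonneg (‖y‖ - ‖B - 1‖ * ‖R‖)]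

/-- `c` is the compression of `x` to the complement of the `i`-th projection, and `c` commutes with
all projections. -/
structure Compress {ι : Type*} (P : ι → M) (i : ι) (x c : M) : Prop where
  comm : ∀ j, Commute (P j) c
  eq : (1 - P i) * x * (1 - P i) = c * (1 - P i)

/-- A family of self-adjoint projections. -/
structure IsProjFamily {ι : Type*} (P : ι → M) : Prop where
  star_eq : ∀ i, star (P i) = P i
  idem : ∀ i, P i * P i = P i

variable {ι : Type*} {P : ι → M}

theorem IsProjFamily.norm_le (hP : IsProjFamily P) (i : ι) : ‖P i‖ ≤ 1 := by
  have h := CStarRing.norm_star_mul_self (x := P i)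
  rw [hP.star_eq, hP.idem] at h
  nlinarith [norm_nonneg (P i)]

theorem IsProjFamily.norm_one_sub_le (hP : IsProjFamily P) (i : ι) : ‖1 - P i‖ ≤ 1 := by
  have h := CStarRing.norm_star_mul_self (x := 1 - P i)
  have e : star (1 - P i) * (1 - P i) = 1 - P i := by
    rw [star_sub, star_one, hP.star_eq, mul_sub, sub_mul, sub_mul, hP.idem]; simp
  rw [e] at h
  nlinarith [norm_nonneg (1 - P i)]

theorem IsProjFamily.symm (hP : IsProjFamily P) {i j : ι} (h : P i * P j = 0) : P j * P i = 0 := by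
  have := congrArg star h
  simpa [hP.star_eq] using this

theorem Compress.star (hP : IsProjFamily P) {i : ι} {x c : M} (h : Compress P i x c) :
    Compress P i (star x) (star c) := by
  refine ⟨fun j => ?_, ?_⟩
  · have := (h.comm j).star_star
    rwa [hP.star_eq] at this
  · have := congrArg Star.star h.eq
    simp only [star_mul, star_sub, star_one, hP.star_eq] at this
    rw [mul_assoc, this]
    have := (h.comm i).star_star
    rw [hP.star_eq] at this
    rw [sub_mul, mul_sub, this.eq]; simp

theorem Compress.sub {i : ι} {x c y e : M} (h : Compress P i x c) (h' : Compress P i y e) :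
    Compress P i (x - y) (c - e) :=
  ⟨fun j => (h.comm j).sub_right (h'.comm j), by
    rw [mul_sub (1 - P i) x, sub_mul _ _ (1 - P i), h.eq, h'.eq, sub_mul c]⟩

theorem IsProjFamily.one_sub_mul_self (hP : IsProjFamily P) (i : ι) : (1 - P i) * P i = 0 := by
  rw [sub_mul, one_mul, hP.idem, sub_self]

theorem Compress.add_left (hP : IsProjFamily P) {i : ι} {x c : M} (h : Compress P i x c) (z : M) :
    Compress P i (x + P i * z) c :=
  ⟨h.comm, by
    rw [mul_add, add_mul, h.eq, ← mul_assoc (1 - P i) (P i), hP.one_sub_mul_self]; simp⟩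

/-- R is killed by P i, so B * R is c * R plus an element of the range of P i; P j annihilates that
range and commutes with c. This carries the orthogonality needed for `norm_sq_add_mul_le` through
the recursions below. -/
theorem kill_mul {i j : ι} {B c R : M} (hB : Compress P i B c)
    (hij : P j * P i = 0) (hi : P i * R = 0) (hj : P j * R = 0) : P j * (B * R) = 0 := by
  have h1 : B * R = P i * (B * R) + (1 - P i) * B * (1 - P i) * R := by
    rw [mul_assoc _ (1 - P i) R, sub_mul 1 (P i) R, hi]; noncomm_ring
  rw [h1, hB.eq, mul_add, ← mul_assoc (P j), hij, zero_mul, zero_add, mul_assoc c,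
    sub_mul, hi, one_mul, sub_zero, ← mul_assoc, (hB.comm j).eq, mul_assoc, hj, mul_zero]

theorem kill_add_mul {i j : ι} {B c y R : M} (hB : Compress P i B c)
    (hy : P i * y = y) (hij : P j * P i = 0) (hi : P i * R = 0) (hj : P j * R = 0) :
    P j * (y + B * R) = 0 := by
  rw [mul_add, kill_mul hB hij hi hj, ← hy, ← mul_assoc, hij, zero_mul, add_zero]

theorem sum_map_nonneg {f : ι → ℝ} (l : List ι) (hf : ∀ i, 0 ≤ f i) : 0 ≤ (l.map f).sum :=
  List.sum_nonneg (by simp only [List.mem_map]; rintro _ ⟨a, -, rfl⟩; exact hf a)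

variable (M) in
theorem norm_one_le : ‖(1 : M)‖ ≤ 1 := by
  have h := CStarRing.norm_star_mul_self (x := (1 : M))
  rw [star_one, one_mul] at h
  nlinarith [norm_nonneg (1 : M)]

theorem norm_sq_list_prod_le {G : ι → M} {τ : ι → ℝ} {c : ℝ} (l : List ι)
    (h : ∀ i ∈ l, ‖G i‖ ^ 2 ≤ 1 + c * τ i) :
    ‖(l.map G).prod‖ ^ 2 ≤ Real.exp (c * (l.map τ).sum) := by
  induction l with
  | nil =>
    have h1 := norm_one_le M
    simp only [List.map_nil, List.prod_nil, List.sum_nil, mul_zero, Real.exp_zero]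
    nlinarith [norm_nonneg (1 : M)]
  | cons i l ih =>
    simp only [List.map_cons, List.prod_cons, List.sum_cons]
    have h1 := h i (by simp)
    have h2 := ih fun j hj => h j (by simp [hj])
    have h3 : 1 + c * τ i ≤ Real.exp (c * τ i) := by
      have := Real.add_one_le_exp (c * τ i); linarith
    rw [mul_add, Real.exp_add]
    calc _ ≤ (‖G i‖ * ‖(l.map G).prod‖) ^ 2 := by gcongr; exact norm_mul_le _ _
      _ = ‖G i‖ ^ 2 * ‖(l.map G).prod‖ ^ 2 := by ring
      _ ≤ _ := by gcongr; exact h1.trans h3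

/-- In the telescoping identity G Q - G' Q' = (G - G') Q + G' (Q - Q') the first summand lies in the
range of P i and Q - Q' is killed by P i, so the differences add up in squares. The second
conclusion is the invariant that keeps the induction going. -/
theorem norm_sq_prod_sub_prod_le_of_left (hP : IsProjFamily P) {G G' : ι → M} {τ : ι → ℝ} {c : ℝ}
    (hc : 0 ≤ c) (l : List ι) (horth : l.Pairwise fun i j => P i * P j = 0)
    (hτ : ∀ i ∈ l, 0 ≤ τ i) (hG : ∀ i ∈ l, ‖G i‖ ^ 2 ≤ 1 + c * τ i)
    (hG' : ∀ i ∈ l, ‖G' i‖ ^ 2 ≤ 1 + c * τ i) (hG1 : ∀ i ∈ l, ‖G' i - 1‖ ^ 2 ≤ c * τ i)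
    (hx : ∀ i ∈ l, P i * (G i - G' i) = G i - G' i)
    (hC : ∀ i ∈ l, ∃ e, Compress P i (G' i) e) :
    ‖(l.map G).prod - (l.map G').prod‖ ^ 2 ≤
        2 * Real.exp (2 * c * (l.map τ).sum) * (l.map fun i => ‖G i - G' i‖ ^ 2).sum ∧
      ∀ j, (∀ i ∈ l, P j * P i = 0) → P j * ((l.map G).prod - (l.map G').prod) = 0 := by
  induction l with
  | nil => simp
  | cons i l ih =>
    simp only [List.forall_mem_cons, List.pairwise_cons] at *
    obtain ⟨ih1, ih2⟩ := ih horth.2 hτ.2 hG.2 hG'.2 hG1.2 hx.2 hC.2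
    simp only [List.map_cons, List.prod_cons, List.sum_cons]
    set Q := (l.map G).prod
    set Q' := (l.map G').prod
    have e : G i * Q - G' i * Q' = (G i - G' i) * Q + G' i * (Q - Q') := by noncomm_ring
    have hR := ih2 i horth.1
    obtain ⟨u, hu⟩ := hC.1
    have hy : P i * ((G i - G' i) * Q) = (G i - G' i) * Q := by rw [← mul_assoc, hx.1]
    refine ⟨?_, fun j hj => ?_⟩
    · rw [e]
      refine (norm_sq_add_mul_le (hP.star_eq i) hy hR).trans ?_
      have hQ : ‖Q‖ ^ 2 ≤ Real.exp (c * (l.map τ).sum) := norm_sq_list_prod_le l hG.2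
      have hs : 0 ≤ (l.map τ).sum := List.sum_nonneg (by simpa using hτ.2)
      have hs2 : 0 ≤ (l.map fun i => ‖G i - G' i‖ ^ 2).sum :=
        List.sum_nonneg (by simp only [List.mem_map]; rintro _ ⟨a, -, rfl⟩; positivity)
      have hτi := hτ.1
      have e1 : ‖(G i - G' i) * Q‖ ^ 2 ≤
          ‖G i - G' i‖ ^ 2 * Real.exp (2 * c * (τ i + (l.map τ).sum)) := by
        calc _ ≤ (‖G i - G' i‖ * ‖Q‖) ^ 2 := by gcongr; exact norm_mul_le _ _
          _ = ‖G i - G' i‖ ^ 2 * ‖Q‖ ^ 2 := by ring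
          _ ≤ _ := by
            gcongr
            refine hQ.trans (Real.exp_le_exp.2 ?_)
            nlinarith [mul_nonneg hc hs, mul_nonneg hc hτi]
      have e2 : ‖G' i‖ ^ 2 + ‖G' i - 1‖ ^ 2 ≤ Real.exp (2 * c * τ i) := by
        have := Real.add_one_le_exp (2 * c * τ i)
        linarith [hG'.1, hG1.1]
      have e3 : (‖G' i‖ ^ 2 + ‖G' i - 1‖ ^ 2) * ‖Q - Q'‖ ^ 2 ≤ Real.exp (2 * c * τ i) *
          (2 * Real.exp (2 * c * (l.map τ).sum) * (l.map fun i => ‖G i - G' i‖ ^ 2).sum) := by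
        gcongr
      have e4 : Real.exp (2 * c * (τ i + (l.map τ).sum)) =
          Real.exp (2 * c * τ i) * Real.exp (2 * c * (l.map τ).sum) := by
        rw [← Real.exp_add]; ring_nf
      rw [e4] at e1 ⊢
      linarith
    · rw [e]
      exact kill_add_mul hu hy hj.1 hR (ih2 j hj.2)

theorem star_list_map_prod (G : ι → M) (l : List ι) :
    star (l.map G).prod = (l.reverse.map fun i => star (G i)).prod := by
  induction l with
  | nil => simp
  | cons i l ih => simp [ih]

/-- Adjoints reverse the product and turn absorption of P i on the right into absorption on the
left; orthogonality of self-adjoint projections is symmetric, so the left estimate applies to the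
reversed list. -/
theorem norm_sq_prod_sub_prod_le_of_right (hP : IsProjFamily P) {G G' : ι → M} {τ : ι → ℝ} {c : ℝ}
    (hc : 0 ≤ c) (l : List ι) (horth : l.Pairwise fun i j => P i * P j = 0)
    (hτ : ∀ i ∈ l, 0 ≤ τ i) (hG : ∀ i ∈ l, ‖G i‖ ^ 2 ≤ 1 + c * τ i)
    (hG' : ∀ i ∈ l, ‖G' i‖ ^ 2 ≤ 1 + c * τ i) (hG1 : ∀ i ∈ l, ‖G' i - 1‖ ^ 2 ≤ c * τ i)
    (hx : ∀ i ∈ l, (G i - G' i) * P i = G i - G' i)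
    (hC : ∀ i ∈ l, ∃ e, Compress P i (G' i) e) :
    ‖(l.map G).prod - (l.map G').prod‖ ^ 2 ≤
      2 * Real.exp (2 * c * (l.map τ).sum) * (l.map fun i => ‖G i - G' i‖ ^ 2).sum := by
  have h := (norm_sq_prod_sub_prod_le_of_left hP (G := fun i => star (G i))
    (G' := fun i => star (G' i)) (τ := τ) hc l.reverse
    (List.pairwise_reverse.2 (horth.imp fun h => hP.symm h))
    (by simpa using hτ) (by simpa using hG) (by simpa using hG')
    (by
      intro i hi
      rw [← norm_star]; simpa using hG1 i (by simpa using hi))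
    (by
      intro i hi
      have := congrArg star (hx i (by simpa using hi))
      simpa [hP.star_eq] using this)
    (by
      intro i hi
      obtain ⟨e, he⟩ := hC i (by simpa using hi)
      exact ⟨_, he.star hP⟩)).1
  rw [← star_list_map_prod, ← star_list_map_prod, ← star_sub, norm_star, List.map_reverse,
    List.sum_reverse, List.map_reverse, List.sum_reverse] at h
  refine h.trans (le_of_eq ?_)
  simp only [← star_sub, norm_star]

/-- The triangle inequality, with no orthogonality. It suffices for differences of order τ². -/
theorem norm_prod_sub_prod_le {G G' : ι → M} {τ : ι → ℝ} {c : ℝ}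
    (hc : 0 ≤ c) (l : List ι) (hτ : ∀ i ∈ l, 0 ≤ τ i) (hG : ∀ i ∈ l, ‖G i‖ ^ 2 ≤ 1 + c * τ i)
    (hG' : ∀ i ∈ l, ‖G' i‖ ^ 2 ≤ 1 + c * τ i) :
    ‖(l.map G).prod - (l.map G').prod‖ ≤
      Real.exp (c * (l.map τ).sum) * (l.map fun i => ‖G i - G' i‖).sum := by
  induction l with
  | nil => simp
  | cons i l ih =>
    simp only [List.forall_mem_cons] at *
    have ih1 := ih hτ.2 hG.2 hG'.2
    simp only [List.map_cons, List.prod_cons, List.sum_cons]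
    set Q := (l.map G).prod
    set Q' := (l.map G').prod
    have e : G i * Q - G' i * Q' = (G i - G' i) * Q + G' i * (Q - Q') := by noncomm_ring
    have hs : 0 ≤ (l.map τ).sum := List.sum_nonneg (by simpa using hτ.2)
    have hs2 : 0 ≤ (l.map fun i => ‖G i - G' i‖).sum :=
      sum_map_nonneg l fun _ => by positivity
    have hτi := hτ.1
    have hQ : ‖Q‖ ≤ Real.exp (c * (τ i + (l.map τ).sum)) := by
      refine abs_le_of_sq_le_sq' ?_ (Real.exp_pos _).le |>.2
      refine (norm_sq_list_prod_le l hG.2).trans ?_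
      rw [← Real.exp_nat_mul]
      refine Real.exp_le_exp.2 ?_
      push_cast
      nlinarith [mul_nonneg hc hs, mul_nonneg hc hτi]
    have hGi : ‖G' i‖ ≤ Real.exp (c * τ i) := by
      have := Real.add_one_le_exp (c * τ i)
      nlinarith [hG'.1, norm_nonneg (G' i), mul_nonneg hc hτi]
    rw [e]
    refine (norm_add_le _ _).trans ?_
    have e1 : ‖(G i - G' i) * Q‖ ≤ ‖G i - G' i‖ * Real.exp (c * (τ i + (l.map τ).sum)) :=
      (norm_mul_le _ _).trans (by gcongr)
    have e2 : ‖G' i * (Q - Q')‖ ≤ Real.exp (c * τ i) *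
        (Real.exp (c * (l.map τ).sum) * (l.map fun i => ‖G i - G' i‖).sum) :=
      (norm_mul_le _ _).trans (by gcongr)
    have e4 : Real.exp (c * (τ i + (l.map τ).sum)) =
        Real.exp (c * τ i) * Real.exp (c * (l.map τ).sum) := by
      rw [← Real.exp_add]; ring_nf
    rw [e4] at e1 ⊢
    linarith

/-- The constant in `norm_prod_sub_prod_le_of_compress`. -/
def prodConst (c b S : ℝ) : ℝ :=
  5 * Real.exp ((2 * c + 4 * (1 + c) * b + 8 * b ^ 2) * S) * b * (1 + S)

theorem sum_map_sq_le {f τ : ι → ℝ} {b δ : ℝ} (l : List ι) (hf : ∀ i ∈ l, 0 ≤ f i)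
    (hτ : ∀ i ∈ l, 0 ≤ τ i) (hδ : ∀ i ∈ l, τ i ≤ δ) (hfb : ∀ i ∈ l, f i ≤ b * τ i) :
    (l.map fun i => f i ^ 2).sum ≤ b ^ 2 * δ * (l.map τ).sum := by
  rw [← List.sum_map_mul_left]
  refine List.sum_le_sum fun i hi => ?_
  have h1 : f i ^ 2 ≤ (b * τ i) ^ 2 := pow_le_pow_left₀ (hf i hi) (hfb i hi) 2
  have h2 : τ i * τ i ≤ δ * τ i := mul_le_mul_of_nonneg_right (hδ i hi) (hτ i hi)
  nlinarith [mul_le_mul_of_nonneg_left h2 (sq_nonneg b)]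

theorem sum_map_le {f τ : ι → ℝ} {b δ : ℝ} (hb : 0 ≤ b) (l : List ι)
    (hτ : ∀ i ∈ l, 0 ≤ τ i) (hδ : ∀ i ∈ l, τ i ≤ δ) (hfb : ∀ i ∈ l, f i ≤ b * τ i ^ 2) :
    (l.map f).sum ≤ b * δ * (l.map τ).sum := by
  rw [← List.sum_map_mul_left]
  refine List.sum_le_sum fun i hi => ?_
  have h2 : τ i * τ i ≤ δ * τ i := mul_le_mul_of_nonneg_right (hδ i hi) (hτ i hi)
  nlinarith [hfb i hi, mul_le_mul_of_nonneg_left h2 hb]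

theorem le_sqrt_aux {x E b S δ : ℝ} (hE : 0 ≤ E) (hb : 0 ≤ b) (hS : 0 ≤ S)
    (hδ : 0 ≤ δ) (h : x ^ 2 ≤ 2 * E ^ 2 * (b ^ 2 * δ * S)) :
    x ≤ 2 * E * b * (1 + S) * √δ := by
  have h0 : 0 ≤ 2 * E * b * (1 + S) * √δ := by positivity
  refine (abs_le_of_sq_le_sq' (h.trans ?_) h0).2
  rw [mul_pow, Real.sq_sqrt hδ]
  have : 0 ≤ E ^ 2 * b ^ 2 * δ := by positivity
  nlinarith [mul_nonneg this hS, mul_nonneg this (sq_nonneg S)]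

/-- If the blocks `G i` and `G' i` differ by `O(τ i)` and their compressions differ by `O(τ i ^ 2)`,
then their products differ by the square root of the mesh. -/
theorem norm_prod_sub_prod_le_of_compress (hP : IsProjFamily P) {G G' : ι → M} {τ : ι → ℝ}
    {c b δ : ℝ} (hc : 0 ≤ c) (hb : 0 ≤ b) (l : List ι)
    (horth : l.Pairwise fun i j => P i * P j = 0) (hδ0 : 0 ≤ δ) (hδ1 : δ ≤ 1)
    (hτ : ∀ i ∈ l, 0 ≤ τ i) (hτδ : ∀ i ∈ l, τ i ≤ δ)
    (hG : ∀ i ∈ l, ‖G i‖ ^ 2 ≤ 1 + c * τ i)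
    (hG' : ∀ i ∈ l, ‖G' i‖ ^ 2 ≤ 1 + c * τ i) (hG1 : ∀ i ∈ l, ‖G' i - 1‖ ^ 2 ≤ c * τ i)
    (hx : ∀ i ∈ l, ‖G i - G' i‖ ≤ b * τ i)
    (hC : ∀ i ∈ l, ∃ e e', Compress P i (G i) e ∧ Compress P i (G' i) e' ∧
      ‖e - e'‖ ≤ b * τ i ^ 2) :
    ‖(l.map G).prod - (l.map G').prod‖ ≤ prodConst c b (l.map τ).sum * √δ := by
  set S := (l.map τ).sum
  have hS : 0 ≤ S := List.sum_nonneg (by simpa using hτ)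
  -- One constant for all intermediate blocks G' + z with ‖z‖ ≤ 2bτ: the cross term in ‖G' + z‖²
  -- gives 4(1 + c)b, while 2c and 8b² come from ‖G' + z - 1‖² ≤ 2‖G' - 1‖² + 2‖z‖².
  set c₁ := 2 * c + 4 * (1 + c) * b + 8 * b ^ 2 with hc₁
  have hc₁0 : 0 ≤ c₁ := by positivity
  have hcc₁ : c ≤ c₁ := by
    have : 0 ≤ c + 4 * (1 + c) * b + 8 * b ^ 2 := by positivity
    rw [hc₁]; linarith
  have hτ1 : ∀ i ∈ l, τ i ≤ 1 := fun i hi => (hτδ i hi).trans hδ1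
  -- G' is deformed to G through G' + u and G' + u + v: u is handled by the left estimate, v by the
  -- right one, and the remaining corner (1 - P)(G - G')(1 - P) is of order τ².
  let u : ι → M := fun i => P i * (G i - G' i)
  let v : ι → M := fun i => (1 - P i) * (G i - G' i) * P i
  have hu : ∀ i ∈ l, ‖u i‖ ≤ b * τ i := fun i hi => by
    calc ‖P i * (G i - G' i)‖ ≤ ‖P i‖ * ‖G i - G' i‖ := norm_mul_le _ _
      _ ≤ 1 * (b * τ i) := by gcongr; exacts [hP.norm_le i, hx i hi]
      _ = _ := one_mul _
  have hv : ∀ i ∈ l, ‖v i‖ ≤ b * τ i := fun i hi => by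
    calc ‖(1 - P i) * (G i - G' i) * P i‖ ≤ ‖(1 - P i)‖ * ‖G i - G' i‖ * ‖P i‖ := norm_mul₃_le
      _ ≤ 1 * (b * τ i) * 1 := by
        have := hx i hi
        gcongr; exacts [mul_nonneg zero_le_one (mul_nonneg hb (hτ i hi)), hP.norm_one_sub_le i,
          hP.norm_le i]
      _ = _ := by ring
  have key : ∀ i ∈ l, ∀ z : M, ‖z‖ ≤ 2 * b * τ i →
      ‖G' i + z‖ ^ 2 ≤ 1 + c₁ * τ i ∧ ‖G' i + z - 1‖ ^ 2 ≤ c₁ * τ i := by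
    intro i hi z hz
    have t0 := hτ i hi
    have t1 := hτ1 i hi
    have n1 : ‖G' i‖ ≤ 1 + c := by
      have := hG' i hi
      nlinarith [norm_nonneg (G' i), mul_le_mul_of_nonneg_left t1 hc]
    have t2 : τ i * τ i ≤ τ i := by nlinarith
    have z2 : ‖z‖ ^ 2 ≤ 4 * b ^ 2 * τ i := by
      have := pow_le_pow_left₀ (norm_nonneg z) hz 2
      nlinarith [mul_le_mul_of_nonneg_left t2 (sq_nonneg b)]
    constructor
    · have h1 := pow_le_pow_left₀ (norm_nonneg _) (norm_add_le (G' i) z) 2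
      have h2 : ‖G' i‖ * ‖z‖ ≤ (1 + c) * (2 * b * τ i) := by gcongr
      have h3 := hG' i hi
      rw [hc₁]
      nlinarith [mul_nonneg hc t0, mul_nonneg (sq_nonneg b) t0]
    · have h1 : ‖G' i + z - 1‖ ≤ ‖G' i - 1‖ + ‖z‖ := by
        rw [add_sub_right_comm]; exact norm_add_le _ _
      have h1 := pow_le_pow_left₀ (norm_nonneg _) h1 2
      have h3 := hG1 i hi
      rw [hc₁]
      nlinarith [sq_nonneg (‖G' i - 1‖ - ‖z‖), mul_nonneg (mul_nonneg hc hb) t0, mul_nonneg hb t0]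
  have hG0 : ∀ i ∈ l, ‖G i‖ ^ 2 ≤ 1 + c₁ * τ i := fun i hi =>
    (hG i hi).trans (by have := hτ i hi; gcongr)
  have hK1 : ∀ i ∈ l, _ := fun i hi => key i hi (u i)
    ((hu i hi).trans (by nlinarith [mul_nonneg hb (hτ i hi)]))
  have hK2 : ∀ i ∈ l, _ := fun i hi => key i hi (u i + v i)
    ((norm_add_le _ _).trans (by linarith [hu i hi, hv i hi]))
  have hK0 : ∀ i ∈ l, _ := fun i hi => key i hi 0
    (by rw [norm_zero]; have := mul_nonneg hb (hτ i hi); linarith)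
  simp only [add_zero] at hK0
  have s1 := (norm_sq_prod_sub_prod_le_of_left hP (G := fun i => G' i + u i) (G' := G') hc₁0 l horth
    hτ (fun i hi => (hK1 i hi).1) (fun i hi => (hK0 i hi).1) (fun i hi => (hK0 i hi).2)
    (fun i hi => by simp only [add_sub_cancel_left, u]; rw [← mul_assoc, hP.idem])
    (fun i hi => by obtain ⟨-, e', -, h, -⟩ := hC i hi; exact ⟨e', h⟩)).1
  have s2 := norm_sq_prod_sub_prod_le_of_right hP (G := fun i => G' i + (u i + v i))
    (G' := fun i => G' i + u i) hc₁0 l horth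
    hτ (fun i hi => (hK2 i hi).1) (fun i hi => (hK1 i hi).1) (fun i hi => (hK1 i hi).2)
    (fun i hi => by
      simp only [← add_assoc, add_sub_cancel_left, v]; rw [mul_assoc _ (P i), hP.idem])
    (fun i hi => by obtain ⟨-, e', -, h, -⟩ := hC i hi; exact ⟨e', h.add_left hP _⟩)
  have s3 := norm_prod_sub_prod_le (G := G) (G' := fun i => G' i + (u i + v i)) hc₁0 l
    hτ hG0 (fun i hi => (hK2 i hi).1)
  simp only [add_sub_cancel_left, add_sub_add_left_eq_sub] at s1 s2
  set A0 := (l.map G').prod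
  set A1 := (l.map fun i => G' i + u i).prod
  set A2 := (l.map fun i => G' i + (u i + v i)).prod
  set A3 := (l.map G).prod
  set E := Real.exp (c₁ * S) with hE
  have hE0 : 0 ≤ E := (Real.exp_pos _).le
  have hE2 : Real.exp (2 * c₁ * S) = E ^ 2 := by rw [hE, ← Real.exp_nat_mul]; ring_nf
  rw [hE2] at s1 s2
  have r1 : ‖A1 - A0‖ ≤ 2 * E * b * (1 + S) * √δ :=
    le_sqrt_aux hE0 hb hS hδ0 (s1.trans (by
      gcongr; exact sum_map_sq_le l (fun _ _ => norm_nonneg _) hτ hτδ hu))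
  have r2 : ‖A2 - A1‖ ≤ 2 * E * b * (1 + S) * √δ :=
    le_sqrt_aux hE0 hb hS hδ0 (s2.trans (by
      gcongr; exact sum_map_sq_le l (fun _ _ => norm_nonneg _) hτ hτδ
        hv))
  have hw : ∀ i ∈ l, ‖G i - (G' i + (u i + v i))‖ ≤ b * τ i ^ 2 := by
    intro i hi
    obtain ⟨e, e', h, h', hn⟩ := hC i hi
    have : G i - (G' i + (u i + v i)) = (e - e') * (1 - P i) := by
      rw [← (h.sub h').eq]; simp only [u, v]; noncomm_ring
    rw [this]
    calc _ ≤ ‖e - e'‖ * ‖1 - P i‖ := norm_mul_le _ _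
      _ ≤ ‖e - e'‖ * 1 := by gcongr; exact hP.norm_one_sub_le i
      _ ≤ _ := by rwa [mul_one]
  have r3 : ‖A3 - A2‖ ≤ E * (b * √δ * S) := by
    refine s3.trans ?_
    gcongr
    refine (sum_map_le hb l hτ hτδ hw).trans ?_
    have : δ ≤ √δ := by
      have := Real.sqrt_le_one.2 hδ1
      nlinarith [Real.mul_self_sqrt hδ0, Real.sqrt_nonneg δ]
    gcongr
  have e : A3 - A0 = (A3 - A2) + (A2 - A1) + (A1 - A0) := by abel
  rw [e]
  refine norm_add₃_le.trans ?_
  have hp : 0 ≤ E * b * √δ := by positivity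
  have : prodConst c b S = 5 * E * b * (1 + S) := rfl
  rw [this]
  nlinarith

/-- `∑ᵢ B₁ ⋯ Bᵢ₋₁ yᵢ Bᵢ₋₁^* ⋯ B₁^*`. -/
def conjSum (B y : ι → M) : List ι → M
  | [] => 0
  | i :: l => y i + B i * (conjSum B y l * star (B i))

theorem conjSum_add (B y z : ι → M) (l : List ι) :
    conjSum B (fun i => y i + z i) l = conjSum B y l + conjSum B z l := by
  induction l with
  | nil => simp [conjSum]
  | cons i l ih => simp only [conjSum, ih]; noncomm_ring

theorem star_conjSum (B y : ι → M) (l : List ι) :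
    star (conjSum B y l) = conjSum B (fun i => star (y i)) l := by
  induction l with
  | nil => simp [conjSum]
  | cons i l ih => simp only [conjSum, star_add, star_mul, star_star, ih, mul_assoc]

/-- Telescoping: for a tail product Q, the defect of B Q is (B B^* - 1) + B (Q Q^* - 1) B^*. -/
theorem conjSum_mul_star_sub_one (B : ι → M) (l : List ι) :
    conjSum B (fun i => B i * star (B i) - 1) l = (l.map B).prod * star (l.map B).prod - 1 := by
  induction l with
  | nil => simp [conjSum]
  | cons i l ih => simp only [conjSum, ih, List.map_cons, List.prod_cons, star_mul]; noncomm_ring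

/-- The recursion is the one for products. The additional right factor star (B i) does not affect
annihilation by P j from the left and costs one more factor exp (c τ), whence 3c in the exponent. -/
theorem norm_sq_conjSum_le (hP : IsProjFamily P) {B y : ι → M} {τ : ι → ℝ} {c : ℝ}
    (hc : 0 ≤ c) (l : List ι) (horth : l.Pairwise fun i j => P i * P j = 0)
    (hτ : ∀ i ∈ l, 0 ≤ τ i) (hB : ∀ i ∈ l, ‖B i‖ ^ 2 ≤ 1 + c * τ i)
    (hB1 : ∀ i ∈ l, ‖B i - 1‖ ^ 2 ≤ c * τ i) (hy : ∀ i ∈ l, P i * y i = y i)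
    (hC : ∀ i ∈ l, ∃ e, Compress P i (B i) e) :
    ‖conjSum B y l‖ ^ 2 ≤
        2 * Real.exp (3 * c * (l.map τ).sum) * (l.map fun i => ‖y i‖ ^ 2).sum ∧
      ∀ j, (∀ i ∈ l, P j * P i = 0) → P j * conjSum B y l = 0 := by
  induction l with
  | nil => simp [conjSum]
  | cons i l ih =>
    simp only [List.forall_mem_cons, List.pairwise_cons] at *
    obtain ⟨ih1, ih2⟩ := ih horth.2 hτ.2 hB.2 hB1.2 hy.2 hC.2
    simp only [List.map_cons, List.sum_cons, conjSum]
    set Q := conjSum B y l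
    obtain ⟨u, hu⟩ := hC.1
    have hR : ∀ j, P j * Q = 0 → P j * (Q * star (B i)) = 0 := fun j h => by
      rw [← mul_assoc, h, zero_mul]
    refine ⟨?_, fun j hj => kill_add_mul hu hy.1 hj.1 (hR _ (ih2 i horth.1)) (hR _ (ih2 j hj.2))⟩
    refine (norm_sq_add_mul_le (hP.star_eq i) hy.1 (hR _ (ih2 i horth.1))).trans ?_
    have hs : 0 ≤ (l.map τ).sum := List.sum_nonneg (by simpa using hτ.2)
    have hs2 : 0 ≤ (l.map fun i => ‖y i‖ ^ 2).sum :=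
      sum_map_nonneg l fun _ => by positivity
    have hτi := hτ.1
    have hct : 0 ≤ c * τ i := mul_nonneg hc hτi
    have e0 : ‖Q * star (B i)‖ ^ 2 ≤ ‖Q‖ ^ 2 * Real.exp (c * τ i) := by
      calc _ ≤ (‖Q‖ * ‖B i‖) ^ 2 := by
            gcongr; exact (norm_mul_le _ _).trans_eq (by rw [norm_star])
        _ = ‖Q‖ ^ 2 * ‖B i‖ ^ 2 := by ring
        _ ≤ _ := by
          gcongr
          have := Real.add_one_le_exp (c * τ i)
          linarith [hB.1]
    have e2 : ‖B i‖ ^ 2 + ‖B i - 1‖ ^ 2 ≤ Real.exp (2 * (c * τ i)) := by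
      have := Real.add_one_le_exp (2 * (c * τ i))
      linarith [hB.1, hB1.1]
    have e3 : (‖B i‖ ^ 2 + ‖B i - 1‖ ^ 2) * ‖Q * star (B i)‖ ^ 2 ≤ Real.exp (2 * (c * τ i)) *
        ((2 * Real.exp (3 * c * (l.map τ).sum) * (l.map fun i => ‖y i‖ ^ 2).sum) *
          Real.exp (c * τ i)) := by
      gcongr
      exact e0.trans (by gcongr)
    have e4 : Real.exp (3 * c * (τ i + (l.map τ).sum)) =
        Real.exp (2 * (c * τ i)) * Real.exp (c * τ i) * Real.exp (3 * c * (l.map τ).sum) := by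
      rw [← Real.exp_add, ← Real.exp_add]; ring_nf
    have e5 : 1 ≤ Real.exp (3 * c * (τ i + (l.map τ).sum)) := by
      rw [Real.one_le_exp_iff]; positivity
    have e6 : ‖y i‖ ^ 2 ≤ Real.exp (3 * c * (τ i + (l.map τ).sum)) * ‖y i‖ ^ 2 :=
      le_mul_of_one_le_left (by positivity) e5
    rw [e4] at e6 ⊢
    linarith

theorem norm_conjSum_le {B y : ι → M} {τ : ι → ℝ} {c : ℝ} (hc : 0 ≤ c) (l : List ι)
    (hτ : ∀ i ∈ l, 0 ≤ τ i) (hB : ∀ i ∈ l, ‖B i‖ ^ 2 ≤ 1 + c * τ i) :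
    ‖conjSum B y l‖ ≤ Real.exp (c * (l.map τ).sum) * (l.map fun i => ‖y i‖).sum := by
  induction l with
  | nil => simp [conjSum]
  | cons i l ih =>
    simp only [List.forall_mem_cons] at *
    have ih1 := ih hτ.2 hB.2
    simp only [List.map_cons, List.sum_cons, conjSum]
    set Q := conjSum B y l
    have hs : 0 ≤ (l.map τ).sum := List.sum_nonneg (by simpa using hτ.2)
    have hct : 0 ≤ c * τ i := mul_nonneg hc hτ.1
    have e0 : ‖B i * (Q * star (B i))‖ ≤ Real.exp (c * τ i) * ‖Q‖ := by
      calc _ ≤ ‖B i‖ * (‖Q‖ * ‖B i‖) := (norm_mul_le _ _).trans (by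
            gcongr; exact (norm_mul_le _ _).trans_eq (by rw [norm_star]))
        _ = ‖B i‖ ^ 2 * ‖Q‖ := by ring
        _ ≤ _ := by
          gcongr
          have := Real.add_one_le_exp (c * τ i)
          linarith [hB.1]
    have e1 : Real.exp (c * τ i) * ‖Q‖ ≤ Real.exp (c * τ i) *
      (Real.exp (c * (l.map τ).sum) * (l.map fun i => ‖y i‖).sum) := by gcongr
    have e4 : Real.exp (c * (τ i + (l.map τ).sum)) =
        Real.exp (c * τ i) * Real.exp (c * (l.map τ).sum) := by
      rw [← Real.exp_add]; ring_nf
    have e5 : 1 ≤ Real.exp (c * (τ i + (l.map τ).sum)) := by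
      rw [Real.one_le_exp_iff]; have := hτ.1; positivity
    have e6 : ‖y i‖ ≤ Real.exp (c * (τ i + (l.map τ).sum)) * ‖y i‖ :=
      le_mul_of_one_le_left (by positivity) e5
    refine (norm_add_le _ _).trans ?_
    rw [e4] at e6 ⊢
    linarith

/-- If the defects `B i * star (B i) - 1` are `O(τ i)` and their compressions are `O(τ i ^ 2)`, then
the defect of the product is bounded by the square root of the mesh. -/
theorem norm_prod_mul_star_sub_one_le (hP : IsProjFamily P) {B : ι → M} {τ : ι → ℝ}
    {c b δ : ℝ} (hc : 0 ≤ c) (hb : 0 ≤ b) (l : List ι)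
    (horth : l.Pairwise fun i j => P i * P j = 0) (hδ0 : 0 ≤ δ) (hδ1 : δ ≤ 1)
    (hτ : ∀ i ∈ l, 0 ≤ τ i) (hτδ : ∀ i ∈ l, τ i ≤ δ)
    (hB : ∀ i ∈ l, ‖B i‖ ^ 2 ≤ 1 + c * τ i) (hB1 : ∀ i ∈ l, ‖B i - 1‖ ^ 2 ≤ c * τ i)
    (hC : ∀ i ∈ l, ∃ e, Compress P i (B i) e)
    (hx : ∀ i ∈ l, ‖B i * star (B i) - 1‖ ≤ b * τ i)
    (hE : ∀ i ∈ l, ∃ e, Compress P i (B i * star (B i) - 1) e ∧ ‖e‖ ≤ b * τ i ^ 2) :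
    ‖(l.map B).prod * star (l.map B).prod - 1‖ ≤
      5 * Real.exp (2 * c * (l.map τ).sum) * b * (1 + (l.map τ).sum) * √δ := by
  set S := (l.map τ).sum
  have hS : 0 ≤ S := List.sum_nonneg (by simpa using hτ)
  let E : ι → M := fun i => B i * star (B i) - 1
  have hEs : ∀ i, star (E i) = E i := fun i => by simp [E]
  -- The defect is cut into the same three blocks. As E i is self-adjoint, star (v i) = P i * E i *
  -- (1 - P i) lies in the range of P i, so `star_conjSum` brings v under the estimate used for u.
  let u : ι → M := fun i => P i * E i
  let v : ι → M := fun i => (1 - P i) * E i * P i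
  let w : ι → M := fun i => (1 - P i) * E i * (1 - P i)
  have e : E = fun i => (u i + v i) + w i := by
    funext i; simp only [u, v, w]; noncomm_ring
  have hu : ∀ i ∈ l, ‖u i‖ ≤ b * τ i := fun i hi => by
    calc ‖P i * E i‖ ≤ ‖P i‖ * ‖E i‖ := norm_mul_le _ _
      _ ≤ 1 * (b * τ i) := by gcongr; exacts [hP.norm_le i, hx i hi]
      _ = _ := one_mul _
  have hv : ∀ i ∈ l, ‖star (v i)‖ ≤ b * τ i := fun i hi => by
    rw [norm_star]
    calc ‖(1 - P i) * E i * P i‖ ≤ ‖(1 - P i)‖ * ‖E i‖ * ‖P i‖ := norm_mul₃_le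
      _ ≤ 1 * (b * τ i) * 1 := by
        have : ‖E i‖ ≤ b * τ i := hx i hi
        gcongr; exacts [mul_nonneg zero_le_one (mul_nonneg hb (hτ i hi)), hP.norm_one_sub_le i,
          hP.norm_le i]
      _ = _ := by ring
  have hw : ∀ i ∈ l, ‖w i‖ ≤ b * τ i ^ 2 := fun i hi => by
    obtain ⟨e, he, hn⟩ := hE i hi
    simp only [w, E, he.eq]
    calc _ ≤ ‖e‖ * ‖1 - P i‖ := norm_mul_le _ _
      _ ≤ ‖e‖ * 1 := by gcongr; exact hP.norm_one_sub_le i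
      _ ≤ _ := by rwa [mul_one]
  have s1 := (norm_sq_conjSum_le hP (y := u) hc l horth hτ hB hB1
    (fun i hi => by simp only [u]; rw [← mul_assoc, hP.idem]) hC).1
  have s2 := (norm_sq_conjSum_le hP (y := fun i => star (v i)) hc l horth hτ hB hB1
    (fun i hi => by
      simp only [v, star_mul, star_sub, star_one, hP.star_eq, hEs]
      rw [← mul_assoc, hP.idem]) hC).1
  have s3 := norm_conjSum_le (y := w) hc l hτ hB
  rw [← star_conjSum, norm_star] at s2
  set F := Real.exp (2 * c * S) with hF
  have hF0 : 0 ≤ F := (Real.exp_pos _).le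
  have hF2 : Real.exp (3 * c * S) ≤ F ^ 2 := by
    rw [hF, ← Real.exp_nat_mul]
    refine Real.exp_le_exp.2 ?_
    push_cast
    nlinarith [mul_nonneg hc hS]
  have hF1 : Real.exp (c * S) ≤ F := Real.exp_le_exp.2 (by nlinarith [mul_nonneg hc hS])
  have hb2 : 0 ≤ b ^ 2 * δ * S := by positivity
  have r1 : ‖conjSum B u l‖ ≤ 2 * F * b * (1 + S) * √δ :=
    le_sqrt_aux hF0 hb hS hδ0 (s1.trans (by
      refine mul_le_mul (by gcongr) (sum_map_sq_le l (fun _ _ => norm_nonneg _) hτ hτδ hu)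
        (sum_map_nonneg l fun _ => sq_nonneg _) (by positivity)))
  have r2 : ‖conjSum B v l‖ ≤ 2 * F * b * (1 + S) * √δ :=
    le_sqrt_aux hF0 hb hS hδ0 (s2.trans (by
      refine mul_le_mul (by gcongr) (sum_map_sq_le l (fun _ _ => norm_nonneg _) hτ hτδ hv)
        (sum_map_nonneg l fun _ => sq_nonneg _) (by positivity)))
  have r3 : ‖conjSum B w l‖ ≤ F * (b * √δ * S) := by
    refine s3.trans ?_
    refine mul_le_mul hF1 ?_ (sum_map_nonneg l fun _ => norm_nonneg _) hF0
    refine (sum_map_le hb l hτ hτδ hw).trans ?_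
    have : δ ≤ √δ := by
      have := Real.sqrt_le_one.2 hδ1
      nlinarith [Real.mul_self_sqrt hδ0, Real.sqrt_nonneg δ]
    gcongr
  rw [← conjSum_mul_star_sub_one]
  change ‖conjSum B E l‖ ≤ _
  rw [e, conjSum_add, conjSum_add]
  refine norm_add₃_le.trans ?_
  have hp : 0 ≤ F * b * √δ := by positivity
  nlinarith

end Abstract

/-! ### Horner sums -/

section Horner

variable {M : Type*} [CStarAlgebra M] {ι : Type*} {P : ι → M}

/-- `∑ᵢ B₁ ⋯ Bᵢ₋₁ yᵢ`. -/
def horner (B y : ι → M) : List ι → M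
  | [] => 0
  | i :: l => y i + B i * horner B y l

theorem horner_mul_eq_zero {B y : ι → M} {z : M} (l : List ι) (h : ∀ i ∈ l, y i * z = 0) :
    horner B y l * z = 0 := by
  induction l with
  | nil => simp [horner]
  | cons i l ih =>
    simp only [List.forall_mem_cons] at h
    rw [horner, add_mul, h.1, mul_assoc, ih h.2]; simp

/-- The leading term lies in the range of P i and the rest of the sum is killed by P i, so
`norm_sq_add_mul_le` makes the terms add up in squares. -/
theorem norm_sq_horner_le_of_left (hP : IsProjFamily P) {B y : ι → M} {τ : ι → ℝ} {c : ℝ}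
    (hc : 0 ≤ c) (l : List ι) (horth : l.Pairwise fun i j => P i * P j = 0)
    (hτ : ∀ i ∈ l, 0 ≤ τ i) (hB : ∀ i ∈ l, ‖B i‖ ^ 2 ≤ 1 + c * τ i)
    (hB1 : ∀ i ∈ l, ‖B i - 1‖ ^ 2 ≤ c * τ i) (hy : ∀ i ∈ l, P i * y i = y i)
    (hC : ∀ i ∈ l, ∃ e, Compress P i (B i) e) :
    ‖horner B y l‖ ^ 2 ≤
        2 * Real.exp (2 * c * (l.map τ).sum) * (l.map fun i => ‖y i‖ ^ 2).sum ∧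
      ∀ j, (∀ i ∈ l, P j * P i = 0) → P j * horner B y l = 0 := by
  induction l with
  | nil => simp [horner]
  | cons i l ih =>
    simp only [List.forall_mem_cons, List.pairwise_cons] at *
    obtain ⟨ih1, ih2⟩ := ih horth.2 hτ.2 hB.2 hB1.2 hy.2 hC.2
    simp only [List.map_cons, List.sum_cons, horner]
    set Q := horner B y l
    obtain ⟨u, hu⟩ := hC.1
    refine ⟨?_, fun j hj => kill_add_mul hu hy.1 hj.1 (ih2 i horth.1) (ih2 j hj.2)⟩
    refine (norm_sq_add_mul_le (hP.star_eq i) hy.1 (ih2 i horth.1)).trans ?_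
    have hs : 0 ≤ (l.map τ).sum := List.sum_nonneg (by simpa using hτ.2)
    have hs2 : 0 ≤ (l.map fun i => ‖y i‖ ^ 2).sum := sum_map_nonneg l fun _ => by positivity
    have hτi := hτ.1
    have e2 : ‖B i‖ ^ 2 + ‖B i - 1‖ ^ 2 ≤ Real.exp (2 * c * τ i) := by
      have := Real.add_one_le_exp (2 * c * τ i)
      linarith [hB.1, hB1.1]
    have e3 : (‖B i‖ ^ 2 + ‖B i - 1‖ ^ 2) * ‖Q‖ ^ 2 ≤ Real.exp (2 * c * τ i) *
        (2 * Real.exp (2 * c * (l.map τ).sum) * (l.map fun i => ‖y i‖ ^ 2).sum) := by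
      gcongr
    have e4 : Real.exp (2 * c * (τ i + (l.map τ).sum)) =
        Real.exp (2 * c * τ i) * Real.exp (2 * c * (l.map τ).sum) := by
      rw [← Real.exp_add]; ring_nf
    have e5 : 1 ≤ Real.exp (2 * c * (τ i + (l.map τ).sum)) := by
      rw [Real.one_le_exp_iff]; positivity
    have e6 : ‖y i‖ ^ 2 ≤ Real.exp (2 * c * (τ i + (l.map τ).sum)) * ‖y i‖ ^ 2 :=
      le_mul_of_one_le_left (by positivity) e5
    rw [e4] at e6 ⊢
    linarith

theorem norm_horner_le {B y : ι → M} {τ : ι → ℝ} {c : ℝ} (hc : 0 ≤ c) (l : List ι)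
    (hτ : ∀ i ∈ l, 0 ≤ τ i) (hB : ∀ i ∈ l, ‖B i‖ ^ 2 ≤ 1 + c * τ i) :
    ‖horner B y l‖ ≤ Real.exp (c * (l.map τ).sum) * (l.map fun i => ‖y i‖).sum := by
  induction l with
  | nil => simp [horner]
  | cons i l ih =>
    simp only [List.forall_mem_cons] at *
    have ih1 := ih hτ.2 hB.2
    simp only [List.map_cons, List.sum_cons, horner]
    set Q := horner B y l
    have hs : 0 ≤ (l.map τ).sum := List.sum_nonneg (by simpa using hτ.2)
    have hct : 0 ≤ c * τ i := mul_nonneg hc hτ.1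
    have hBi : ‖B i‖ ≤ Real.exp (c * τ i) := by
      have := Real.add_one_le_exp (c * τ i)
      nlinarith [hB.1, norm_nonneg (B i)]
    have e0 : ‖B i * Q‖ ≤ Real.exp (c * τ i) * ‖Q‖ := (norm_mul_le _ _).trans (by gcongr)
    have e1 : Real.exp (c * τ i) * ‖Q‖ ≤ Real.exp (c * τ i) *
      (Real.exp (c * (l.map τ).sum) * (l.map fun i => ‖y i‖).sum) := by gcongr
    have e4 : Real.exp (c * (τ i + (l.map τ).sum)) =
        Real.exp (c * τ i) * Real.exp (c * (l.map τ).sum) := by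
      rw [← Real.exp_add]; ring_nf
    have e5 : 1 ≤ Real.exp (c * (τ i + (l.map τ).sum)) := by
      rw [Real.one_le_exp_iff]; have := hτ.1; positivity
    have e6 : ‖y i‖ ≤ Real.exp (c * (τ i + (l.map τ).sum)) * ‖y i‖ :=
      le_mul_of_one_le_left (by positivity) e5
    refine (norm_add_le _ _).trans ?_
    rw [e4] at e6 ⊢
    linarith

/-- The hypothesis says that the adjoints of y i and of the remaining sum have orthogonal ranges, so
squares add exactly and no compression of B is needed. -/
theorem norm_sq_horner_le_of_right {B y : ι → M} {τ : ι → ℝ} {c : ℝ}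
    (hc : 0 ≤ c) (l : List ι) (hτ : ∀ i ∈ l, 0 ≤ τ i) (hB : ∀ i ∈ l, ‖B i‖ ^ 2 ≤ 1 + c * τ i)
    (hy : ∀ i l', i :: l' <:+ l → y i * star (horner B y l') = 0) :
    ‖horner B y l‖ ^ 2 ≤ Real.exp (c * (l.map τ).sum) * (l.map fun i => ‖y i‖ ^ 2).sum := by
  induction l with
  | nil => simp [horner]
  | cons i l ih =>
    simp only [List.forall_mem_cons] at hτ hB
    have ih1 := ih hτ.2 hB.2 fun j l' h => hy j l' (h.trans (List.suffix_cons i l))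
    have h0 := hy i l List.suffix_rfl
    simp only [List.map_cons, List.sum_cons, horner]
    set Q := horner B y l
    have hs : 0 ≤ (l.map τ).sum := List.sum_nonneg (by simpa using hτ.2)
    have hct : 0 ≤ c * τ i := mul_nonneg hc hτ.1
    have h1 : ‖star (y i) + star Q * star (B i)‖ ^ 2 ≤
        ‖star (y i)‖ ^ 2 + ‖star Q * star (B i)‖ ^ 2 :=
      norm_sq_add_le_of_star_mul_eq_zero (by rw [star_star, ← mul_assoc, h0, zero_mul])
    rw [← star_mul, ← star_add, norm_star, norm_star, norm_star] at h1
    refine h1.trans ?_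
    have e0 : ‖B i * Q‖ ^ 2 ≤ Real.exp (c * τ i) * ‖Q‖ ^ 2 := by
      calc _ ≤ (‖B i‖ * ‖Q‖) ^ 2 := by gcongr; exact norm_mul_le _ _
        _ = ‖B i‖ ^ 2 * ‖Q‖ ^ 2 := by ring
        _ ≤ _ := by
          gcongr
          have := Real.add_one_le_exp (c * τ i)
          linarith [hB.1]
    have e1 : Real.exp (c * τ i) * ‖Q‖ ^ 2 ≤ Real.exp (c * τ i) *
      (Real.exp (c * (l.map τ).sum) * (l.map fun i => ‖y i‖ ^ 2).sum) := by gcongr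
    have e4 : Real.exp (c * (τ i + (l.map τ).sum)) =
        Real.exp (c * τ i) * Real.exp (c * (l.map τ).sum) := by
      rw [← Real.exp_add]; ring_nf
    have e5 : 1 ≤ Real.exp (c * (τ i + (l.map τ).sum)) := by
      rw [Real.one_le_exp_iff]; have := hτ.1; positivity
    have e6 : ‖y i‖ ^ 2 ≤ Real.exp (c * (τ i + (l.map τ).sum)) * ‖y i‖ ^ 2 :=
      le_mul_of_one_le_left (by positivity) e5
    rw [e4] at e6 ⊢
    linarith

/-- Term by term, the expanded product is dominated by the expansion of exp (∑ ‖x i‖). Both bounds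
are proved together because the step for the second uses the first. -/
theorem norm_list_prod_one_add_sub_le (x : ι → M) (l : List ι) :
    ‖(l.map fun i => 1 + x i).prod - 1‖ ≤ Real.exp (l.map fun i => ‖x i‖).sum - 1 ∧
    ‖(l.map fun i => 1 + x i).prod - 1 - (l.map x).sum‖ ≤
      Real.exp (l.map fun i => ‖x i‖).sum - 1 - (l.map fun i => ‖x i‖).sum := by
  induction l with
  | nil => simp
  | cons i l ih =>
    simp only [List.map_cons, List.prod_cons, List.sum_cons]
    set Q := (l.map fun i => 1 + x i).prod
    set s := (l.map fun i => ‖x i‖).sum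
    have e : (1 + x i) * Q - 1 = (Q - 1) + x i * (Q - 1) + x i := by noncomm_ring
    have h1 : Real.exp s * (1 + ‖x i‖) ≤ Real.exp (‖x i‖ + s) := by
      rw [Real.exp_add, mul_comm]
      have := Real.add_one_le_exp ‖x i‖
      gcongr; linarith
    have h2 : ‖x i * (Q - 1)‖ ≤ ‖x i‖ * (Real.exp s - 1) :=
      (norm_mul_le _ _).trans (by gcongr; exact ih.1)
    constructor
    · rw [e]
      refine norm_add₃_le.trans ?_
      linarith [ih.1]
    · have e' : (1 + x i) * Q - 1 - (x i + (l.map x).sum) =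
        (Q - 1 - (l.map x).sum) + x i * (Q - 1) := by noncomm_ring
      rw [e']
      refine (norm_add_le _ _).trans ?_
      linarith [ih.2]

theorem exp_sub_one_sub_le (s : ℝ) (hs : 0 ≤ s) : Real.exp s - 1 - s ≤ s ^ 2 * Real.exp s := by
  have h1 := Real.add_one_le_exp (-s)
  have h2 : Real.exp s - 1 ≤ s * Real.exp s := by
    have : Real.exp (-s) * Real.exp s = 1 := by rw [← Real.exp_add]; simp
    nlinarith [Real.exp_pos s]
  nlinarith [Real.add_one_le_exp s]

end Horner

/-! ### Subdivisions -/

/-- The length of the interval `[i.1, i.2]`. -/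
def len (i : ℝ≥0 × ℝ≥0) : ℝ := (i.2 : ℝ) - i.1

/-- `l` lists the intervals of a subdivision of `[p, e]`. -/
inductive IsSteps : ℝ≥0 → List (ℝ≥0 × ℝ≥0) → ℝ≥0 → Prop
  | nil (p : ℝ≥0) : IsSteps p [] p
  | cons {p q e : ℝ≥0} {l : List (ℝ≥0 × ℝ≥0)} (h : p ≤ q) (hl : IsSteps q l e) :
      IsSteps p ((p, q) :: l) e

namespace IsSteps

variable {p e : ℝ≥0} {l : List (ℝ≥0 × ℝ≥0)}

theorem le (h : IsSteps p l e) : p ≤ e := by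
  induction h with
  | nil => exact le_rfl
  | cons h _ ih => exact h.trans ih

theorem sum_len (h : IsSteps p l e) : (l.map len).sum = len (p, e) := by
  induction h with
  | nil => simp [len]
  | cons h _ ih => rw [List.map_cons, List.sum_cons, ih]; simp [len]

theorem bounds (h : IsSteps p l e) : ∀ i ∈ l, p ≤ i.1 ∧ i.1 ≤ i.2 ∧ i.2 ≤ e := by
  induction h with
  | nil => simp
  | cons h hl ih =>
    simp only [List.forall_mem_cons]
    exact ⟨⟨le_rfl, h, hl.le⟩, fun i hi => ⟨h.trans (ih i hi).1, (ih i hi).2⟩⟩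

theorem len_nonneg (h : IsSteps p l e) (i) (hi : i ∈ l) : 0 ≤ len i :=
  sub_nonneg.2 (by exact_mod_cast (h.bounds i hi).2.1)

theorem len_le (h : IsSteps p l e) (i) (hi : i ∈ l) : len i ≤ len (p, e) := by
  obtain ⟨h1, -, h2⟩ := h.bounds i hi
  have h1' : (p : ℝ) ≤ i.1 := by exact_mod_cast h1
  have h2' : (i.2 : ℝ) ≤ e := by exact_mod_cast h2
  simp only [len]; linarith

theorem pairwise (h : IsSteps p l e) : l.Pairwise fun i j => i.1 ≤ i.2 ∧ i.2 ≤ j.1 ∧ j.1 ≤ j.2 := by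
  induction h with
  | nil => exact List.Pairwise.nil
  | cons h hl ih =>
    exact List.pairwise_cons.2 ⟨fun j hj => ⟨h, (hl.bounds j hj).1, (hl.bounds j hj).2.1⟩, ih⟩

end IsSteps

/-! ### Multiplicative noises -/

/-- An additive noise `a` in a `C*`-algebra with drift `L`; the projections `P` represent the
creation parts. -/
structure Noise (M : Type*) [CStarAlgebra M] where
  a : ℝ≥0 × ℝ≥0 → M
  P : ℝ≥0 × ℝ≥0 → M
  L : M
  a_add : ∀ {p q r}, p ≤ q → q ≤ r → a (p, r) = a (p, q) + a (q, r)
  proj : IsProjFamily P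
  orth : ∀ {i j : ℝ≥0 × ℝ≥0}, i.1 ≤ i.2 → i.2 ≤ j.1 → j.1 ≤ j.2 → P i * P j = 0
  mono : ∀ {i j : ℝ≥0 × ℝ≥0}, i.1 ≤ j.1 → j.1 ≤ j.2 → j.2 ≤ i.2 → P i * P j = P j
  P_a : ∀ i, P i * a i = a i
  comm : ∀ i, Commute (P i) L
  ito : ∀ {i : ℝ≥0 × ℝ≥0}, i.1 ≤ i.2 → star (a i) * a i = -(len i • (L + star L))

namespace Noise

variable {M : Type*} [CStarAlgebra M] (N : Noise M)

/-- The increment `a - a^* + τ L`. -/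
def X (i : ℝ≥0 × ℝ≥0) : M := N.a i - star (N.a i) + len i • N.L

/-- The multiplicative increment `1 + a - a^* + τ L`. -/
def g (i : ℝ≥0 × ℝ≥0) : M := 1 + N.X i

/-- The noise obtained by passing to adjoints. -/
def dual : Noise M where
  a i := -N.a i
  P := N.P
  L := star N.L
  a_add h h' := by rw [N.a_add h h', neg_add]
  proj := N.proj
  orth := N.orth
  mono := N.mono
  P_a i := by rw [mul_neg, N.P_a]
  comm i := by
    have := (N.comm i).star_star
    rwa [N.proj.star_eq] at this
  ito h := by rw [star_neg, neg_mul_neg, N.ito h, star_star, add_comm]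

theorem dual_g (i : ℝ≥0 × ℝ≥0) : N.dual.g i = star (N.g i) := by
  simp only [g, X, dual, star_add, star_sub, star_one, star_smul, star_star, star_trivial, star_neg]
  abel

theorem X_add {p q r : ℝ≥0} (h : p ≤ q) (h' : q ≤ r) : N.X (p, r) = N.X (p, q) + N.X (q, r) := by
  have : len (p, r) = len (p, q) + len (q, r) := by simp [len]
  rw [X, X, X, N.a_add h h', this, star_add, add_smul]; abel

theorem star_a_mul_P (i : ℝ≥0 × ℝ≥0) : star (N.a i) * N.P i = star (N.a i) := by
  have := congrArg star (N.P_a i)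
  rwa [star_mul, N.proj.star_eq] at this

theorem P_mul_a_eq_zero {i j : ℝ≥0 × ℝ≥0} (h : N.P i * N.P j = 0) : N.P i * N.a j = 0 := by
  rw [← N.P_a j, ← mul_assoc, h, zero_mul]

theorem star_a_mul_eq_zero {i : ℝ≥0 × ℝ≥0} {z : M} (h : N.P i * z = 0) : star (N.a i) * z = 0 := by
  rw [← N.star_a_mul_P, mul_assoc, h, mul_zero]

theorem star_a_mul_a {i j : ℝ≥0 × ℝ≥0} (h : N.P i * N.P j = 0) : star (N.a i) * N.a j = 0 :=
  N.star_a_mul_eq_zero (N.P_mul_a_eq_zero h)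

theorem comm_star (i : ℝ≥0 × ℝ≥0) : Commute (N.P i) (star N.L) := N.dual.comm i

theorem one_sub_P_mul_a (i : ℝ≥0 × ℝ≥0) : (1 - N.P i) * N.a i = 0 := by
  rw [sub_mul, one_mul, N.P_a, sub_self]

theorem star_a_mul_one_sub_P (i : ℝ≥0 × ℝ≥0) : star (N.a i) * (1 - N.P i) = 0 := by
  rw [mul_sub, mul_one, N.star_a_mul_P, sub_self]

/-- The factor 1 - P kills the creation part from the left and the annihilation part from the right;
the drift part commutes with all projections. -/
theorem compress_g (i : ℝ≥0 × ℝ≥0) : Compress N.P i (N.g i) (1 + len i • N.L) := by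
  have hc : ∀ j, Commute (N.P j) (1 + len i • N.L) := fun j =>
    (Commute.one_right _).add_right ((N.comm j).smul_right _)
  refine ⟨hc, ?_⟩
  have h1 : (1 - N.P i) * N.g i * (1 - N.P i) = (1 - N.P i) * N.a i * (1 - N.P i) -
    (1 - N.P i) * (star (N.a i) * (1 - N.P i)) +
      (1 - N.P i) * (1 + len i • N.L) * (1 - N.P i) := by
    simp only [g, X]; noncomm_ring
  have h2 : Commute (1 - N.P i) (1 + len i • N.L) := (Commute.one_left _).sub_left (hc i)
  have h3 : (1 - N.P i) * (1 - N.P i) = 1 - N.P i := by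
    rw [mul_sub, N.proj.one_sub_mul_self]; simp
  rw [h1, N.one_sub_P_mul_a, N.star_a_mul_one_sub_P, h2.eq, mul_assoc, h3]; simp

theorem g_mul_star_g_sub_one (i : ℝ≥0 × ℝ≥0) :
    N.g i * star (N.g i) - 1 = len i • (N.L + star N.L) + N.X i * star (N.X i) := by
  have h : N.X i + star (N.X i) = len i • (N.L + star N.L) := by
    simp only [X, star_add, star_sub, star_star, star_smul, star_trivial, smul_add]; abel
  rw [← h, g, star_add, star_one]; noncomm_ring

/-- Between two factors 1 - P the mixed terms of X X^* vanish, leaving a^* a and τ² L L^*. By the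
Itô relation a^* a cancels the first-order term τ(L + L^*). This cancellation is what makes the
limit unitary. -/
theorem compress_g_mul_star_g_sub_one {i : ℝ≥0 × ℝ≥0} (hi : i.1 ≤ i.2) :
    Compress N.P i (N.g i * star (N.g i) - 1) (len i ^ 2 • (N.L * star N.L)) := by
  have hc : ∀ j, Commute (N.P j) (N.L * star N.L) := fun j =>
    (N.comm j).mul_right (N.comm_star j)
  refine ⟨fun j => (hc j).smul_right _, ?_⟩
  rw [g_mul_star_g_sub_one]
  set Q := 1 - N.P i with hQ
  have q1 : Q * N.a i = 0 := N.one_sub_P_mul_a i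
  have q2 : star (N.a i) * Q = 0 := N.star_a_mul_one_sub_P i
  have cL : Q * N.L = N.L * Q := ((Commute.one_left _).sub_left (N.comm i)).eq
  have cLs : Q * star N.L = star N.L * Q := ((Commute.one_left _).sub_left (N.comm_star i)).eq
  have hQQ : Q * Q = Q := by rw [hQ, mul_sub, N.proj.one_sub_mul_self]; simp
  have e1 : Q * N.X i = Q * (-star (N.a i) + len i • N.L) := by
    rw [X, sub_eq_add_neg, add_assoc, mul_add, q1, zero_add]
  have e2 : star (N.X i) * Q = (-N.a i + len i • star N.L) * Q := by
    simp only [X, star_add, star_sub, star_star, star_smul, star_trivial, add_mul, sub_mul, q2,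
      neg_mul]
    simp
  have e3 : Q * (N.X i * star (N.X i)) * Q =
      Q * (star (N.a i) * N.a i) * Q - len i • (Q * (star (N.a i) * (star N.L * Q))) -
        len i • (Q * N.L * N.a i * Q) + len i ^ 2 • (Q * N.L * (star N.L * Q)) := by
    rw [mul_assoc Q, mul_assoc (N.X i), e2, ← mul_assoc Q, e1]
    simp only [mul_add, add_mul, neg_mul, mul_neg, mul_smul_comm, smul_mul_assoc, smul_smul,
      ← mul_assoc, smul_add, smul_neg, sq]
    abel
  rw [mul_add, add_mul, e3, N.ito hi, ← cLs, ← mul_assoc (star (N.a i)), q2, cL, mul_assoc N.L Q,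
    q1, mul_assoc N.L Q, ← mul_assoc Q Q, hQQ, cLs]
  simp only [mul_neg, neg_mul, mul_zero, zero_mul, smul_zero, sub_zero, add_neg_cancel_left,
    mul_assoc, smul_mul_assoc]

/-- A bound for the noise coefficients. -/
def bd : ℝ := 9 * ‖N.L + star N.L‖ + 2 * ‖N.L‖ ^ 2 + ‖N.L‖ + 1

theorem one_le_bd : 1 ≤ N.bd := by
  have := norm_nonneg (N.L + star N.L)
  have := norm_nonneg N.L
  rw [bd]; nlinarith

theorem norm_L_le : ‖N.L‖ ≤ N.bd := by
  have := norm_nonneg (N.L + star N.L)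
  rw [bd]; nlinarith [sq_nonneg ‖N.L‖]

theorem norm_sq_a_le' {i : ℝ≥0 × ℝ≥0} (hi : i.1 ≤ i.2) :
    ‖N.a i‖ ^ 2 ≤ ‖N.L + star N.L‖ * len i := by
  have h := CStarRing.norm_star_mul_self (x := N.a i)
  have h0 : 0 ≤ len i := sub_nonneg.2 (by exact_mod_cast hi)
  rw [N.ito hi, norm_neg, norm_smul, Real.norm_of_nonneg h0] at h
  rw [sq, ← h, mul_comm]

theorem norm_sq_a_le {i : ℝ≥0 × ℝ≥0} (hi : i.1 ≤ i.2) : ‖N.a i‖ ^ 2 ≤ N.bd * len i := by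
  have h0 : 0 ≤ len i := sub_nonneg.2 (by exact_mod_cast hi)
  refine (N.norm_sq_a_le' hi).trans ?_
  gcongr
  have := norm_nonneg (N.L + star N.L)
  have := norm_nonneg N.L
  rw [bd]; nlinarith

theorem norm_sq_X_le' {i : ℝ≥0 × ℝ≥0} (hi : i.1 ≤ i.2) (h1 : len i ≤ 1) :
    ‖N.X i‖ ^ 2 ≤ (8 * ‖N.L + star N.L‖ + 2 * ‖N.L‖ ^ 2) * len i := by
  have h0 : 0 ≤ len i := sub_nonneg.2 (by exact_mod_cast hi)
  have h2 : ‖N.X i‖ ≤ 2 * ‖N.a i‖ + len i * ‖N.L‖ := by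
    rw [X]
    refine (norm_add_le _ _).trans ?_
    rw [norm_smul, Real.norm_of_nonneg h0]
    gcongr
    refine (norm_sub_le _ _).trans_eq ?_
    rw [norm_star]; ring
  have h3 := pow_le_pow_left₀ (norm_nonneg _) h2 2
  have h4 := N.norm_sq_a_le' hi
  have h5 : len i * len i ≤ len i := by nlinarith
  nlinarith [sq_nonneg (2 * ‖N.a i‖ - len i * ‖N.L‖),
    mul_le_mul_of_nonneg_left h5 (sq_nonneg ‖N.L‖)]

theorem norm_sq_X_le {i : ℝ≥0 × ℝ≥0} (hi : i.1 ≤ i.2) (h1 : len i ≤ 1) :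
    ‖N.X i‖ ^ 2 ≤ N.bd * len i := by
  have h0 : 0 ≤ len i := sub_nonneg.2 (by exact_mod_cast hi)
  refine (N.norm_sq_X_le' hi h1).trans ?_
  gcongr
  have := norm_nonneg (N.L + star N.L)
  have := norm_nonneg N.L
  rw [bd]; linarith

theorem norm_defect_le {i : ℝ≥0 × ℝ≥0} (hi : i.1 ≤ i.2) (h1 : len i ≤ 1) :
    ‖N.g i * star (N.g i) - 1‖ ≤ N.bd * len i := by
  have h0 : 0 ≤ len i := sub_nonneg.2 (by exact_mod_cast hi)
  rw [g_mul_star_g_sub_one]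
  refine (norm_add_le _ _).trans ?_
  rw [norm_smul, Real.norm_of_nonneg h0, CStarRing.norm_self_mul_star]
  have := N.norm_sq_X_le' hi h1
  have := norm_nonneg N.L
  rw [bd]
  nlinarith

/-- Although g - 1 is only of order √τ, the noise cancels in X + X^*, so g g^* - 1 is of order τ. -/
theorem norm_sq_g_le {i : ℝ≥0 × ℝ≥0} (hi : i.1 ≤ i.2) (h1 : len i ≤ 1) :
    ‖N.g i‖ ^ 2 ≤ 1 + N.bd * len i := by
  rw [sq, ← CStarRing.norm_self_mul_star]
  have h := norm_add_le (1 : M) (N.g i * star (N.g i) - 1)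
  rw [add_sub_cancel] at h
  linarith [norm_one_le M, N.norm_defect_le hi h1]

theorem norm_sq_g_sub_one_le {i : ℝ≥0 × ℝ≥0} (hi : i.1 ≤ i.2) (h1 : len i ≤ 1) :
    ‖N.g i - 1‖ ^ 2 ≤ N.bd * len i := by
  rw [g, add_sub_cancel_left]
  exact N.norm_sq_X_le hi h1

end Noise

/-! ### Products of increments over subdivisions and their block estimates -/

namespace Noise

variable {M : Type*} [CStarAlgebra M] (N : Noise M)

/-- The product of the multiplicative increments over a subdivision. -/
def Theta (l : List (ℝ≥0 × ℝ≥0)) : M := (l.map N.g).prod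

theorem Theta_append (l l' : List (ℝ≥0 × ℝ≥0)) : N.Theta (l ++ l') = N.Theta l * N.Theta l' := by
  simp [Theta]

theorem Theta_cons (i : ℝ≥0 × ℝ≥0) (l : List (ℝ≥0 × ℝ≥0)) :
    N.Theta (i :: l) = N.g i * N.Theta l := by
  simp [Theta]

section Steps

variable {N} {p e : ℝ≥0} {l : List (ℝ≥0 × ℝ≥0)}

theorem _root_.FreeLevy.IsSteps.orth (h : IsSteps p l e) :
    l.Pairwise fun i j => N.P i * N.P j = 0 :=
  h.pairwise.imp fun ⟨h1, h2, h3⟩ => N.orth h1 h2 h3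

/-- Compressions multiply. With Q = 1 - P(p, e), the creation part of the first factor is killed by
Q from the left. Its annihilation part is killed because the tail R satisfies Q' R Q = u Q for Q' =
1 - P(q, e), while P(p, q) Q' = P(p, q) and P(p, q) u Q = u P(p, q) Q = 0. -/
theorem compress_Theta (h : IsSteps p l e) :
    Compress N.P (p, e) (N.Theta l) (l.map fun i => 1 + len i • N.L).prod := by
  induction h with
  | nil p =>
    refine ⟨fun j => by simp, ?_⟩
    have : (1 - N.P (p, p)) * (1 - N.P (p, p)) = 1 - N.P (p, p) := by
      rw [mul_sub, N.proj.one_sub_mul_self]; simp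
    simp [Theta, this]
  | @cons p q e l hpq hl ih =>
    have hqe := hl.le
    rw [List.map_cons, List.prod_cons, Theta_cons]
    set u := (l.map fun i => 1 + len i • N.L).prod
    set R := N.Theta l
    set w := 1 + len (p, q) • N.L
    have hw : ∀ j, Commute (N.P j) w := fun j =>
      (Commute.one_right _).add_right ((N.comm j).smul_right _)
    refine ⟨fun j => (hw j).mul_right (ih.comm j), ?_⟩
    set Q := 1 - N.P (p, e)
    set Q' := 1 - N.P (q, e)
    have h1 : N.P (p, e) * N.P (p, q) = N.P (p, q) := N.mono le_rfl hpq hqe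
    have h2 : N.P (p, e) * N.P (q, e) = N.P (q, e) := N.mono hpq hqe le_rfl
    have h3 : N.P (p, q) * N.P (q, e) = 0 := N.orth hpq le_rfl hqe
    have h1' : N.P (p, q) * Q = 0 := by
      have := congrArg star h1
      rw [star_mul, N.proj.star_eq, N.proj.star_eq] at this
      rw [mul_sub, this]; simp
    have h2' : Q' * Q = Q := by
      have := congrArg star h2
      rw [star_mul, N.proj.star_eq, N.proj.star_eq] at this
      simp only [Q, Q', mul_sub, sub_mul, this]; simp
    have h2'' : Q * Q' = Q := by
      simp only [Q, Q', mul_sub, sub_mul, h2]; simp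
    have h3' : N.P (p, q) * Q' = N.P (p, q) := by rw [mul_sub, h3]; simp
    have hQa : Q * N.a (p, q) = 0 := by
      rw [← N.P_a, ← mul_assoc, sub_mul, h1]; simp
    have hR : Q' * (R * Q) = u * Q := by
      rw [← h2', ← mul_assoc, ← mul_assoc, ih.eq, mul_assoc]
    have ha : star (N.a (p, q)) * (R * Q) = 0 := by
      refine N.star_a_mul_eq_zero ?_
      rw [← h3', mul_assoc, hR, ← mul_assoc, (ih.comm _).eq, mul_assoc, h1', mul_zero]
    have e1 : Q * (N.g (p, q) * R) * Q = Q * N.a (p, q) * R * Q -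
        Q * (star (N.a (p, q)) * (R * Q)) + Q * (w * (R * Q)) := by
      simp only [g, X, w]; noncomm_ring
    have hQw : Q * w = w * Q := ((Commute.one_left _).sub_left (hw _)).eq
    have hR2 : Q * (R * Q) = Q * (u * Q) := by rw [← hR, ← mul_assoc Q Q', h2'']
    rw [e1, hQa, ha, ← mul_assoc Q w, hQw, mul_assoc w, hR2]
    have hu : Q * u = u * Q := ((Commute.one_left _).sub_left (ih.comm _)).eq
    have hQQ : Q * Q = Q := by rw [mul_sub, mul_one, N.proj.one_sub_mul_self]; simp
    rw [← mul_assoc Q u Q, hu, mul_assoc u, hQQ]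
    simp [mul_assoc]

theorem norm_compress_Theta_sub_le (h : IsSteps p l e) (h1 : len (p, e) ≤ 1) :
    ‖(l.map fun i => 1 + len i • N.L).prod - (1 + len (p, e) • N.L)‖ ≤
      N.bd ^ 2 * Real.exp N.bd * len (p, e) ^ 2 := by
  have h2 := (norm_list_prod_one_add_sub_le (fun i => len i • N.L) l).2
  have hs : (l.map fun i => len i • N.L).sum = len (p, e) • N.L := by
    rw [← h.sum_len, List.sum_smul, List.map_map]; rfl
  have hn : (l.map fun i => ‖len i • N.L‖).sum = len (p, e) * ‖N.L‖ := by
    rw [← h.sum_len, ← List.sum_map_mul_right]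
    refine congrArg List.sum (List.map_congr_left fun i hi => ?_)
    rw [norm_smul, Real.norm_of_nonneg (h.len_nonneg i hi)]
  have h0 : 0 ≤ len (p, e) := sub_nonneg.2 (by exact_mod_cast h.le)
  rw [hs, hn] at h2
  rw [← sub_sub]
  have hb := N.norm_L_le
  have hb1 := N.one_le_bd
  refine h2.trans ((exp_sub_one_sub_le _ (by positivity)).trans ?_)
  rw [mul_pow, mul_comm (len (p, e) ^ 2), mul_right_comm]
  gcongr
  nlinarith [norm_nonneg N.L]

/-- The quadratic remainder terms `aᵢ^* a_{>i}^*`. -/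
def rem (N : Noise M) (e : ℝ≥0) (i : ℝ≥0 × ℝ≥0) : M := star (N.a i) * star (N.a (i.2, e))

/-- The recursion Θ(i :: l) - g = X_i X_{>i} + g_i (Θ(l) - g_{>i}), where the subscript >i refers to
the rest of the interval, turns the difference into a Horner sum of the products X_i X_{>i}. These
are sorted by the estimate that applies to them; a_i^* a_{>i} is absent because the ranges are
orthogonal. -/
theorem Theta_sub_eq (h : IsSteps p l e) : N.Theta l - N.g (p, e) =
    horner N.g (fun i => N.a i * N.X (i.2, e)) l +
      horner N.g (fun i => len i • (N.L * N.X (i.2, e))) l -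
      horner N.g (fun i => star (N.a i) * (len (i.2, e) • N.L)) l + horner N.g (N.rem e) l := by
  induction h with
  | nil p =>
    have ha : N.a (p, p) = 0 := by
      have := N.a_add (le_refl p) (le_refl p)
      simpa using this
    simp [Theta, horner, g, X, ha, len]
  | @cons p q e l hpq hl ih =>
    have e1 : N.Theta ((p, q) :: l) - N.g (p, e) =
        N.X (p, q) * N.X (q, e) + N.g (p, q) * (N.Theta l - N.g (q, e)) := by
      rw [Theta_cons, g, g, g, N.X_add hpq hl.le]; noncomm_ring
    have h0 : star (N.a (p, q)) * N.a (q, e) = 0 :=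
      N.star_a_mul_a (N.orth hpq le_rfl hl.le)
    have e2 : N.X (p, q) * N.X (q, e) = N.a (p, q) * N.X (q, e) +
        len (p, q) • (N.L * N.X (q, e)) - star (N.a (p, q)) * (len (q, e) • N.L) +
        N.rem e (p, q) - star (N.a (p, q)) * N.a (q, e) := by
      have e3 : star (N.a (p, q)) * N.X (q, e) = star (N.a (p, q)) * N.a (q, e) - N.rem e (p, q) +
          star (N.a (p, q)) * (len (q, e) • N.L) := by
        rw [X, rem]; noncomm_ring
      have e4 : N.X (p, q) * N.X (q, e) = N.a (p, q) * N.X (q, e) -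
          star (N.a (p, q)) * N.X (q, e) + len (p, q) • (N.L * N.X (q, e)) := by
        rw [X, add_mul, sub_mul, smul_mul_assoc]
      rw [e4, e3]; abel
    rw [e1, ih, e2, h0]; simp only [horner]; noncomm_ring

/-- This supplies the orthogonality needed to sum the double annihilation terms in squares. With
a(p, e) = a(p, q) + a(q, e), the Itô relation reduces a(q, e)^* a(q, e) to the drift, which commutes
with P j, and a(p, q)^* P j = 0 because j lies to the left. -/
theorem star_rem_aux (h : IsSteps p l e) {j : ℝ≥0 × ℝ≥0} (hj : j.1 ≤ j.2) (hjp : j.2 ≤ p) :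
    horner N.g (N.rem e) l * (N.a (p, e) * N.P j) = 0 := by
  induction h with
  | nil => simp [horner]
  | @cons p q e l hpq hl ih =>
    have hqe := hl.le
    have o1 : N.P (q, e) * N.P (p, q) = 0 := N.proj.symm (N.orth hpq le_rfl hqe)
    have o2 : N.P (p, q) * N.P j = 0 := N.proj.symm (N.orth hj hjp hpq)
    have e1 : star (N.a (q, e)) * N.a (p, q) = 0 := N.star_a_mul_a o1
    have e2 : N.rem e (p, q) * (N.a (q, e) * N.P j) = 0 := by
      rw [rem, mul_assoc, ← mul_assoc _ _ (N.P j), N.ito hqe, neg_mul, mul_neg, smul_mul_assoc,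
        ← ((N.comm j).add_right (N.comm_star j)).eq, mul_smul_comm, ← mul_assoc,
        N.star_a_mul_eq_zero o2]
      simp
    have e3 : horner N.g (N.rem e) l * N.P (p, q) = 0 :=
      horner_mul_eq_zero l fun i hi => by
        obtain ⟨b1, b2, b3⟩ := hl.bounds i hi
        rw [rem, mul_assoc, N.star_a_mul_eq_zero (N.proj.symm (N.orth hpq (b1.trans b2) b3)),
          mul_zero]
    rw [horner, N.a_add hpq hqe, add_mul (N.a (p, q)), mul_add, add_mul, add_mul, e2]
    rw [rem, mul_assoc, ← mul_assoc _ (N.a (p, q)), e1, mul_assoc (N.g _), ← N.P_a (p, q),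
      mul_assoc (N.P _), ← mul_assoc _ (N.P (p, q)), e3, mul_assoc (N.g _), ih (hjp.trans hpq)]
    simp

/-- A bound for the products over subdivisions of short intervals. -/
def blockBd (N : Noise M) : ℝ := 12 * Real.exp (2 * N.bd) * N.bd ^ 2

theorem sum_le_of_forall_le {f : ℝ≥0 × ℝ≥0 → ℝ} {β : ℝ} (h : IsSteps p l e)
    (hf : ∀ i ∈ l, f i ≤ β * len i) : (l.map f).sum ≤ β * len (p, e) := by
  rw [← h.sum_len, ← List.sum_map_mul_left]
  exact List.sum_le_sum hf

theorem norm_sq_horner_le_left (h : IsSteps p l e) (h1 : len (p, e) ≤ 1)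
    {y : ℝ≥0 × ℝ≥0 → M} {β : ℝ} (hy : ∀ i ∈ l, N.P i * y i = y i)
    (hβ : ∀ i ∈ l, ‖y i‖ ^ 2 ≤ β * len i) :
    ‖horner N.g y l‖ ^ 2 ≤ 2 * Real.exp (2 * N.bd) * (β * len (p, e)) := by
  have h0 : 0 ≤ len (p, e) := sub_nonneg.2 (by exact_mod_cast h.le)
  have hc : 0 ≤ N.bd := zero_le_one.trans N.one_le_bd
  have hl1 : ∀ i ∈ l, len i ≤ 1 := fun i hi => (h.len_le i hi).trans h1
  have h2 := (norm_sq_horner_le_of_left N.proj (y := y) hc l h.orth h.len_nonneg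
    (fun i hi => N.norm_sq_g_le (h.bounds i hi).2.1 (hl1 i hi))
    (fun i hi => N.norm_sq_g_sub_one_le (h.bounds i hi).2.1 (hl1 i hi)) hy
    (fun i _ => ⟨_, N.compress_g i⟩)).1
  refine h2.trans ?_
  rw [h.sum_len]
  refine mul_le_mul ?_ (sum_le_of_forall_le h hβ) (sum_map_nonneg l fun _ => sq_nonneg _)
    (by positivity)
  exact mul_le_mul_of_nonneg_left (Real.exp_le_exp.2 (by nlinarith)) zero_le_two

theorem norm_sq_horner_le_right (h : IsSteps p l e) (h1 : len (p, e) ≤ 1)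
    {y : ℝ≥0 × ℝ≥0 → M} {β : ℝ}
    (hy : ∀ i l', i :: l' <:+ l → y i * star (horner N.g y l') = 0)
    (hβ : ∀ i ∈ l, ‖y i‖ ^ 2 ≤ β * len i) :
    ‖horner N.g y l‖ ^ 2 ≤ Real.exp (2 * N.bd) * (β * len (p, e)) := by
  have h0 : 0 ≤ len (p, e) := sub_nonneg.2 (by exact_mod_cast h.le)
  have hc : 0 ≤ N.bd := zero_le_one.trans N.one_le_bd
  have hl1 : ∀ i ∈ l, len i ≤ 1 := fun i hi => (h.len_le i hi).trans h1
  have h2 := norm_sq_horner_le_of_right (y := y) hc l h.len_nonneg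
    (fun i hi => N.norm_sq_g_le (h.bounds i hi).2.1 (hl1 i hi)) hy
  refine h2.trans ?_
  rw [h.sum_len]
  refine mul_le_mul ?_ (sum_le_of_forall_le h hβ) (sum_map_nonneg l fun _ => sq_nonneg _)
    (by positivity)
  exact Real.exp_le_exp.2 (by nlinarith)

theorem norm_horner_le_trivial (h : IsSteps p l e) (h1 : len (p, e) ≤ 1)
    {y : ℝ≥0 × ℝ≥0 → M} {β : ℝ} (hβ : ∀ i ∈ l, ‖y i‖ ≤ β * len i) :
    ‖horner N.g y l‖ ≤ Real.exp N.bd * (β * len (p, e)) := by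
  have h0 : 0 ≤ len (p, e) := sub_nonneg.2 (by exact_mod_cast h.le)
  have hc : 0 ≤ N.bd := zero_le_one.trans N.one_le_bd
  have hl1 : ∀ i ∈ l, len i ≤ 1 := fun i hi => (h.len_le i hi).trans h1
  have h2 := norm_horner_le (y := y) hc l h.len_nonneg
    (fun i hi => N.norm_sq_g_le (h.bounds i hi).2.1 (hl1 i hi))
  refine h2.trans ?_
  rw [h.sum_len]
  refine mul_le_mul ?_ (sum_le_of_forall_le h hβ) (sum_map_nonneg l fun _ => norm_nonneg _)
    (by positivity)
  exact Real.exp_le_exp.2 (by nlinarith)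

theorem _root_.FreeLevy.IsSteps.of_suffix (h : IsSteps p l e) {i : ℝ≥0 × ℝ≥0}
    {l' : List (ℝ≥0 × ℝ≥0)} (hl' : i :: l' <:+ l) : i.1 ≤ i.2 ∧ IsSteps i.2 l' e := by
  induction h with
  | nil => simp at hl'
  | @cons p q e l hpq hl ih =>
    rcases List.suffix_cons_iff.1 hl' with h | h
    · obtain ⟨rfl, rfl⟩ := List.cons.inj h
      exact ⟨hpq, hl⟩
    · exact ih h

/-- Since star (a i) absorbs P i on the right and P i commutes with z, it is enough that P i kills
the Horner sum from the right. -/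
theorem star_a_mul_mul_star_horner (N : Noise M) {i : ℝ≥0 × ℝ≥0} {q : ℝ≥0}
    (hi : i.1 ≤ i.2) (hl : IsSteps i.2 l q) (z : M) (hz : ∀ j, Commute (N.P j) z)
    (y : ℝ≥0 × ℝ≥0 → M) (hy : ∀ j ∈ l, N.P i * N.P j = 0 → y j * N.P i = 0) :
    star (N.a i) * z * star (horner N.g y l) = 0 := by
  have h1 : horner N.g y l * N.P i = 0 := horner_mul_eq_zero l fun j hj => by
    obtain ⟨b1, b2, b3⟩ := hl.bounds j hj
    exact hy j hj (N.orth hi b1 b2)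
  have h2 := congrArg star h1
  rw [star_mul, N.proj.star_eq, star_zero] at h2
  rw [← N.star_a_mul_P, mul_assoc (star _), (hz i).eq, mul_assoc, mul_assoc, h2]
  simp

theorem norm_sq_Theta_le (h : IsSteps p l e) (h1 : len (p, e) ≤ 1) :
    ‖N.Theta l‖ ^ 2 ≤ 1 + N.blockBd * len (p, e) := by
  have hc := N.one_le_bd
  have h0 : 0 ≤ len (p, e) := sub_nonneg.2 (by exact_mod_cast h.le)
  have h2 := norm_sq_list_prod_le (G := N.g) l (fun i hi =>
    N.norm_sq_g_le (h.bounds i hi).2.1 ((h.len_le i hi).trans h1))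
  rw [h.sum_len] at h2
  refine h2.trans ?_
  set c := N.bd
  set T := len (p, e)
  have h3 : Real.exp (c * T) - 1 ≤ c * T * Real.exp (c * T) := by
    have : Real.exp (-(c * T)) * Real.exp (c * T) = 1 := by rw [← Real.exp_add]; simp
    nlinarith [Real.exp_pos (c * T), Real.add_one_le_exp (-(c * T))]
  have h4 : c * T * Real.exp (c * T) ≤ c * T * Real.exp (2 * c) := by
    have : Real.exp (c * T) ≤ Real.exp (2 * c) := Real.exp_le_exp.2 (by nlinarith)
    gcongr
  have h5 : 0 ≤ Real.exp (2 * c) * T := by positivity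
  change _ ≤ 1 + 12 * Real.exp (2 * c) * c ^ 2 * T
  have h6 : c ≤ 12 * c ^ 2 := by nlinarith
  have h7 := mul_le_mul_of_nonneg_left h6 h5
  linarith

/-- For an interval of length T ≤ 1, the terms of the first, third and fourth Horner sums satisfy ‖y
i‖² = O(τ_i T), so orthogonality bounds these sums by O(T). The triangle inequality would only give
∑ √τ_i √T, which is not controlled under refinement. The terms with an explicit factor τ_i can be
summed directly. -/
theorem norm_Theta_sub_g_le (h : IsSteps p l e) (h1 : len (p, e) ≤ 1) :
    ‖N.Theta l - N.g (p, e)‖ ≤ N.blockBd * len (p, e) := by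
  have hc := N.one_le_bd
  have h0 : 0 ≤ len (p, e) := sub_nonneg.2 (by exact_mod_cast h.le)
  set c := N.bd
  set T := len (p, e)
  have ht : ∀ i ∈ l, 0 ≤ len (i.2, e) ∧ len (i.2, e) ≤ T := fun i hi => by
    obtain ⟨b1, b2, b3⟩ := h.bounds i hi
    have b1' : (p : ℝ) ≤ i.1 := by exact_mod_cast b1
    have b2' : (i.1 : ℝ) ≤ i.2 := by exact_mod_cast b2
    have b3' : (i.2 : ℝ) ≤ e := by exact_mod_cast b3
    simp only [len, T]; constructor <;> linarith
  have hX : ∀ i ∈ l, ‖N.X (i.2, e)‖ ^ 2 ≤ c * T := fun i hi =>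
    (N.norm_sq_X_le (h.bounds i hi).2.2 ((ht i hi).2.trans h1)).trans (by
      have := (ht i hi).2; gcongr)
  have ha := fun i hi => N.norm_sq_a_le (h.bounds i hi).2.1
  have b1 := norm_sq_horner_le_left h h1 (y := fun i => N.a i * N.X (i.2, e)) (β := c * (c * T))
    (fun i _ => by rw [← mul_assoc, N.P_a]) (fun i hi => by
      calc _ ≤ (‖N.a i‖ * ‖N.X (i.2, e)‖) ^ 2 := by gcongr; exact norm_mul_le _ _
        _ = ‖N.a i‖ ^ 2 * ‖N.X (i.2, e)‖ ^ 2 := by ring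
        _ ≤ (c * len i) * (c * T) := by
          have := h.len_nonneg i hi
          gcongr; exacts [ha i hi, hX i hi]
        _ = _ := by ring)
  have b2 := norm_horner_le_trivial (N := N) h h1 (y := fun i => len i • (N.L * N.X (i.2, e)))
    (β := c * c) (fun i hi => by
      have hn := h.len_nonneg i hi
      have h2 : ‖N.X (i.2, e)‖ ≤ c := by
        refine (abs_le_of_sq_le_sq' ((hX i hi).trans ?_) (by linarith)).2
        nlinarith
      rw [norm_smul, Real.norm_of_nonneg hn, mul_comm]
      have := N.norm_L_le
      gcongr
      exact (norm_mul_le _ _).trans (by gcongr))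
  have b3 := norm_sq_horner_le_right h h1 (y := fun i => star (N.a i) * (len (i.2, e) • N.L))
    (β := c * (c * T) ^ 2)
    (fun i l' hl' => by
      obtain ⟨hi, hs⟩ := h.of_suffix hl'
      refine N.star_a_mul_mul_star_horner hi hs _ (fun j => (N.comm j).smul_right _) _
        fun j _ ho => ?_
      rw [mul_assoc, smul_mul_assoc, ← (N.comm i).eq, mul_smul_comm, ← mul_assoc,
        N.star_a_mul_eq_zero (N.proj.symm ho), zero_mul, smul_zero])
    (fun i hi => by
      have hn := h.len_nonneg i hi
      obtain ⟨t1, t2⟩ := ht i hi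
      have h2 : ‖len (i.2, e) • N.L‖ ≤ c * T := by
        rw [norm_smul, Real.norm_of_nonneg t1, mul_comm]
        have := N.norm_L_le
        gcongr
      calc _ ≤ (‖N.a i‖ * ‖len (i.2, e) • N.L‖) ^ 2 := by
            gcongr; exact (norm_mul_le _ _).trans_eq (by rw [norm_star])
        _ = ‖N.a i‖ ^ 2 * ‖len (i.2, e) • N.L‖ ^ 2 := by ring
        _ ≤ (c * len i) * (c * T) ^ 2 := by gcongr; exact ha i hi
        _ = _ := by ring)
  have b4 := norm_sq_horner_le_right h h1 (y := N.rem e) (β := c * (c * T))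
    (fun i l' hl' => by
      obtain ⟨hi, hs⟩ := h.of_suffix hl'
      have := congrArg star (star_rem_aux (N := N) hs hi le_rfl)
      rw [star_mul, star_mul, N.proj.star_eq, star_zero] at this
      rw [rem, ← N.star_a_mul_P, mul_assoc (star _), mul_assoc, this, mul_zero])
    (fun i hi => by
      have hn := h.len_nonneg i hi
      obtain ⟨t1, t2⟩ := ht i hi
      calc _ ≤ (‖N.a i‖ * ‖N.a (i.2, e)‖) ^ 2 := by
            gcongr; exact (norm_mul_le _ _).trans_eq (by rw [norm_star, norm_star])
        _ = ‖N.a i‖ ^ 2 * ‖N.a (i.2, e)‖ ^ 2 := by ring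
        _ ≤ (c * len i) * (c * T) := by
          gcongr
          · exact ha i hi
          · exact (N.norm_sq_a_le (h.bounds i hi).2.2).trans (by gcongr)
        _ = _ := by ring)
  rw [Theta_sub_eq h]
  set F := Real.exp (2 * c)
  have hF : 1 ≤ F := by rw [Real.one_le_exp_iff]; linarith
  have hT2 : T * T ≤ T := by nlinarith
  have hFc : 0 ≤ F * c ^ 2 * T := by positivity
  have hb2 : Real.exp c * (c * c * T) ≤ F * c ^ 2 * T := by
    have : Real.exp c ≤ F := Real.exp_le_exp.2 (by linarith)
    have h2 : 0 ≤ c * c * T := by positivity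
    nlinarith
  have b1' := (abs_le_of_sq_le_sq' (b := 2 * (F * c ^ 2 * T)) (b1.trans (by
    have : c ^ 2 * T ^ 2 * F * 1 * 1 ≤ c ^ 2 * T ^ 2 * F * F * c ^ 2 := by
      gcongr; nlinarith
    nlinarith)) (by positivity)).2
  have b3' := (abs_le_of_sq_le_sq' (b := F * c ^ 2 * T) (b3.trans (by
    have : c ^ 3 * T ^ 2 * F * 1 * 1 * T ≤ c ^ 3 * T ^ 2 * F * F * c * 1 := by gcongr
    nlinarith)) hFc).2
  have b4' := (abs_le_of_sq_le_sq' (b := F * c ^ 2 * T) (b4.trans (by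
    have : c ^ 2 * T ^ 2 * F * 1 * 1 ≤ c ^ 2 * T ^ 2 * F * F * c ^ 2 := by
      gcongr; nlinarith
    nlinarith)) hFc).2
  change _ ≤ 12 * F * c ^ 2 * T
  refine (norm_add_le _ _).trans ?_
  have := norm_sub_le (horner N.g (fun i => N.a i * N.X (i.2, e)) l +
      horner N.g (fun i => len i • (N.L * N.X (i.2, e))) l)
      (horner N.g (fun i => star (N.a i) * (len (i.2, e) • N.L)) l)
  have := norm_add_le (horner N.g (fun i => N.a i * N.X (i.2, e)) l)
      (horner N.g (fun i => len i • (N.L * N.X (i.2, e))) l)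
  linarith [b2.trans hb2]

/-- Refining a subdivision changes the product by the square root of the mesh. -/
theorem norm_blocks_sub_Theta_le (h : IsSteps p l e) {δ : ℝ} (hδ0 : 0 ≤ δ) (hδ1 : δ ≤ 1)
    (hδ : ∀ i ∈ l, len i ≤ δ) {G : ℝ≥0 × ℝ≥0 → M}
    (hG : ∀ i ∈ l, ∃ l', IsSteps i.1 l' i.2 ∧ G i = N.Theta l') :
    ‖(l.map G).prod - N.Theta l‖ ≤ prodConst N.blockBd N.blockBd (len (p, e)) * √δ := by
  have hc := N.one_le_bd
  have hK : 0 ≤ N.blockBd := by rw [blockBd]; positivity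
  have hcK : N.bd ≤ N.blockBd := by
    have h1 : 1 ≤ Real.exp (2 * N.bd) := by rw [Real.one_le_exp_iff]; linarith
    rw [blockBd]
    nlinarith [mul_nonneg (sub_nonneg.2 h1) (sq_nonneg N.bd)]
  have hl1 : ∀ i ∈ l, len i ≤ 1 := fun i hi => (hδ i hi).trans hδ1
  rw [← h.sum_len]
  refine norm_prod_sub_prod_le_of_compress N.proj hK hK l h.orth hδ0 hδ1 h.len_nonneg hδ
    ?_ ?_ ?_ ?_ ?_
  · intro i hi
    obtain ⟨l', hl', e⟩ := hG i hi
    rw [e]; exact norm_sq_Theta_le hl' (hl1 i hi)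
  · intro i hi
    refine (N.norm_sq_g_le (h.bounds i hi).2.1 (hl1 i hi)).trans ?_
    have := h.len_nonneg i hi
    gcongr
  · intro i hi
    refine (N.norm_sq_g_sub_one_le (h.bounds i hi).2.1 (hl1 i hi)).trans ?_
    have := h.len_nonneg i hi
    gcongr
  · intro i hi
    obtain ⟨l', hl', e⟩ := hG i hi
    rw [e]; exact norm_Theta_sub_g_le hl' (hl1 i hi)
  · intro i hi
    obtain ⟨l', hl', e⟩ := hG i hi
    -- The compressions of a block and of a single increment are ∏ (1 + τ_k L) and 1 + τ L, which
    -- agree to first order.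
    refine ⟨_, _, e ▸ compress_Theta hl', N.compress_g i, ?_⟩
    refine (norm_compress_Theta_sub_le hl' (hl1 i hi)).trans ?_
    gcongr
    rw [blockBd]
    have : Real.exp N.bd ≤ Real.exp (2 * N.bd) := Real.exp_le_exp.2 (by linarith)
    nlinarith [mul_le_mul_of_nonneg_left this (sq_nonneg N.bd),
      mul_nonneg (Real.exp_pos (2 * N.bd)).le (sq_nonneg N.bd)]

theorem norm_Theta_mul_star_sub_one_le (h : IsSteps p l e) {δ : ℝ} (hδ0 : 0 ≤ δ) (hδ1 : δ ≤ 1)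
    (hδ : ∀ i ∈ l, len i ≤ δ) : ‖N.Theta l * star (N.Theta l) - 1‖ ≤
      5 * Real.exp (2 * N.bd * len (p, e)) * N.bd ^ 2 * (1 + len (p, e)) * √δ := by
  have hc := N.one_le_bd
  have hl1 : ∀ i ∈ l, len i ≤ 1 := fun i hi => (hδ i hi).trans hδ1
  rw [← h.sum_len]
  refine norm_prod_mul_star_sub_one_le N.proj (by linarith) (sq_nonneg _) l h.orth hδ0 hδ1
    h.len_nonneg hδ
    (fun i hi => N.norm_sq_g_le (h.bounds i hi).2.1 (hl1 i hi))
    (fun i hi => N.norm_sq_g_sub_one_le (h.bounds i hi).2.1 (hl1 i hi))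
    (fun i _ => ⟨_, N.compress_g i⟩) ?_ ?_
  · intro i hi
    refine (N.norm_defect_le (h.bounds i hi).2.1 (hl1 i hi)).trans ?_
    have := h.len_nonneg i hi
    gcongr; nlinarith
  · intro i hi
    refine ⟨_, N.compress_g_mul_star_g_sub_one (h.bounds i hi).2.1, ?_⟩
    rw [norm_smul, norm_pow, CStarRing.norm_self_mul_star, Real.norm_of_nonneg (h.len_nonneg i hi)]
    have := N.norm_L_le
    have := norm_nonneg N.L
    rw [mul_comm]
    gcongr; nlinarith

/-- The adjoint of Θ is the product of the increments of the dual noise in reversed order, so this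
is the defect estimate for the dual noise along the reversed list. -/
theorem norm_star_Theta_mul_sub_one_le (h : IsSteps p l e) {δ : ℝ} (hδ0 : 0 ≤ δ) (hδ1 : δ ≤ 1)
    (hδ : ∀ i ∈ l, len i ≤ δ) : ‖star (N.Theta l) * N.Theta l - 1‖ ≤
      5 * Real.exp (2 * N.dual.bd * len (p, e)) * N.dual.bd ^ 2 * (1 + len (p, e)) * √δ := by
  have hc := N.dual.one_le_bd
  have hl1 : ∀ i ∈ l, len i ≤ 1 := fun i hi => (hδ i hi).trans hδ1
  have e1 : star (N.Theta l) = (l.reverse.map N.dual.g).prod := by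
    rw [Theta, star_list_map_prod]
    exact congrArg List.prod (List.map_congr_left fun i _ => (N.dual_g i).symm)
  have e2 : N.Theta l = star (l.reverse.map N.dual.g).prod := by rw [← e1, star_star]
  have e3 : (l.reverse.map len).sum = len (p, e) := by
    rw [← h.sum_len, List.map_reverse, List.sum_reverse]
  rw [e1, e2, ← e3]
  refine norm_prod_mul_star_sub_one_le N.dual.proj (by linarith) (sq_nonneg _) l.reverse
    (List.pairwise_reverse.2 (h.orth.imp fun h => N.proj.symm h)) hδ0 hδ1
    (by simpa using h.len_nonneg) (by simpa using hδ)
    (fun i hi => N.dual.norm_sq_g_le (h.bounds i (by simpa using hi)).2.1 (hl1 i (by simpa using hi)))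
    (fun i hi => N.dual.norm_sq_g_sub_one_le (h.bounds i (by simpa using hi)).2.1
      (hl1 i (by simpa using hi)))
    (fun i _ => ⟨_, N.dual.compress_g i⟩) ?_ ?_
  · intro i hi
    rw [List.mem_reverse] at hi
    refine (N.dual.norm_defect_le (h.bounds i hi).2.1 (hl1 i hi)).trans ?_
    have := h.len_nonneg i hi
    gcongr; nlinarith
  · intro i hi
    rw [List.mem_reverse] at hi
    refine ⟨_, N.dual.compress_g_mul_star_g_sub_one (h.bounds i hi).2.1, ?_⟩
    rw [norm_smul, norm_pow, CStarRing.norm_self_mul_star, Real.norm_of_nonneg (h.len_nonneg i hi)]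
    have := N.dual.norm_L_le
    have := norm_nonneg N.dual.L
    rw [mul_comm]
    gcongr; nlinarith

end Steps
end Noise

/-! ### Creation and annihilation operators -/

section Fock

variable {H : Type u} [NormedAddCommGroup H] [InnerProductSpace ℂ H]

theorem inner_completion_completion {E F : Type*} [NormedAddCommGroup E] [InnerProductSpace ℂ E]
    [NormedAddCommGroup F] [InnerProductSpace ℂ F] {f g : E →L[ℂ] F} {c : ℂ}
    (h : ∀ x y, inner ℂ (f x) (g y) = c * inner ℂ x y) (x y : Completion E) :
    inner ℂ (f.completion x) (g.completion y) = c * inner ℂ x y := by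
  induction x, y using Completion.induction_on₂ with
  | hp => exact isClosed_eq (by fun_prop) (by fun_prop)
  | ih x y =>
    rw [ContinuousLinearMap.completion_apply_coe, ContinuousLinearMap.completion_apply_coe,
      Completion.inner_coe, Completion.inner_coe, h]

/-- Creation raises the degree by one, so only the vanishing component of degree zero is lost from
the inner product series. -/
theorem lp_inner_eq_mul_of_shift {G : ℕ → Type*} [∀ n, NormedAddCommGroup (G n)]
    [∀ n, InnerProductSpace ℂ (G n)] {x y x' y' : lp G 2} {c : ℂ} (h0 : x' 0 = 0)
    (h : ∀ n, inner ℂ (x' (n + 1)) (y' (n + 1)) = c * inner ℂ (x n) (y n)) :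
    inner ℂ x' y' = c * inner ℂ x y := by
  have h1 := lp.hasSum_inner (𝕜 := ℂ) x' y'
  have h2 := (lp.hasSum_inner (𝕜 := ℂ) x y).mul_left c
  simp only [← h] at h2
  have h3 := (hasSum_nat_add_iff (f := fun n => inner ℂ (x' n) (y' n)) 1).1 h2
  rw [Finset.sum_range_one, h0, inner_zero_left, add_zero] at h3
  exact h1.unique h3

theorem inner_tensorLeft (h k : H) (n : ℕ) (x y : Completion (tensorPow H n).carrier) :
    inner ℂ (tensorLeft h n x) (tensorLeft k n y) = inner ℂ h k * inner ℂ x y :=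
  inner_completion_completion (E := (tensorPow H n).carrier) (f := tensorLeftAlg h n)
    (g := tensorLeftAlg k n) (fun x y => TensorProduct.inner_tmul (𝕜 := ℂ) h k x y) x y

/-- The squared norm of the difference expands to zero through `inner_tensorLeft`, so no density
argument is needed. -/
theorem tensorLeft_add (h k : H) (n : ℕ) (x : Completion (tensorPow H n).carrier) :
    tensorLeft (h + k) n x = tensorLeft h n x + tensorLeft k n x := by
  rw [← sub_eq_zero, ← inner_self_eq_zero (𝕜 := ℂ)]
  simp only [inner_sub_left, inner_sub_right, inner_add_left, inner_add_right, inner_tensorLeft]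
  ring

theorem tensorLeft_smul (c : ℂ) (h : H) (n : ℕ) (x : Completion (tensorPow H n).carrier) :
    tensorLeft (c • h) n x = c • tensorLeft h n x := by
  rw [← sub_eq_zero, ← inner_self_eq_zero (𝕜 := ℂ)]
  simp only [inner_sub_left, inner_sub_right, inner_smul_left, inner_smul_right, inner_tensorLeft]
  ring

theorem creation_apply_zero (h : H) (x : Fock H) : creation h x 0 = 0 := rfl

theorem creation_add (h k : H) : creation (h + k) = creation h + creation k := by
  refine ContinuousLinearMap.ext fun x => lp.ext (funext fun n => ?_)
  cases n with
  | zero => exact (add_zero (0 : Completion (tensorPow H 0).carrier)).symm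
  | succ n => exact tensorLeft_add h k n (x n)

theorem creation_smul (c : ℂ) (h : H) : creation (c • h) = c • creation h := by
  refine ContinuousLinearMap.ext fun x => lp.ext (funext fun n => ?_)
  cases n with
  | zero => exact (smul_zero (A := Completion (tensorPow H 0).carrier) c).symm
  | succ n => exact tensorLeft_smul c h n (x n)

theorem annihilation_add (h k : H) :
    annihilation (h + k) = annihilation h + annihilation k := by
  simp only [annihilation, creation_add, map_add]

theorem annihilation_smul (c : ℂ) (h : H) :
    annihilation (c • h) = (starRingEnd ℂ c) • annihilation h := by
  simp only [annihilation, creation_smul, map_smulₛₗ]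

theorem star_creation (h : H) : star (creation h) = annihilation h := rfl

theorem star_annihilation (h : H) : star (annihilation h) = creation h := by
  rw [← star_creation, star_star]

/-- The relation of the full Fock space. It yields the Itô relation, the orthogonality of creation
ranges and normal ordering. -/
theorem annihilation_mul_creation (h k : H) :
    annihilation h * creation k = (inner ℂ h k : ℂ) • (1 : Fock H →L[ℂ] Fock H) := by
  refine ContinuousLinearMap.ext fun y => ext_inner_left ℂ fun x => ?_
  change inner ℂ x (annihilation h (creation k y)) = inner ℂ x ((inner ℂ h k : ℂ) • y)
  rw [annihilation, ContinuousLinearMap.adjoint_inner_right, inner_smul_right]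
  exact lp_inner_eq_mul_of_shift (creation_apply_zero h x)
    fun n => inner_tensorLeft h k n (x n) (y n)

theorem annihilation_vacuum (h : H) : annihilation h vacuum = 0 := by
  refine ext_inner_left ℂ fun x => ?_
  rw [annihilation, ContinuousLinearMap.adjoint_inner_right, vacuum, lp.inner_single_right,
    creation_apply_zero, inner_zero_left, inner_zero_right]

theorem inner_vacuum_creation (h : H) (x : Fock H) : inner ℂ vacuum (creation h x) = 0 := by
  rw [← ContinuousLinearMap.adjoint_inner_left]
  change inner ℂ (annihilation h vacuum) x = 0
  rw [annihilation_vacuum, inner_zero_left]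

theorem inner_vacuum_vacuum : inner ℂ (vacuum : Fock H) vacuum = 1 := by
  rw [vacuum, lp.inner_single_left, lp.single_apply_self, Completion.inner_coe]
  refine (EuclideanSpace.inner_single_left (𝕜 := ℂ) PUnit.unit (1 : ℂ)
    (EuclideanSpace.single PUnit.unit (1 : ℂ))).trans ?_
  simp

theorem norm_vacuum : ‖(vacuum : Fock H)‖ = 1 := by
  have h2 : ‖(vacuum : Fock H)‖ ^ 2 = 1 := by
    rw [← inner_self_eq_norm_sq (𝕜 := ℂ), inner_vacuum_vacuum]
    simp
  nlinarith [norm_nonneg (vacuum : Fock H)]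

theorem vacuumState_apply (g : Fock H →L[ℂ] Fock H) :
    vacuumState H g = inner ℂ vacuum (g vacuum) := rfl

theorem norm_vacuumState_le (g : Fock H →L[ℂ] Fock H) : ‖vacuumState H g‖ ≤ ‖g‖ := by
  rw [vacuumState_apply]
  refine (norm_inner_le_norm _ _).trans ?_
  have := g.le_opNorm vacuum
  rw [norm_vacuum] at *
  linarith

theorem isState_vacuumState : IsState (vacuumState H) where
  map_one := inner_vacuum_vacuum
  nonneg a := by
    change 0 ≤ inner ℂ vacuum (ContinuousLinearMap.adjoint a (a vacuum))
    rw [ContinuousLinearMap.adjoint_inner_right]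
    rw [inner_self_eq_norm_sq_to_K]
    have h := Complex.zero_le_real.2 (sq_nonneg ‖a vacuum‖)
    rw [Complex.ofReal_pow] at h
    exact h

/-- The closed subspace spanned by the vectors `A^*(h) ξ`, `h ∈ S`. -/
def creationRange (S : Set H) : Submodule ℂ (Fock H) :=
  (Submodule.span ℂ {ξ | ∃ h ∈ S, ∃ ζ, ξ = creation h ζ}).topologicalClosure

theorem creation_mem_creationRange {S : Set H} {h : H} (hh : h ∈ S) (ζ : Fock H) :
    creation h ζ ∈ creationRange S :=
  Submodule.le_topologicalClosure _ (Submodule.subset_span ⟨h, hh, ζ, rfl⟩)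

theorem creationRange_le {S : Set H} {K : Submodule ℂ (Fock H)} (hK : IsClosed (K : Set (Fock H)))
    (h : ∀ h ∈ S, ∀ ζ, creation h ζ ∈ K) : creationRange S ≤ K :=
  Submodule.topologicalClosure_minimal _ (Submodule.span_le.2 (by
    rintro _ ⟨k, hk, ζ, rfl⟩
    exact h k hk ζ)) hK

instance (S : Set H) : (creationRange S).HasOrthogonalProjection :=
  haveI : CompleteSpace (creationRange S) :=
    (Submodule.isClosed_topologicalClosure _).completeSpace_coe
  inferInstance

theorem creationRange_mono {S T : Set H} (h : S ⊆ T) : creationRange S ≤ creationRange T :=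
  creationRange_le (Submodule.isClosed_topologicalClosure _)
    fun _ hk ζ => creation_mem_creationRange (h hk) ζ

theorem mem_orthogonal_creationRange {S : Set H} {ξ : Fock H} :
    ξ ∈ (creationRange S)ᗮ ↔ ∀ h ∈ S, annihilation h ξ = 0 := by
  constructor
  · intro hξ h hh
    refine ext_inner_left ℂ fun x => ?_
    rw [annihilation, ContinuousLinearMap.adjoint_inner_right, inner_zero_right]
    exact hξ _ (creation_mem_creationRange hh x)
  · intro hξ
    have : creationRange S ≤ (Submodule.span ℂ {ξ})ᗮ := by
      refine creationRange_le (Submodule.isClosed_orthogonal _) fun h hh ζ => ?_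
      rw [Submodule.mem_orthogonal_singleton_iff_inner_left,
        ← ContinuousLinearMap.adjoint_inner_right]
      change inner ℂ ζ (annihilation h ξ) = 0
      rw [hξ h hh, inner_zero_right]
    intro x hx
    exact Submodule.mem_orthogonal_singleton_iff_inner_left.1 (this hx)

theorem creationRange_isOrtho {S T : Set H} (h : ∀ x ∈ S, ∀ y ∈ T, inner ℂ x y = 0) :
    creationRange S ≤ (creationRange T)ᗮ := by
  refine creationRange_le (Submodule.isClosed_orthogonal _) fun x hx ζ => ?_
  rw [mem_orthogonal_creationRange]
  intro y hy
  change (annihilation y * creation x) ζ = 0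
  rw [annihilation_mul_creation, ← inner_conj_symm, h x hx y hy]
  simp

theorem vacuum_mem_orthogonal (S : Set H) : vacuum ∈ (creationRange S)ᗮ :=
  mem_orthogonal_creationRange.2 fun h _ => annihilation_vacuum h

/-- The projection onto the closed span of the vectors `A^*(h) ξ`, `h ∈ S`. -/
def creationProj (S : Set H) : Fock H →L[ℂ] Fock H := (creationRange S).starProjection

theorem star_creationProj (S : Set H) : star (creationProj S) = creationProj S :=
  isSelfAdjoint_starProjection _

theorem creationProj_mul_self (S : Set H) : creationProj S * creationProj S = creationProj S :=
  Submodule.isIdempotentElem_starProjection _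

theorem creationProj_mul_creation {S : Set H} {h : H} (hh : h ∈ S) :
    creationProj S * creation h = creation h :=
  ContinuousLinearMap.ext fun ζ =>
    Submodule.starProjection_eq_self_iff.2 (creation_mem_creationRange hh ζ)

theorem creationProj_mul_of_subset {S T : Set H} (h : S ⊆ T) :
    creationProj T * creationProj S = creationProj S :=
  ContinuousLinearMap.ext fun _ =>
    Submodule.starProjection_eq_self_iff.2
      (creationRange_mono h (Submodule.starProjection_apply_mem _ _))

theorem creationProj_mul_eq_zero {S T : Set H} (h : ∀ x ∈ S, ∀ y ∈ T, inner ℂ x y = 0) :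
    creationProj T * creationProj S = 0 :=
  ContinuousLinearMap.ext fun _ =>
    (Submodule.starProjection_apply_eq_zero_iff (creationRange T)).2
      (creationRange_isOrtho h (Submodule.starProjection_apply_mem _ _))

theorem creationProj_vacuum (S : Set H) : creationProj S vacuum = 0 :=
  (Submodule.starProjection_apply_eq_zero_iff (creationRange S)).2 (vacuum_mem_orthogonal S)

end Fock

/-! ### Indicator vectors -/

section Chi

variable {D : Type u} [NormedAddCommGroup D] [InnerProductSpace ℂ D]

theorem inner_chi (p q r s : ℝ≥0) (v w : D) : inner ℂ (chi p q v) (chi r s w) =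
    (volume.restrict (Set.Ici (0 : ℝ))).real (Set.Icc (p : ℝ) q ∩ Set.Icc r s) • inner ℂ v w := by
  rw [chi, chi, L2.inner_indicatorConstLp_indicatorConstLp measurableSet_Icc measurableSet_Icc
    isCompact_Icc.measure_lt_top.ne isCompact_Icc.measure_lt_top.ne, Completion.inner_coe]

theorem inner_chi_of_le {p q r s : ℝ≥0} (h : q ≤ r) (v w : D) :
    inner ℂ (chi p q v) (chi r s w) = 0 := by
  have h' : (q : ℝ) ≤ r := by exact_mod_cast h
  have hs : Set.Icc (p : ℝ) q ∩ Set.Icc r s ⊆ {(q : ℝ)} := by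
    rintro x ⟨⟨_, h2⟩, h3, _⟩
    exact le_antisymm h2 (h'.trans h3)
  have h0 : (volume.restrict (Set.Ici (0 : ℝ))) (Set.Icc (p : ℝ) q ∩ Set.Icc r s) = 0 :=
    measure_mono_null hs (by
      rw [Measure.restrict_apply (measurableSet_singleton _)]
      exact measure_mono_null Set.inter_subset_left (by simp))
  rw [inner_chi, measureReal_def, h0]; simp

theorem inner_chi_self {p q : ℝ≥0} (h : p ≤ q) (v w : D) :
    inner ℂ (chi p q v) (chi p q w) = (((q : ℝ) - p : ℝ) : ℂ) * inner ℂ v w := by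
  have h' : (p : ℝ) ≤ q := by exact_mod_cast h
  have hs : Set.Icc (p : ℝ) q ∩ Set.Ici 0 = Set.Icc (p : ℝ) q :=
    Set.inter_eq_left.2 fun x hx => le_trans p.2 hx.1
  rw [inner_chi, Set.inter_self, measureReal_def, Measure.restrict_apply measurableSet_Icc, hs,
    Real.volume_Icc, ENNReal.toReal_ofReal (sub_nonneg.2 h')]
  simp

/-- The two identities make the squared norm of the difference vanish, so linearity and additivity
of χ can be read off from inner products without handling almost everywhere classes. -/
theorem chi_eq_of_inner {p q : ℝ≥0} {v : D} {x : L2 D}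
    (h : inner ℂ (chi p q v) (chi p q v) = inner ℂ (chi p q v) x)
    (h' : inner ℂ x x = inner ℂ (chi p q v) x) : chi p q v = x := by
  rw [← sub_eq_zero, ← inner_self_eq_zero (𝕜 := ℂ), inner_sub_left, inner_sub_right,
    inner_sub_right, h, h', ← inner_conj_symm x, ← h, inner_conj_symm, sub_self]

theorem chi_add (p q : ℝ≥0) (v w : D) : chi p q (v + w) = chi p q v + chi p q w :=
  chi_eq_of_inner (by simp only [inner_add_right, inner_chi, smul_add])
    (by simp only [inner_add_right, inner_add_left, inner_chi, smul_add])

theorem chi_smul (p q : ℝ≥0) (c : ℂ) (v : D) : chi p q (c • v) = c • chi p q v :=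
  chi_eq_of_inner
    (by simp only [inner_smul_right, inner_chi, Complex.real_smul]; ring)
    (by simp only [inner_smul_right, inner_smul_left, inner_chi, Complex.real_smul]; ring)

theorem chi_split {p q r : ℝ≥0} (h : p ≤ q) (h' : q ≤ r) (v : D) :
    chi p r v = chi p q v + chi q r v := by
  have h1 : inner ℂ (chi q r v) (chi p q v) = 0 := by
    rw [← inner_conj_symm, inner_chi_of_le le_rfl, map_zero]
  have e1 : Set.Icc (p : ℝ) r ∩ Set.Icc p q = Set.Icc (p : ℝ) q ∩ Set.Icc p q := by
    rw [Set.inter_self]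
    exact Set.inter_eq_right.2 (Set.Icc_subset_Icc_right (by exact_mod_cast h'))
  have e2 : Set.Icc (p : ℝ) r ∩ Set.Icc q r = Set.Icc (q : ℝ) r ∩ Set.Icc q r := by
    rw [Set.inter_self]
    exact Set.inter_eq_right.2 (Set.Icc_subset_Icc_left (by exact_mod_cast h))
  have h2 : inner ℂ (chi p r v) (chi p q v + chi q r v) =
      (((q : ℝ) - p : ℝ) : ℂ) * inner ℂ v v + (((r : ℝ) - q : ℝ) : ℂ) * inner ℂ v v := by
    rw [inner_add_right, inner_chi, inner_chi, e1, e2, ← inner_chi, ← inner_chi,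
      inner_chi_self h, inner_chi_self h']
  refine chi_eq_of_inner ?_ ?_
  · rw [h2, inner_chi_self (h.trans h')]
    push_cast
    ring
  · rw [h2, inner_add_right, inner_add_left, inner_add_left, inner_chi_self h, inner_chi_self h',
      h1, inner_chi_of_le le_rfl]
    ring

end Chi

/-! ### Subdivisions given by finite sets of points -/

/-- The consecutive pairs of a list. -/
def pairs (l : List ℝ≥0) : List (ℝ≥0 × ℝ≥0) := l.zip l.tail

theorem pairs_append (l l' : List ℝ≥0) (q : ℝ≥0) :
    pairs (l ++ q :: l') = pairs (l ++ [q]) ++ pairs (q :: l') := by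
  induction l with
  | nil => simp [pairs]
  | cons p l ih =>
    cases l with
    | nil => simp [pairs]
    | cons p' l => simpa [pairs] using ih

theorem isSteps_pairs (l : List ℝ≥0) (p e : ℝ≥0) (h : (p :: (l ++ [e])).Pairwise (· ≤ ·)) :
    IsSteps p (pairs (p :: (l ++ [e]))) e := by
  induction l generalizing p with
  | nil => exact IsSteps.cons (by simpa using h) (IsSteps.nil e)
  | cons q l ih =>
    have h' := List.pairwise_cons.1 h
    exact IsSteps.cons (h'.1 q (by simp)) (ih q h'.2)

theorem sort_filter_append (β : Finset ℝ≥0) {P Q R : ℝ≥0 → Prop} [DecidablePred P]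
    [DecidablePred Q] [DecidablePred R] (h : ∀ t, P t ↔ Q t ∨ R t)
    (h' : ∀ s t, Q s → R t → s < t) :
    (β.filter P).sort (· ≤ ·) = (β.filter Q).sort (· ≤ ·) ++ (β.filter R).sort (· ≤ ·) := by
  have e : β.filter P = ((β.filter Q).sort (· ≤ ·) ++ (β.filter R).sort (· ≤ ·)).toFinset := by
    ext t
    simp [h t, and_or_left]
  rw [e, List.toFinset_sort]
  · rw [List.pairwise_append]
    refine ⟨Finset.pairwise_sort _ _, Finset.pairwise_sort _ _, fun s hs t ht => (h' s t ?_ ?_).le⟩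
    · exact (Finset.mem_filter.1 ((Finset.mem_sort _).1 hs)).2
    · exact (Finset.mem_filter.1 ((Finset.mem_sort _).1 ht)).2
  · rw [List.nodup_append]
    refine ⟨Finset.sort_nodup _ _, Finset.sort_nodup _ _, fun s hs t ht => (h' s t ?_ ?_).ne⟩
    · exact (Finset.mem_filter.1 ((Finset.mem_sort _).1 hs)).2
    · exact (Finset.mem_filter.1 ((Finset.mem_sort _).1 ht)).2

theorem sort_filter_eq (β : Finset ℝ≥0) {q : ℝ≥0} (hq : q ∈ β) {P : ℝ≥0 → Prop}
    [DecidablePred P] (h : ∀ t, P t ↔ t = q) : (β.filter P).sort (· ≤ ·) = [q] := by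
  have : β.filter P = {q} := by
    ext t
    simp only [Finset.mem_filter, h, Finset.mem_singleton]
    exact ⟨fun h => h.2, fun h => ⟨h ▸ hq, h⟩⟩
  rw [this, Finset.sort_singleton]

/-- The subdivision of `[p, q]` by the points of `β` in it. -/
def subdiv (β : Finset ℝ≥0) (p q : ℝ≥0) : List (ℝ≥0 × ℝ≥0) :=
  pairs ((β.filter fun t => p ≤ t ∧ t ≤ q).sort (· ≤ ·))

theorem subdiv_append {β : Finset ℝ≥0} {p q r : ℝ≥0} (hq : q ∈ β) (h : p ≤ q) (h' : q ≤ r) :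
    subdiv β p r = subdiv β p q ++ subdiv β q r := by
  have e1 := sort_filter_eq β hq (P := (· = q)) fun t => Iff.rfl
  have e2 := sort_filter_append β (P := fun t => p ≤ t ∧ t ≤ q) (Q := fun t => p ≤ t ∧ t < q)
    (R := (· = q)) (fun t => ⟨fun ⟨h1, h2⟩ => h2.lt_or_eq.imp (⟨h1, ·⟩) id, by
      rintro (⟨h1, h2⟩ | rfl); exacts [⟨h1, h2.le⟩, ⟨h, le_rfl⟩]⟩)
    (by rintro s t ⟨_, h⟩ rfl; exact h)
  have e3 := sort_filter_append β (P := fun t => q ≤ t ∧ t ≤ r) (Q := (· = q))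
    (R := fun t => q < t ∧ t ≤ r) (fun t => ⟨fun ⟨h1, h2⟩ => h1.eq_or_lt.imp Eq.symm (⟨·, h2⟩), by
      rintro (rfl | ⟨h1, h2⟩); exacts [⟨le_rfl, h'⟩, ⟨h1.le, h2⟩]⟩)
    (by rintro s t rfl ⟨h, _⟩; exact h)
  have e4 := sort_filter_append β (P := fun t => p ≤ t ∧ t ≤ r) (Q := fun t => p ≤ t ∧ t < q)
    (R := fun t => q ≤ t ∧ t ≤ r) (fun t => ⟨fun ⟨h1, h2⟩ => (lt_or_ge t q).imp (⟨h1, ·⟩) (⟨·, h2⟩),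
      by rintro (⟨h1, h2⟩ | ⟨h1, h2⟩); exacts [⟨h1, h2.le.trans h'⟩, ⟨h.trans h1, h2⟩]⟩)
    (fun s t h1 h2 => h1.2.trans_le h2.1)
  rw [subdiv, subdiv, subdiv, e4, e3, e2, e1]
  exact pairs_append _ _ _

theorem subdiv_self {β : Finset ℝ≥0} {p : ℝ≥0} (hp : p ∈ β) : subdiv β p p = [] := by
  rw [subdiv, sort_filter_eq β hp fun t => ⟨fun h => le_antisymm h.2 h.1, by rintro rfl; simp⟩]
  rfl

theorem isSteps_subdiv {β : Finset ℝ≥0} {p q : ℝ≥0} (hp : p ∈ β) (hq : q ∈ β) (h : p ≤ q) :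
    IsSteps p (subdiv β p q) q := by
  obtain rfl | hlt := h.eq_or_lt
  · rw [subdiv_self hp]; exact IsSteps.nil p
  have e1 := sort_filter_eq β hp (P := (· = p)) fun t => Iff.rfl
  have e1' := sort_filter_eq β hq (P := (· = q)) fun t => Iff.rfl
  have e2 := sort_filter_append β (P := fun t => p < t ∧ t ≤ q) (Q := fun t => p < t ∧ t < q)
    (R := (· = q)) (fun t => ⟨fun ⟨h1, h2⟩ => h2.lt_or_eq.imp (⟨h1, ·⟩) id, by
      rintro (⟨h1, h2⟩ | rfl); exacts [⟨h1, h2.le⟩, ⟨hlt, le_rfl⟩]⟩)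
    (by rintro s t ⟨_, h⟩ rfl; exact h)
  have e3 := sort_filter_append β (P := fun t => p ≤ t ∧ t ≤ q) (Q := (· = p))
    (R := fun t => p < t ∧ t ≤ q) (fun t => ⟨fun ⟨h1, h2⟩ => h1.eq_or_lt.imp Eq.symm (⟨·, h2⟩), by
      rintro (rfl | ⟨h1, h2⟩); exacts [⟨le_rfl, h⟩, ⟨h1.le, h2⟩]⟩)
    (by rintro s t rfl ⟨h, _⟩; exact h)
  have hs := Finset.pairwise_sort (β.filter fun t => p ≤ t ∧ t ≤ q) (· ≤ ·)
  rw [e3, e2, e1, e1'] at hs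
  rw [subdiv, e3, e2, e1, e1']
  exact isSteps_pairs _ _ _ hs

theorem subdiv_congr {α β : Finset ℝ≥0} {p q : ℝ≥0} (h : ∀ t, p ≤ t → t ≤ q → (t ∈ α ↔ t ∈ β)) :
    subdiv α p q = subdiv β p q := by
  rw [subdiv, subdiv]
  congr 2
  ext t
  simp only [Finset.mem_filter]
  exact ⟨fun ⟨h1, h2, h3⟩ => ⟨(h t h2 h3).1 h1, h2, h3⟩,
    fun ⟨h1, h2, h3⟩ => ⟨(h t h2 h3).2 h1, h2, h3⟩⟩

/-- The intervals of `l` have length at most `δ`. -/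
def MeshLE (l : List (ℝ≥0 × ℝ≥0)) (δ : ℝ) : Prop := ∀ i ∈ l, len i ≤ δ

theorem IsSteps.mem_of_mem_pairs {β : Finset ℝ≥0} {p q : ℝ≥0} {i : ℝ≥0 × ℝ≥0}
    (hi : i ∈ subdiv β p q) : i.1 ∈ β ∧ i.2 ∈ β := by
  have h1 := List.of_mem_zip (show (i.1, i.2) ∈ _ from hi)
  exact ⟨(Finset.mem_filter.1 ((Finset.mem_sort _).1 h1.1)).1,
    (Finset.mem_filter.1 ((Finset.mem_sort _).1 (List.mem_of_mem_tail h1.2))).1⟩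

/-- A finer subdivision is composed of subdivisions of the intervals of the coarser one. -/
theorem IsSteps.flatMap_subdiv {β : Finset ℝ≥0} {p q : ℝ≥0} {l : List (ℝ≥0 × ℝ≥0)}
    (h : IsSteps p l q) (hp : p ∈ β) (hl : ∀ i ∈ l, i.2 ∈ β) :
    l.flatMap (fun i => subdiv β i.1 i.2) = subdiv β p q := by
  induction h with
  | nil p => rw [subdiv_self hp]; rfl
  | @cons p r q l hpr hl' ih =>
    have hr := hl (p, r) (by simp)
    rw [List.flatMap_cons, ih hr fun i hi => hl i (by simp [hi])]
    exact (subdiv_append hr hpr hl'.le).symm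

theorem flatMap_subdiv {α β : Finset ℝ≥0} (hαβ : α ⊆ β) {p q : ℝ≥0} (hp : p ∈ α) (hq : q ∈ α)
    (h : p ≤ q) : (subdiv α p q).flatMap (fun i => subdiv β i.1 i.2) = subdiv β p q :=
  (isSteps_subdiv hp hq h).flatMap_subdiv (hαβ hp)
    fun _ hi => hαβ (IsSteps.mem_of_mem_pairs hi).2

theorem MeshLE.mono {α β : Finset ℝ≥0} (hαβ : α ⊆ β) {p q : ℝ≥0} (hp : p ∈ α) (hq : q ∈ α)
    (h : p ≤ q) {δ : ℝ} (hm : MeshLE (subdiv α p q) δ) : MeshLE (subdiv β p q) δ := by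
  rw [← flatMap_subdiv hαβ hp hq h]
  intro i hi
  obtain ⟨j, hj, hi⟩ := List.mem_flatMap.1 hi
  have hj' := IsSteps.mem_of_mem_pairs hj
  exact ((isSteps_subdiv (hαβ hj'.1) (hαβ hj'.2)
    ((isSteps_subdiv hp hq h).bounds j hj).2.1).len_le i hi).trans (hm j hj)

theorem MeshLE.append {l l' : List (ℝ≥0 × ℝ≥0)} {δ : ℝ} (h : MeshLE l δ) (h' : MeshLE l' δ) :
    MeshLE (l ++ l') δ := fun i hi => (List.mem_append.1 hi).elim (h i) (h' i)

/-- Induction on the number of steps of length δ needed, peeling off the last interval. -/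
theorem exists_meshLE {δ : ℝ} (hδ : 0 < δ) {p q : ℝ≥0} (h : p ≤ q) :
    ∃ β : Finset ℝ≥0, p ∈ β ∧ q ∈ β ∧ MeshLE (subdiv β p q) δ := by
  lift δ to ℝ≥0 using hδ.le
  obtain ⟨n, hn⟩ := exists_nat_ge (((q : ℝ) - p) / δ)
  rw [div_le_iff₀ hδ] at hn
  induction n generalizing q with
  | zero =>
    have : q = p := le_antisymm (by
      have : (q : ℝ) ≤ p := by simpa using hn
      exact_mod_cast this) h
    subst this
    refine ⟨{q}, by simp, by simp, ?_⟩
    rw [subdiv_self (by simp)]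
    simp [MeshLE]
  | succ n ih =>
    -- The maximum with p keeps the new endpoint inside the interval and makes the truncated
    -- subtraction harmless: if q < δ, then q' = p.
    set q' : ℝ≥0 := max p (q - δ) with hq'
    have h1 : p ≤ q' := le_max_left _ _
    have h2 : q' ≤ q := max_le h tsub_le_self
    have h3 : (q : ℝ) - δ ≤ q' := by
      have : q ≤ q' + δ := tsub_le_iff_right.1 (le_max_right _ _)
      have : (q : ℝ) ≤ q' + δ := by exact_mod_cast this
      linarith
    have h4 : (q' : ℝ) - p ≤ n * δ := by
      rcases max_cases p (q - δ) with ⟨e, _⟩ | ⟨e, e'⟩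
      · rw [hq', e, sub_self]; positivity
      · have h5 : δ ≤ q := by
          by_contra hc
          rw [tsub_eq_zero_of_le (not_le.1 hc).le] at e'
          exact absurd e' (not_lt.2 bot_le)
        have : ((q - δ : ℝ≥0) : ℝ) = q - δ := NNReal.coe_sub h5
        rw [hq', e, this]
        push_cast at hn
        linarith
    obtain ⟨β, hp, hq, hβ⟩ := ih h1 h4
    have hs := Finset.subset_insert q β
    refine ⟨insert q β, hs hp, by simp, ?_⟩
    rw [subdiv_append (hs hq) h1 h2]
    refine (hβ.mono hs hp hq h1).append fun i hi => ?_
    refine ((isSteps_subdiv (hs hq) (by simp) h2).len_le i hi).trans ?_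
    simp only [len]; linarith

/-! ### Limits over subdivisions -/

namespace Noise

variable {M : Type*} [CStarAlgebra M] (N : Noise M)

/-- The constant in the estimates for refinements. -/
def refineBd (p q : ℝ≥0) : ℝ := prodConst N.blockBd N.blockBd (len (p, q))

/-- The finer product is the product, over the coarser intervals, of the blocks inside them. -/
theorem norm_Theta_subdiv_sub_le {α β : Finset ℝ≥0} (hαβ : α ⊆ β) {p q : ℝ≥0} (hp : p ∈ α)
    (hq : q ∈ α) (h : p ≤ q) {δ : ℝ} (hδ0 : 0 ≤ δ) (hδ1 : δ ≤ 1)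
    (hm : MeshLE (subdiv α p q) δ) :
    ‖N.Theta (subdiv β p q) - N.Theta (subdiv α p q)‖ ≤ N.refineBd p q * √δ := by
  have h1 : N.Theta (subdiv β p q) =
      ((subdiv α p q).map fun i => N.Theta (subdiv β i.1 i.2)).prod := by
    rw [← flatMap_subdiv hαβ hp hq h]
    generalize subdiv α p q = l
    induction l with
    | nil => rfl
    | cons i l ih => rw [List.flatMap_cons, Theta_append, ih]; simp
  rw [h1]
  refine norm_blocks_sub_Theta_le (isSteps_subdiv hp hq h) hδ0 hδ1 hm fun i hi => ?_
  have hi' := IsSteps.mem_of_mem_pairs hi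
  exact ⟨_, isSteps_subdiv (hαβ hi'.1) (hαβ hi'.2) ((isSteps_subdiv hp hq h).bounds i hi).2.1, rfl⟩

/-- A sequence of ever finer subdivisions. -/
def grid (p q : ℝ≥0) (n : ℕ) : Finset ℝ≥0 :=
  if h : p ≤ q then (exists_meshLE (Nat.one_div_pos_of_nat (n := n) (α := ℝ)) h).choose else ∅

theorem grid_spec {p q : ℝ≥0} (h : p ≤ q) (n : ℕ) : p ∈ grid p q n ∧ q ∈ grid p q n ∧
    MeshLE (subdiv (grid p q n) p q) (1 / ((n : ℝ) + 1)) := by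
  rw [grid, dif_pos h]
  exact (exists_meshLE (Nat.one_div_pos_of_nat (n := n) (α := ℝ)) h).choose_spec

/-- The limit of the products `Θ` over subdivisions of `[p, q]`. -/
def U (p q : ℝ≥0) : M := limUnder atTop fun n => N.Theta (subdiv (grid p q n) p q)

theorem tendsto_sqrt_one_div : Tendsto (fun n : ℕ => √(1 / ((n : ℝ) + 1))) atTop (𝓝 0) := by
  have := (Real.continuous_sqrt.tendsto 0).comp
    (tendsto_one_div_add_atTop_nhds_zero_nat (𝕜 := ℝ))
  rw [Real.sqrt_zero] at this
  exact this

theorem one_div_le_one (n : ℕ) : 1 / ((n : ℝ) + 1) ≤ 1 := by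
  rw [div_le_one (by positivity)]; linarith [n.cast_nonneg (α := ℝ)]

/-- Both products are compared with the product over the common refinement. -/
theorem dist_Theta_grid_le {p q : ℝ≥0} (h : p ≤ q) {α : Finset ℝ≥0} (hp : p ∈ α) (hq : q ∈ α)
    {δ : ℝ} (hδ0 : 0 ≤ δ) (hδ1 : δ ≤ 1) (hm : MeshLE (subdiv α p q) δ) (n : ℕ) :
    dist (N.Theta (subdiv α p q)) (N.Theta (subdiv (grid p q n) p q)) ≤
      N.refineBd p q * √δ + N.refineBd p q * √(1 / ((n : ℝ) + 1)) := by
  obtain ⟨h1, h2, h3⟩ := grid_spec h n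
  refine (dist_triangle_left _ _ (N.Theta (subdiv (α ∪ grid p q n) p q))).trans (add_le_add ?_ ?_)
  · rw [dist_eq_norm]
    exact N.norm_Theta_subdiv_sub_le Finset.subset_union_left hp hq h hδ0 hδ1 hm
  · rw [dist_eq_norm]
    exact N.norm_Theta_subdiv_sub_le Finset.subset_union_right h1 h2 h (by positivity)
      (one_div_le_one n) h3

theorem tendsto_grid {p q : ℝ≥0} (h : p ≤ q) :
    Tendsto (fun n => N.Theta (subdiv (grid p q n) p q)) atTop (𝓝 (N.U p q)) := by
  refine CauchySeq.tendsto_limUnder ?_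
  refine cauchySeq_of_le_tendsto_0 (fun n => |N.refineBd p q| * √(1 / ((n : ℝ) + 1)) +
    |N.refineBd p q| * √(1 / ((n : ℝ) + 1))) (fun n m k hn hm => ?_) ?_
  · obtain ⟨h1, h2, h3⟩ := grid_spec h n
    refine (N.dist_Theta_grid_le h h1 h2 (by positivity) (one_div_le_one n) h3 m).trans ?_
    have hkn : √(1 / ((n : ℝ) + 1)) ≤ √(1 / ((k : ℝ) + 1)) := by
      gcongr
    have hkm : √(1 / ((m : ℝ) + 1)) ≤ √(1 / ((k : ℝ) + 1)) := by
      gcongr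
    have := le_abs_self (N.refineBd p q)
    gcongr
  · simpa using (tendsto_sqrt_one_div.const_mul |N.refineBd p q|).add
      (tendsto_sqrt_one_div.const_mul |N.refineBd p q|)

theorem norm_Theta_sub_U_le {p q : ℝ≥0} (h : p ≤ q) {α : Finset ℝ≥0} (hp : p ∈ α) (hq : q ∈ α)
    {δ : ℝ} (hδ0 : 0 ≤ δ) (hδ1 : δ ≤ 1) (hm : MeshLE (subdiv α p q) δ) :
    dist (N.Theta (subdiv α p q)) (N.U p q) ≤ N.refineBd p q * √δ := by
  have h1 := (tendsto_const_nhds (x := N.Theta (subdiv α p q))).dist (N.tendsto_grid h)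
  have h2 := (tendsto_sqrt_one_div.const_mul (N.refineBd p q)).const_add (N.refineBd p q * √δ)
  rw [mul_zero, add_zero] at h2
  exact le_of_tendsto_of_tendsto' h1 h2 fun n => N.dist_Theta_grid_le h hp hq hδ0 hδ1 hm n

theorem tendsto_Theta_of_meshLE {p q : ℝ≥0} (h : p ≤ q) {α : ℕ → Finset ℝ≥0} (hp : ∀ n, p ∈ α n)
    (hq : ∀ n, q ∈ α n) (hm : ∀ n, MeshLE (subdiv (α n) p q) (1 / ((n : ℝ) + 1))) :
    Tendsto (fun n => N.Theta (subdiv (α n) p q)) atTop (𝓝 (N.U p q)) := by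
  rw [tendsto_iff_dist_tendsto_zero]
  refine squeeze_zero (fun _ => dist_nonneg) (fun n => N.norm_Theta_sub_U_le h (hp n) (hq n)
    (by positivity) (one_div_le_one n) (hm n)) ?_
  simpa using tendsto_sqrt_one_div.const_mul (N.refineBd p q)

/-- Carries a closed condition from all subdivision products to their limit: norm estimates as well
as membership in a closed algebra. -/
theorem U_mem_of_isClosed {p q : ℝ≥0} (h : p ≤ q) {S : Set M} (hS : IsClosed S)
    (hl : ∀ l, IsSteps p l q → N.Theta l ∈ S) : N.U p q ∈ S :=
  hS.mem_of_tendsto (N.tendsto_grid h) (Eventually.of_forall fun n =>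
    hl _ (isSteps_subdiv (grid_spec h n).1 (grid_spec h n).2.1 h))

theorem U_self (p : ℝ≥0) : N.U p p = 1 := by
  refine tendsto_nhds_unique (N.tendsto_grid (le_refl p)) ?_
  refine tendsto_const_nhds.congr fun n => ?_
  rw [subdiv_self (grid_spec le_rfl n).1]
  rfl

/-- The union of grids for the two intervals contains q, so the product over [p, r] factors there
exactly, and the mesh bounds survive the union. -/
theorem U_mul {p q r : ℝ≥0} (h : p ≤ q) (h' : q ≤ r) : N.U p q * N.U q r = N.U p r := by
  have s1 : ∀ n, grid p q n ⊆ grid p q n ∪ grid q r n := fun n => Finset.subset_union_left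
  have s2 : ∀ n, grid q r n ⊆ grid p q n ∪ grid q r n := fun n => Finset.subset_union_right
  have g1 := grid_spec h
  have g2 := grid_spec h'
  have m1 := fun n => (g1 n).2.2.mono (s1 n) (g1 n).1 (g1 n).2.1 h
  have m2 := fun n => (g2 n).2.2.mono (s2 n) (g2 n).1 (g2 n).2.1 h'
  have e := fun n => subdiv_append (s1 n (g1 n).2.1) h h'
  have t1 := N.tendsto_Theta_of_meshLE h (fun n => s1 n (g1 n).1) (fun n => s1 n (g1 n).2.1) m1
  have t2 := N.tendsto_Theta_of_meshLE h' (fun n => s2 n (g2 n).1) (fun n => s2 n (g2 n).2.1) m2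
  have t3 := N.tendsto_Theta_of_meshLE (h.trans h') (fun n => s1 n (g1 n).1)
    (fun n => s2 n (g2 n).2.1) (fun n => by rw [e n]; exact (m1 n).append (m2 n))
  refine tendsto_nhds_unique (t1.mul t2) (t3.congr fun n => ?_)
  rw [e n, Theta_append]

theorem U_mul_star {p q : ℝ≥0} (h : p ≤ q) : N.U p q * star (N.U p q) = 1 := by
  have t1 := N.tendsto_grid h
  refine tendsto_nhds_unique (t1.mul t1.star) ?_
  rw [tendsto_iff_norm_sub_tendsto_zero]
  refine squeeze_zero (fun _ => norm_nonneg _) (fun n => norm_Theta_mul_star_sub_one_le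
    (isSteps_subdiv (grid_spec h n).1 (grid_spec h n).2.1 h)
    (by positivity) (one_div_le_one n) (grid_spec h n).2.2) ?_
  simpa using tendsto_sqrt_one_div.const_mul _

theorem star_U_mul {p q : ℝ≥0} (h : p ≤ q) : star (N.U p q) * N.U p q = 1 := by
  have t1 := N.tendsto_grid h
  refine tendsto_nhds_unique (t1.star.mul t1) ?_
  rw [tendsto_iff_norm_sub_tendsto_zero]
  refine squeeze_zero (fun _ => norm_nonneg _) (fun n => norm_star_Theta_mul_sub_one_le
    (isSteps_subdiv (grid_spec h n).1 (grid_spec h n).2.1 h)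
    (by positivity) (one_div_le_one n) (grid_spec h n).2.2) ?_
  simpa using tendsto_sqrt_one_div.const_mul _

theorem norm_U_sub_g_le {p q : ℝ≥0} (h : p ≤ q) (h1 : len (p, q) ≤ 1) :
    ‖N.U p q - N.g (p, q)‖ ≤ N.blockBd * len (p, q) :=
  N.U_mem_of_isClosed (S := {u | ‖u - N.g (p, q)‖ ≤ N.blockBd * len (p, q)}) h
    (isClosed_le (by fun_prop) (by fun_prop)) fun _ hl => norm_Theta_sub_g_le hl h1

theorem norm_compress_U_sub_g_le {p q : ℝ≥0} (h : p ≤ q) (h1 : len (p, q) ≤ 1) :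
    ‖(1 - N.P (p, q)) * (N.U p q - N.g (p, q)) * (1 - N.P (p, q))‖ ≤
      N.bd ^ 2 * Real.exp N.bd * len (p, q) ^ 2 := by
  refine N.U_mem_of_isClosed (S := {u | ‖(1 - N.P (p, q)) * (u - N.g (p, q)) * (1 - N.P (p, q))‖ ≤
      N.bd ^ 2 * Real.exp N.bd * len (p, q) ^ 2}) h
    (isClosed_le (by fun_prop) (by fun_prop)) fun l hl => ?_
  rw [Set.mem_ofPred_eq]
  have e : (1 - N.P (p, q)) * (N.Theta l - N.g (p, q)) * (1 - N.P (p, q)) =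
      ((l.map fun i => 1 + len i • N.L).prod - (1 + len (p, q) • N.L)) * (1 - N.P (p, q)) := by
    rw [sub_mul _ _ (1 - N.P (p, q)), ← (compress_Theta hl).eq, ← (N.compress_g (p, q)).eq,
      mul_sub (1 - N.P (p, q)), sub_mul _ _ (1 - N.P (p, q))]
  rw [e]
  exact (norm_mul_le _ _).trans ((mul_le_of_le_one_right (norm_nonneg _)
    (N.proj.norm_one_sub_le _)).trans (norm_compress_Theta_sub_le hl h1))

/-- The net of the products over the partitions of `[p, q]` converges to `U`. -/
theorem tendsto_partition {p q : ℝ≥0} (h : p ≤ q) :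
    Tendsto (fun α : Partition p q => N.Theta (pairs (α.1.sort (· ≤ ·)))) atTop (𝓝 (N.U p q)) := by
  have e : ∀ α : Partition p q, pairs (α.1.sort (· ≤ ·)) = subdiv α.1 p q := fun α => by
    rw [subdiv, Finset.filter_true_of_mem fun t ht => α.2.2.2 t ht]
  simp only [e]
  rw [Metric.tendsto_nhds]
  intro ε hε
  have h2 := (tendsto_sqrt_one_div.const_mul (N.refineBd p q))
  rw [mul_zero] at h2
  obtain ⟨n, hn⟩ := (h2.eventually (gt_mem_nhds hε)).exists
  obtain ⟨g1, g2, g3⟩ := grid_spec h n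
  -- Every partition finer than one fine grid is within ε of the limit. The grid is cut down to [p,
  -- q] because nothing is known about its points outside.
  let α₀ : Partition p q := ⟨(grid p q n).filter fun t => p ≤ t ∧ t ≤ q, by simp [g1, h],
    by simp [g2, h], fun t ht => (Finset.mem_filter.1 ht).2⟩
  have e0 : subdiv α₀.1 p q = subdiv (grid p q n) p q :=
    subdiv_congr fun t h1 h2 => by simp [α₀, h1, h2]
  filter_upwards [eventually_ge_atTop α₀] with α hα
  refine (N.norm_Theta_sub_U_le h α.2.1 α.2.2.1 (by positivity) (one_div_le_one n) ?_).trans_lt hn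
  exact MeshLE.mono (α := α₀.1) hα α₀.2.1 α₀.2.2.1 h (e0 ▸ g3)

end Noise

/-! ### Gaussian Schürmann triples -/

theorem K.gen_x {d : ℕ} (k l : Fin d) : K.gen (KGen.x k l) = K.x k l := rfl

theorem K.counit_x {d : ℕ} (k l : Fin d) : K.counit d (K.x k l) = if k = l then 1 else 0 :=
  K.lift_gen ..

theorem K.counit_xs {d : ℕ} (k l : Fin d) :
    K.counit d (K.gen (KGen.xs k l)) = if k = l then 1 else 0 :=
  K.lift_gen ..

theorem K.star_x {d : ℕ} (k l : Fin d) : star (K.x k l) = K.gen (KGen.xs k l) := K.star_gen _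

theorem K.counit_star {d : ℕ} (b : K d) : K.counit d (star b) = star (K.counit d b) := by
  induction b using K.induction with
  | h0 c => rw [K.star_algebraMap, AlgHom.commutes, AlgHom.commutes]; rfl
  | hg g =>
    rw [K.star_gen]
    cases g with
    | x k l =>
      exact (K.counit_xs k l).trans (by rw [K.gen_x, K.counit_x]; split_ifs <;> simp)
    | xs k l =>
      exact (K.counit_x k l).trans (by rw [K.counit_xs]; split_ifs <;> simp)
  | hm a b ha hb => rw [star_mul, map_mul, map_mul, ha, hb, star_mul]
  | ha a b ha hb => rw [star_add, map_add, map_add, ha, hb, star_add]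

/-- The bounded operators on the Fock space of the process. -/
abbrev FockOp (D : Type u) [NormedAddCommGroup D] [InnerProductSpace ℂ D] : Type u :=
  Fock (L2 D) →L[ℂ] Fock (L2 D)

/-- The matrices of bounded operators on the Fock space. -/
abbrev OpMat (d : ℕ) (D : Type u) [NormedAddCommGroup D] [InnerProductSpace ℂ D] : Type u :=
  CStarMatrix (Fin d) (Fin d) (FockOp D)

/-- The vectors `χ_{[p, q]} ⊗ v` with `[p, q]` in a given interval. -/
def chiSet (D : Type u) [NormedAddCommGroup D] [InnerProductSpace ℂ D] (i : ℝ≥0 × ℝ≥0) :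
    Set (L2 D) := {h | ∃ p q v, i.1 ≤ p ∧ q ≤ i.2 ∧ h = chi p q v}

section ChiSet

variable {D : Type u} [NormedAddCommGroup D] [InnerProductSpace ℂ D]

theorem chi_mem_chiSet (i : ℝ≥0 × ℝ≥0) (v : D) : chi i.1 i.2 v ∈ chiSet D i :=
  ⟨_, _, v, le_rfl, le_rfl, rfl⟩

theorem chiSet_mono {i j : ℝ≥0 × ℝ≥0} (h : i.1 ≤ j.1) (h' : j.2 ≤ i.2) :
    chiSet D j ⊆ chiSet D i := by
  rintro _ ⟨p, q, v, h1, h2, rfl⟩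
  exact ⟨p, q, v, h.trans h1, h2.trans h', rfl⟩

theorem inner_chiSet {i j : ℝ≥0 × ℝ≥0} (h : i.2 ≤ j.1) (x : L2 D) (hx : x ∈ chiSet D i)
    (y : L2 D) (hy : y ∈ chiSet D j) : inner ℂ x y = 0 := by
  obtain ⟨p, q, v, h1, h2, rfl⟩ := hx
  obtain ⟨p', q', v', h1', h2', rfl⟩ := hy
  exact inner_chi_of_le (h2.trans (h.trans h1')) v v'

end ChiSet

section Diag

variable {d : ℕ} {B : Type*} [CStarAlgebra B]

/-- The diagonal matrix with constant entries. -/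
def diag (d : ℕ) (c : B) : CStarMatrix (Fin d) (Fin d) B :=
  CStarMatrix.ofMatrix fun k l => if k = l then c else 0

theorem diag_apply (c : B) (k l : Fin d) : diag d c k l = if k = l then c else 0 := rfl

theorem diag_mul_apply (c : B) (x : CStarMatrix (Fin d) (Fin d) B) (k l : Fin d) :
    (diag d c * x) k l = c * x k l := by
  simp [CStarMatrix.mul_apply, diag_apply]

theorem mul_diag_apply (c : B) (x : CStarMatrix (Fin d) (Fin d) B) (k l : Fin d) :
    (x * diag d c) k l = x k l * c := by
  simp [CStarMatrix.mul_apply, diag_apply]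

theorem diag_mul_diag (c c' : B) : diag d c * diag d c' = diag d (c * c') := by
  ext k l
  rw [diag_mul_apply, diag_apply, diag_apply]
  split_ifs <;> simp

theorem star_diag (c : B) : star (diag d c) = diag d (star c) := by
  ext k l
  rw [CStarMatrix.star_apply, diag_apply, diag_apply]
  by_cases h : k = l
  · simp [h]
  · simp [h, Ne.symm h]

end Diag

theorem Noise.g_eq {M : Type*} [CStarAlgebra M] (N : Noise M) (i : ℝ≥0 × ℝ≥0) :
    N.g i = 1 + (N.a i - star (N.a i) + ((len i : ℝ) : ℂ) • N.L) := by
  rw [Complex.coe_smul]; rfl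

namespace SchurmannTriple

variable {d : ℕ} {D : Type u} [NormedAddCommGroup D] [InnerProductSpace ℂ D]
  {T : SchurmannTriple d D}

/-- Expand ⟨η(a^*), η(b)⟩ = Ψ((a - δ(a))(b - δ(b))). -/
theorem Ψ_mul (a b : K d) : T.Ψ (a * b) =
    K.counit d a * T.Ψ b + T.Ψ a * K.counit d b + inner ℂ (T.η (star a)) (T.η b) := by
  rw [T.inner_η, star_sub, star_star, K.star_algebraMap, K.counit_star, star_star]
  simp only [sub_mul, mul_sub, map_sub, map_smul,
    Algebra.algebraMap_eq_smul_one, mul_smul_comm, mul_one, smul_mul_assoc, one_mul,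
    T.isGenerator.map_one, smul_eq_mul]
  ring

/-- The relation X^*X = E seen by Ψ; after multiplication by the length of the interval it is the
Itô relation of the noise. -/
theorem sum_inner_η (k l : Fin d) :
    T.Ψ (K.x k l) + star (T.Ψ (K.x l k)) + ∑ m, inner ℂ (T.η (K.x m k)) (T.η (K.x m l)) = 0 := by
  have h := congrArg T.Ψ (K.star_mul_rel (d := d) k l)
  have h0 : T.Ψ (if k = l then (1 : K d) else 0) = 0 := by
    split_ifs
    · exact T.isGenerator.map_one
    · exact map_zero _
  have e : ∀ m : Fin d, star (K.gen (KGen.xs m k)) = K.x m k := fun m => K.star_gen _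
  rw [h0, map_sum] at h
  simp only [Ψ_mul, K.counit_xs, K.gen_x, K.counit_x, ite_mul, one_mul, zero_mul, mul_ite, mul_one,
    mul_zero, Finset.sum_add_distrib, Finset.sum_ite_eq', Finset.mem_univ, if_true, e] at h
  rw [← T.isGenerator.map_star, K.star_x]
  exact h

/-- The noise of a Gaussian Schürmann triple. -/
def noise (T : SchurmannTriple d D) : Noise (OpMat d D) where
  a i := CStarMatrix.ofMatrix fun k l => creation (chi i.1 i.2 (T.η (K.x k l)))
  P i := diag d (creationProj (chiSet D i))
  L := CStarMatrix.ofMatrix fun k l => T.Ψ (K.x k l) • (1 : FockOp D)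
  a_add h h' := by
    refine CStarMatrix.ext fun k l => ?_
    change (creation _ : FockOp D) = (creation _ : FockOp D) + (creation _ : FockOp D)
    rw [← creation_add, ← chi_split h h']
  proj :=
    { star_eq := fun i => by rw [star_diag, star_creationProj]
      idem := fun i => by rw [diag_mul_diag, creationProj_mul_self] }
  orth {i j} _ h _ := by
    rw [diag_mul_diag, creationProj_mul_eq_zero]
    · refine CStarMatrix.ext fun k l => ?_
      simp [diag_apply]
    · intro x hx y hy
      rw [← inner_conj_symm, inner_chiSet h y hy x hx, map_zero]
  mono {i j} h _ h' := by
    rw [diag_mul_diag, creationProj_mul_of_subset (chiSet_mono h h')]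
  P_a i := by
    refine CStarMatrix.ext fun k l => ?_
    rw [diag_mul_apply]
    exact creationProj_mul_creation (chi_mem_chiSet i _)
  comm i := by
    refine CStarMatrix.ext fun k l => ?_
    rw [diag_mul_apply, mul_diag_apply]
    change _ * (T.Ψ (K.x k l) • (1 : FockOp D)) = (T.Ψ (K.x k l) • (1 : FockOp D)) * _
    rw [mul_smul_comm, smul_mul_assoc, one_mul, mul_one]
  ito {i} h := by
    rw [← Complex.coe_smul]
    refine CStarMatrix.ext fun k l => ?_
    rw [CStarMatrix.mul_apply]
    change ∑ m, annihilation (chi i.1 i.2 (T.η (K.x m k))) * creation (chi i.1 i.2 (T.η (K.x m l))) =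
      -(((len i : ℝ) : ℂ) • (T.Ψ (K.x k l) • (1 : FockOp D) +
        star (T.Ψ (K.x l k) • (1 : FockOp D))))
    simp only [annihilation_mul_creation, inner_chi_self h]
    rw [← Finset.sum_smul, ← Finset.mul_sum, star_smul, star_one, ← add_smul, smul_smul, ← neg_smul]
    congr 1
    rw [len]
    linear_combination (((i.2 : ℝ) - i.1 : ℝ) : ℂ) * sum_inner_η (T := T) k l

variable (hρ : ∀ k l : Fin d, T.ρ (K.x k l) = if k = l then 1 else 0)

include hρ

theorem ρ_eq (b : K d) : T.ρ b = K.counit d b • (1 : Completion D →L[ℂ] Completion D) := by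
  induction b using K.induction with
  | h0 c => rw [AlgHomClass.commutes, AlgHom.commutes, Algebra.algebraMap_eq_smul_one]; rfl
  | hg g =>
    cases g with
    | x k l =>
      refine (hρ k l).trans ?_
      rw [K.gen_x, K.counit_x]; split_ifs <;> simp
    | xs k l =>
      rw [← K.star_x, map_star, hρ, K.counit_star, K.counit_x]; split_ifs <;> simp
  | hm a b ha hb => rw [map_mul, map_mul, ha, hb]; rw [smul_mul_smul_comm, one_mul]
  | ha a b ha hb => rw [map_add, map_add, ha, hb, add_smul]

/-- A trivial representation turns the cocycle into a derivation with respect to the counit. -/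
theorem η_mul_eq (a b : K d) :
    T.η (a * b) = K.counit d a • T.η b + K.counit d b • T.η a := by
  have h := T.η_mul a b
  rw [ρ_eq hρ a] at h
  apply Completion.coe_injective
  rw [h]
  push_cast
  rfl

theorem η_one : T.η 1 = 0 := by
  have h := η_mul_eq hρ 1 1
  simpa using h

/-- The derivation applied to X X^* = E. The sign makes the annihilation part of the increment equal
to -a^*. -/
theorem η_xs (k l : Fin d) : T.η (K.gen (KGen.xs k l)) = -T.η (K.x l k) := by
  have h := congrArg T.η (K.mul_star_rel (d := d) l k)
  have h0 : T.η (if l = k then (1 : K d) else 0) = 0 := by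
    split_ifs
    · exact η_one hρ
    · exact map_zero _
  rw [h0, map_sum] at h
  simp only [η_mul_eq hρ, K.counit_xs, K.gen_x, K.counit_x, ite_smul, one_smul, zero_smul,
    Finset.sum_add_distrib, Finset.sum_ite_eq, Finset.mem_univ, if_true] at h
  exact eq_neg_of_add_eq_zero_left h

theorem noise_g (p q : ℝ≥0) (k l : Fin d) : T.noise.g (p, q) k l = T.increment p q k l := by
  rw [Noise.g_eq, increment, K.star_x, η_xs hρ, ← neg_one_smul ℂ, chi_smul, annihilation_smul]
  change (if k = l then (1 : FockOp D) else 0) + ((creation _ : FockOp D) - (annihilation _ : FockOp D) +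
    ((len (p, q) : ℝ) : ℂ) • (T.Ψ (K.x k l) • (1 : FockOp D))) = _
  rw [smul_smul, len, map_neg, map_one, neg_one_smul]
  abel

theorem noise_Theta {R S : ℝ≥0} (α : Partition R S) (k l : Fin d) :
    T.noise.Theta (pairs (α.1.sort (· ≤ ·))) k l = T.partitionProd α k l := by
  have e : T.increment = fun p q => CStarMatrix.ofMatrix.symm (T.noise.g (p, q)) := by
    funext p q; ext1 k l; exact (noise_g hρ p q k l).symm
  rw [partitionProd, e, Noise.Theta, pairs]
  generalize α.1.sort (· ≤ ·) = m
  -- The two zipped lists are decoupled so that the induction can shorten both independently.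
  generalize m.tail = m'
  induction m generalizing m' k l with
  | nil => rfl
  | cons p m ih =>
    cases m' with
    | nil => rfl
    | cons q m' =>
      rw [List.zip_cons_cons, List.map_cons, List.prod_cons, List.zipWith_cons_cons,
        List.prod_cons, CStarMatrix.mul_apply, Matrix.mul_apply]
      exact Finset.sum_congr rfl fun n _ => congrArg _ (ih _ _ _)

theorem tendsto_partitionProd {r s : ℝ≥0} (h : r ≤ s) (k l : Fin d) :
    Tendsto (fun α : Partition r s => T.partitionProd α k l) atTop (𝓝 (T.noise.U r s k l)) := by
  have h1 := T.noise.tendsto_partition h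
  simp only [← noise_Theta hρ]
  -- The norm topology on C*-matrices is the product topology, so convergence of the matrix gives
  -- convergence of each entry.
  exact tendsto_pi_nhds.1 (tendsto_pi_nhds.1 h1 k) l

end SchurmannTriple

/-! ### Homomorphisms of the dual group -/

theorem K.algHom_ext {d : ℕ} {A : Type*} [Semiring A] [Algebra ℂ A] {f g : K d →ₐ[ℂ] A}
    (h : ∀ x, f (K.gen x) = g (K.gen x)) : f = g := by
  ext b
  induction b using K.induction with
  | h0 c => rw [AlgHom.commutes, AlgHom.commutes]
  | hg x => exact h x
  | hm a b ha hb => rw [map_mul, map_mul, ha, hb]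
  | ha a b ha hb => rw [map_add, map_add, ha, hb]

theorem freeLift_ι {I : Type*} [DecidableEq I] {d : ℕ} {A : Type*} [Semiring A] [Algebra ℂ A]
    (f : I → (K d →ₐ[ℂ] A)) (i : I) (b : K d) :
    freeLift f (LinearAlgebra.FreeProduct.ι ℂ (fun _ : I => K d) i b) = f i b :=
  DFunLike.congr_fun (LinearAlgebra.FreeProduct.lift_comp_ι ℂ (fun _ : I => K d)
    (maps := fun {i} => f i)) b

theorem conv_x {d : ℕ} {A : Type*} [Semiring A] [Algebra ℂ A] (f g : K d →ₐ[ℂ] A) (k l : Fin d) :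
    conv f g (K.gen (KGen.x k l)) =
      ∑ n, f (K.gen (KGen.x k n)) * g (K.gen (KGen.x n l)) := by
  rw [conv, AlgHom.comp_apply, K.comul, K.lift_gen, map_sum]
  refine Finset.sum_congr rfl fun n _ => ?_
  rw [map_mul, KK.inj, KK.inj, freeLift_ι, freeLift_ι]
  rfl

theorem conv_xs {d : ℕ} {A : Type*} [Semiring A] [Algebra ℂ A] (f g : K d →ₐ[ℂ] A) (k l : Fin d) :
    conv f g (K.gen (KGen.xs k l)) =
      ∑ n, g (K.gen (KGen.xs n l)) * f (K.gen (KGen.xs k n)) := by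
  rw [conv, AlgHom.comp_apply, K.comul, K.lift_gen, map_sum]
  refine Finset.sum_congr rfl fun n _ => ?_
  rw [map_mul, KK.inj, KK.inj, freeLift_ι, freeLift_ι]
  rfl

section OfUnitary

variable {d : ℕ} {B : Type*} [CStarAlgebra B] (u : CStarMatrix (Fin d) (Fin d) B)
  (h : u * star u = 1) (h' : star u * u = 1)

/-- The values on the indeterminates of the homomorphism given by a unitary matrix. -/
def unitaryGen : KGen d → B
  | KGen.x k l => u k l
  | KGen.xs k l => star (u k l)

omit h' in
include h in
theorem unitaryGen_mul_star (k l : Fin d) :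
    ∑ p, unitaryGen u (KGen.x k p) * unitaryGen u (KGen.xs l p) = if k = l then 1 else 0 := by
  have e : (u * star u) k l = (1 : CStarMatrix (Fin d) (Fin d) B) k l := by rw [h]
  rw [CStarMatrix.mul_apply, CStarMatrix.one_apply] at e
  exact e

include h' in
theorem unitaryGen_star_mul (k l : Fin d) :
    ∑ p, unitaryGen u (KGen.xs p k) * unitaryGen u (KGen.x p l) = if k = l then 1 else 0 := by
  have e : (star u * u) k l = (1 : CStarMatrix (Fin d) (Fin d) B) k l := by rw [h']
  rw [CStarMatrix.mul_apply, CStarMatrix.one_apply] at e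
  exact e

/-- The `*`-homomorphism of `K⟨d⟩` given by a unitary matrix. -/
def K.ofUnitary : K d →⋆ₐ[ℂ] B where
  __ := K.lift (unitaryGen u) (unitaryGen_mul_star u h) (unitaryGen_star_mul u h')
  map_star' b := by
    change K.lift (unitaryGen u) (unitaryGen_mul_star u h) (unitaryGen_star_mul u h') (star b) =
      star (K.lift (unitaryGen u) (unitaryGen_mul_star u h) (unitaryGen_star_mul u h') b)
    induction b using K.induction with
    | h0 c =>
      rw [K.star_algebraMap, AlgHom.commutes, AlgHom.commutes, algebraMap_star_comm]
    | hg g =>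
      rw [K.star_gen, K.lift_gen, K.lift_gen]
      cases g
      · rfl
      · exact (star_star _).symm
    | hm a b ha hb => rw [star_mul, map_mul, map_mul, ha, hb, star_mul]
    | ha a b ha hb => rw [star_add, map_add, map_add, ha, hb, star_add]

theorem K.ofUnitary_x (k l : Fin d) : K.ofUnitary u h h' (K.x k l) = u k l :=
  K.lift_gen (unitaryGen u) (unitaryGen_mul_star u h) (unitaryGen_star_mul u h') _

end OfUnitary

/-! ### The process given by the limit unitaries -/

namespace SchurmannTriple

variable {d : ℕ} {D : Type u} [NormedAddCommGroup D] [InnerProductSpace ℂ D]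
  (T : SchurmannTriple d D)

/-- The matrix `U_{r,s}`, extended by the identity to `s < r`. -/
def unitary (r s : ℝ≥0) : OpMat d D := if r ≤ s then T.noise.U r s else 1

theorem unitary_of_le {r s : ℝ≥0} (h : r ≤ s) : T.unitary r s = T.noise.U r s := if_pos h

theorem unitary_mul_star (r s : ℝ≥0) : T.unitary r s * star (T.unitary r s) = 1 := by
  rw [unitary]
  split_ifs with h
  · exact T.noise.U_mul_star h
  · rw [star_one, one_mul]

theorem star_unitary_mul (r s : ℝ≥0) : star (T.unitary r s) * T.unitary r s = 1 := by
  rw [unitary]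
  split_ifs with h
  · exact T.noise.star_U_mul h
  · rw [star_one, one_mul]

/-- The process on the full Fock space. -/
def process (r s : ℝ≥0) : K d →⋆ₐ[ℂ] FockOp D :=
  K.ofUnitary (T.unitary r s) (T.unitary_mul_star r s) (T.star_unitary_mul r s)

theorem process_x (r s : ℝ≥0) (k l : Fin d) : T.process r s (K.x k l) = T.unitary r s k l :=
  K.ofUnitary_x ..

theorem process_xs (r s : ℝ≥0) (k l : Fin d) :
    T.process r s (K.gen (KGen.xs k l)) = star (T.process r s (K.x k l)) := by
  rw [← K.star_x, map_star]

/-- On the indeterminates, convolution of homomorphisms is multiplication of the corresponding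
unitary matrices, so this is `Noise.U_mul`. -/
theorem process_conv {r s t : ℝ≥0} (h : r ≤ s) (h' : s ≤ t) :
    (T.process r t).toAlgHom = conv (T.process r s).toAlgHom (T.process s t).toAlgHom := by
  have e : ∀ k l, T.process r t (K.x k l) =
      ∑ n, T.process r s (K.x k n) * T.process s t (K.x n l) := fun k l => by
    simp only [process_x]
    rw [T.unitary_of_le h, T.unitary_of_le h', T.unitary_of_le (h.trans h'), ← T.noise.U_mul h h',
      CStarMatrix.mul_apply]
  refine K.algHom_ext fun g => ?_
  cases g with
  | x k l =>
    rw [conv_x]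
    exact e k l
  | xs k l =>
    rw [conv_xs]
    change T.process r t _ = ∑ n, T.process s t _ * T.process r s _
    simp only [process_xs, e, star_sum, star_mul]

theorem process_self (r : ℝ≥0) (b : K d) :
    T.process r r b = algebraMap ℂ (FockOp D) (K.counit d b) := by
  have h1 : ∀ k l, T.process r r (K.x k l) = algebraMap ℂ (FockOp D) (K.counit d (K.x k l)) := by
    intro k l
    rw [process_x, T.unitary_of_le le_rfl, T.noise.U_self, K.counit_x, CStarMatrix.one_apply]
    split_ifs
    · exact (map_one _).symm
    · exact (map_zero _).symm
  have : (T.process r r).toAlgHom = (Algebra.ofId ℂ (FockOp D)).comp (K.counit d) := by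
    refine K.algHom_ext fun g => ?_
    cases g with
    | x k l => exact h1 k l
    | xs k l =>
      change T.process r r _ = algebraMap ℂ (FockOp D) (K.counit d _)
      rw [process_xs, h1, ← K.star_x, K.counit_star, algebraMap_star_comm]
  exact DFunLike.congr_fun this b

theorem process_isFockConstruction
    (hρ : ∀ k l : Fin d, T.ρ (K.x k l) = if k = l then 1 else 0) :
    T.IsFockConstruction T.process := by
  intro r s h k l
  rw [process_x, T.unitary_of_le h]
  exact tendsto_partitionProd hρ h k l

end SchurmannTriple

/-! ### The algebra generated by creation operators -/

section FockAlgebra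

variable {H : Type u} [NormedAddCommGroup H] [InnerProductSpace ℂ H]

/-- The creation and annihilation operators of vectors in `S`. -/
def fockGen (S : Set H) : Set (Fock H →L[ℂ] Fock H) := creation '' S ∪ annihilation '' S

/-- The norm closed algebra generated by creation and annihilation operators of vectors in `S`. -/
def fockAlg (S : Set H) : Subalgebra ℂ (Fock H →L[ℂ] Fock H) :=
  (Algebra.adjoin ℂ (fockGen S)).topologicalClosure

theorem creation_mem_fockAlg {S : Set H} {h : H} (hh : h ∈ S) : creation h ∈ fockAlg S :=
  Subalgebra.le_topologicalClosure _ (Algebra.subset_adjoin (Or.inl ⟨h, hh, rfl⟩))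

theorem star_mem_fockAlg {S : Set H} {x : Fock H →L[ℂ] Fock H} (hx : x ∈ fockAlg S) :
    star x ∈ fockAlg S := by
  have h1 : ∀ y ∈ Algebra.adjoin ℂ (fockGen S), star y ∈ Algebra.adjoin ℂ (fockGen S) := by
    intro y hy
    induction hy using Algebra.adjoin_induction with
    | mem y hy =>
      obtain ⟨h, hh, rfl⟩ | ⟨h, hh, rfl⟩ := hy
      · exact Algebra.subset_adjoin (Or.inr ⟨h, hh, rfl⟩)
      · rw [star_annihilation]; exact Algebra.subset_adjoin (Or.inl ⟨h, hh, rfl⟩)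
    | algebraMap c => rw [← algebraMap_star_comm]; exact Subalgebra.algebraMap_mem _ _
    | add y z _ _ hy hz => rw [star_add]; exact add_mem hy hz
    | mul y z _ _ hy hz => rw [star_mul]; exact mul_mem hz hy
  exact map_mem_closure continuous_star hx h1

/-- Products of annihilation operators. -/
inductive AnnWord (S : Set H) : (Fock H →L[ℂ] Fock H) → Prop
  | one : AnnWord S 1
  | mul {h : H} {w : Fock H →L[ℂ] Fock H} (hh : h ∈ S) (hw : AnnWord S w) :
      AnnWord S (annihilation h * w)

/-- Normally ordered products of creation and annihilation operators. -/
inductive NormalWord (S : Set H) : (Fock H →L[ℂ] Fock H) → Prop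
  | ann {w : Fock H →L[ℂ] Fock H} (hw : AnnWord S w) : NormalWord S w
  | mul {h : H} {w : Fock H →L[ℂ] Fock H} (hh : h ∈ S) (hw : NormalWord S w) :
      NormalWord S (creation h * w)

/-- A nonempty word kills ξ and also Ω, since both are orthogonal to the creation range: the inner
factors return a multiple of the vector, and the outermost annihilator kills it. -/
theorem AnnWord.apply {S : Set H} {w : Fock H →L[ℂ] Fock H} (hw : AnnWord S w) {ξ : Fock H}
    (hξ : ξ ∈ (creationRange S)ᗮ) : w ξ = vacuumState H w • ξ := by
  cases hw with
  | one => rw [isState_vacuumState.map_one, one_smul]; rfl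
  | mul hh hw =>
    rename_i h w
    have key : ∀ {w : Fock H →L[ℂ] Fock H}, AnnWord S w → ∀ {ζ : Fock H},
        ζ ∈ (creationRange S)ᗮ → ∃ c : ℂ, w ζ = c • ζ := by
      intro w hw ζ hζ
      induction hw with
      | one => exact ⟨1, (one_smul _ _).symm⟩
      | mul hh _ ih =>
        obtain ⟨c, hc⟩ := ih
        refine ⟨0, ?_⟩
        rw [mul_apply_eq_comp, hc, map_smul, mem_orthogonal_creationRange.1 hζ _ hh,
          smul_zero, zero_smul]
    have h0 : ∀ {ζ : Fock H}, ζ ∈ (creationRange S)ᗮ → (annihilation h * w) ζ = 0 := by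
      intro ζ hζ
      obtain ⟨c, hc⟩ := key hw hζ
      rw [mul_apply_eq_comp, hc, map_smul, mem_orthogonal_creationRange.1 hζ _ hh,
        smul_zero]
    rw [h0 hξ, vacuumState_apply, h0 (vacuum_mem_orthogonal S), inner_zero_right, zero_smul]

theorem inner_vacuum_of_mem {S : Set H} {ξ : Fock H} (hξ : ξ ∈ creationRange S) :
    inner ℂ vacuum ξ = 0 := by
  rw [← inner_conj_symm, vacuum_mem_orthogonal S ξ hξ, map_zero]

/-- The operators `x` with `x ξ - ⟨Ω, x Ω⟩ ξ` in the range of the creation operators, for all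
`ξ` orthogonal to that range. -/
def shiftSpace (S : Set H) : Submodule ℂ (Fock H →L[ℂ] Fock H) where
  carrier := {x | ∀ ξ ∈ (creationRange S)ᗮ, x ξ - vacuumState H x • ξ ∈ creationRange S}
  add_mem' {x y} hx hy ξ hξ := by
    have e : (x + y) ξ - vacuumState H (x + y) • ξ =
        (x ξ - vacuumState H x • ξ) + (y ξ - vacuumState H y • ξ) := by
      rw [map_add, add_smul, add_apply]; abel
    rw [e]
    exact add_mem (hx ξ hξ) (hy ξ hξ)
  zero_mem' ξ _ := by simp
  smul_mem' c x hx ξ hξ := by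
    have e : (c • x) ξ - vacuumState H (c • x) • ξ = c • (x ξ - vacuumState H x • ξ) := by
      rw [map_smul, smul_sub, smul_assoc]; rfl
    rw [e]
    exact Submodule.smul_mem _ _ (hx ξ hξ)

theorem isClosed_shiftSpace (S : Set H) : IsClosed (shiftSpace S : Set (Fock H →L[ℂ] Fock H)) := by
  have e : (shiftSpace S : Set (Fock H →L[ℂ] Fock H)) = ⋂ ξ ∈ (creationRange S)ᗮ,
      (fun x : Fock H →L[ℂ] Fock H => x ξ - (inner ℂ vacuum (x vacuum) : ℂ) • ξ) ⁻¹'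
        (creationRange S : Set (Fock H)) := by
    ext x; simp only [Set.mem_iInter]; rfl
  rw [e]
  exact isClosed_biInter fun ξ _ =>
    (Submodule.isClosed_topologicalClosure _).preimage (by fun_prop)

theorem NormalWord.mem_shiftSpace {S : Set H} {w : Fock H →L[ℂ] Fock H} (hw : NormalWord S w) :
    w ∈ shiftSpace S := by
  intro ξ hξ
  cases hw with
  | ann hw => rw [hw.apply hξ, sub_self]; exact zero_mem _
  | mul hh hw =>
    rw [vacuumState_apply, mul_apply_eq_comp, mul_apply_eq_comp, inner_vacuum_creation, zero_smul,
      sub_zero]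
    exact creation_mem_creationRange hh _

/-- Because A(h) A^*(k) is a scalar, the span of normally ordered words is stable under left
multiplication by the generators, hence contains the algebra they generate. A word starting with a
creator maps into the creation range and has vacuum expectation 0, a pure annihilation word acts as
a scalar, and the space of operators with this property is closed. -/
theorem fockAlg_le_shiftSpace {S : Set H} {x : Fock H →L[ℂ] Fock H} (hx : x ∈ fockAlg S) :
    x ∈ shiftSpace S := by
  have h1 : ∀ y ∈ Algebra.adjoin ℂ (fockGen S),
      ∀ z ∈ Submodule.span ℂ {w | NormalWord S w}, y * z ∈ Submodule.span ℂ {w | NormalWord S w} := by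
    intro y hy
    induction hy using Algebra.adjoin_induction with
    | mem y hy =>
      intro z hz
      induction hz using Submodule.span_induction with
      | zero => rw [mul_zero]; exact zero_mem _
      | add a b _ _ ha hb => rw [mul_add]; exact add_mem ha hb
      | smul c a _ ha => rw [mul_smul_comm]; exact Submodule.smul_mem _ _ ha
      | mem w hw =>
        obtain ⟨h, hh, rfl⟩ | ⟨h, hh, rfl⟩ := hy
        · exact Submodule.subset_span (NormalWord.mul hh hw)
        · cases hw with
          | ann hw => exact Submodule.subset_span (NormalWord.ann (AnnWord.mul hh hw))
          | mul hk hw =>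
            rw [← mul_assoc, annihilation_mul_creation, smul_mul_assoc, one_mul]
            exact Submodule.smul_mem _ _ (Submodule.subset_span hw)
    | algebraMap c =>
      intro z hz
      rw [← Algebra.smul_def]; exact Submodule.smul_mem _ _ hz
    | add a b _ _ ha hb => intro z hz; rw [add_mul]; exact add_mem (ha z hz) (hb z hz)
    | mul a b _ _ ha hb => intro z hz; rw [mul_assoc]; exact ha _ (hb z hz)
  have h2 : Submodule.span ℂ {w | NormalWord S w} ≤ shiftSpace S :=
    Submodule.span_le.2 fun w hw => NormalWord.mem_shiftSpace hw
  refine (isClosed_shiftSpace S).closure_subset_iff.2 (fun y hy => ?_) hx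
  have := h1 y hy 1 (Submodule.subset_span (NormalWord.ann AnnWord.one))
  rw [mul_one] at this
  exact h2 this

/-- Alternating centred products map the vacuum into the range of the first set of creators. -/
theorem alternating_apply_vacuum_mem {I : Type*} {S : I → Set H}
    (hS : ∀ i j, i ≠ j → ∀ x ∈ S i, ∀ y ∈ S j, inner ℂ x y = 0)
    (w : List (I × (Fock H →L[ℂ] Fock H))) (hw : w.IsChain fun p q => p.1 ≠ q.1)
    (h0 : ∀ p ∈ w, p.2 ∈ fockAlg (S p.1) ∧ vacuumState H p.2 = 0) (p) (hp : w.head? = some p) :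
    (w.map Prod.snd).prod vacuum ∈ creationRange (S p.1) := by
  induction w generalizing p with
  | nil => simp at hp
  | cons q w ih =>
    obtain rfl : q = p := by simpa using hp
    obtain ⟨h1, h2⟩ := h0 q (by simp)
    rw [List.map_cons, List.prod_cons, mul_apply_eq_comp]
    set ξ := (w.map Prod.snd).prod vacuum with hξ
    -- The tail has moved the vacuum into the creation range of the next leg, which is orthogonal to
    -- that of the present one because consecutive legs differ.
    have h3 : ξ ∈ (creationRange (S q.1))ᗮ := by
      cases w with
      | nil => exact vacuum_mem_orthogonal _
      | cons r w =>
        have hc := List.isChain_cons_cons.1 hw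
        exact creationRange_isOrtho (hS r.1 q.1 (Ne.symm hc.1))
          (ih hc.2 (fun p hp => h0 p (by simp [hp])) r rfl)
    have h4 := fockAlg_le_shiftSpace h1 ξ h3
    rwa [h2, zero_smul, sub_zero] at h4

end FockAlgebra

/-! ### Freeness of the increments of the Fock space process -/

namespace SchurmannTriple

variable {d : ℕ} {D : Type u} [NormedAddCommGroup D] [InnerProductSpace ℂ D]
  (T : SchurmannTriple d D)

theorem noise_g_mem (i : ℝ≥0 × ℝ≥0) (k l : Fin d) : T.noise.g i k l ∈ fockAlg (chiSet D i) := by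
  rw [Noise.g_eq]
  have h1 : ∀ k l, T.noise.a i k l ∈ fockAlg (chiSet D i) := fun k l =>
    creation_mem_fockAlg (chi_mem_chiSet i _)
  refine add_mem ?_ (add_mem (sub_mem (h1 k l) ?_) ?_)
  · rw [CStarMatrix.one_apply]
    split_ifs
    exacts [one_mem _, zero_mem _]
  · rw [CStarMatrix.star_apply]
    exact star_mem_fockAlg (h1 l k)
  · exact Subalgebra.smul_mem _ (Subalgebra.smul_mem _ (one_mem _) _) _

theorem fockAlg_mono {S S' : Set (L2 D)} (h : S ⊆ S') : fockAlg S ≤ fockAlg S' :=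
  Subalgebra.topologicalClosure_mono
    (Algebra.adjoin_mono (Set.union_subset_union (Set.image_mono h) (Set.image_mono h)))

theorem noise_Theta_mem {p q : ℝ≥0} {m : List (ℝ≥0 × ℝ≥0)} (hm : IsSteps p m q) (k l : Fin d) :
    T.noise.Theta m k l ∈ fockAlg (chiSet D (p, q)) := by
  have key : ∀ m' : List (ℝ≥0 × ℝ≥0), (∀ i ∈ m', p ≤ i.1 ∧ i.2 ≤ q) → ∀ k l,
      T.noise.Theta m' k l ∈ fockAlg (chiSet D (p, q)) := by
    intro m' hm'
    induction m' with
    | nil =>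
      intro k l
      change (1 : OpMat d D) k l ∈ _
      rw [CStarMatrix.one_apply]
      split_ifs
      exacts [one_mem _, zero_mem _]
    | cons i m' ih =>
      intro k l
      rw [Noise.Theta_cons, CStarMatrix.mul_apply]
      refine sum_mem fun n _ => mul_mem ?_ (ih (fun j hj => hm' j (by simp [hj])) n l)
      have := hm' i (by simp)
      exact fockAlg_mono (chiSet_mono this.1 this.2) (T.noise_g_mem i k n)
  exact key m (fun i hi => ⟨(hm.bounds i hi).1, (hm.bounds i hi).2.2⟩) k l

theorem process_mem {p q : ℝ≥0} (h : p ≤ q) (b : K d) :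
    T.process p q b ∈ fockAlg (chiSet D (p, q)) := by
  have h1 : ∀ k l, T.process p q (K.x k l) ∈ fockAlg (chiSet D (p, q)) := by
    intro k l
    rw [process_x, T.unitary_of_le h]
    refine T.noise.U_mem_of_isClosed
      (S := (fun u : OpMat d D => u k l) ⁻¹' (fockAlg (chiSet D (p, q)) : Set (FockOp D))) h ?_
      fun m hm => T.noise_Theta_mem hm k l
    refine (Subalgebra.isClosed_topologicalClosure _).preimage ?_
    exact (continuous_apply l).comp (continuous_apply k)
  induction b using K.induction with
  | h0 c => rw [AlgHomClass.commutes]; exact Subalgebra.algebraMap_mem _ _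
  | hg g =>
    cases g with
    | x k l => exact h1 k l
    | xs k l => rw [process_xs]; exact star_mem_fockAlg (h1 k l)
  | hm a b ha hb => rw [map_mul]; exact mul_mem ha hb
  | ha a b ha hb => rw [map_add]; exact add_mem ha hb

/-- Increments over intervals sharing at most endpoints lie in Fock algebras of mutually orthogonal
sets of vectors. Alternating centred products therefore send Ω into a creation range, which is
orthogonal to Ω. -/
theorem process_free {n : ℕ} {t : Fin (n + 1) → ℝ≥0} (ht : Monotone t) :
    IsFreeProduct
      (fun i : Fin n => vacuumState (L2 D) ∘ₗ
        (T.process (t i.castSucc) (t i.succ)).toAlgHom.toLinearMap)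
      (vacuumState (L2 D) ∘ₗ (freeLift fun i : Fin n =>
        (T.process (t i.castSucc) (t i.succ)).toAlgHom).toLinearMap) := by
  refine ⟨fun i b => ?_, fun w hw hc h0 => ?_⟩
  · rw [LinearMap.comp_apply, LinearMap.comp_apply, AlgHom.toLinearMap_apply, freeLift_ι]
    rfl
  · set F : Fin n → K d → FockOp D := fun i => T.process (t i.castSucc) (t i.succ) with hF
    have h1 : freeLift (fun i : Fin n => (T.process (t i.castSucc) (t i.succ)).toAlgHom)
        (w.map fun p => LinearAlgebra.FreeProduct.ι ℂ (fun _ : Fin n => K d) p.1 p.2).prod =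
        ((w.map fun p => (p.1, F p.1 p.2)).map Prod.snd).prod := by
      rw [map_list_prod, List.map_map, List.map_map]
      congr 1
      refine List.map_congr_left fun p _ => ?_
      exact freeLift_ι _ p.1 p.2
    rw [LinearMap.comp_apply, AlgHom.toLinearMap_apply, h1, vacuumState_apply]
    have hlt : ∀ i j : Fin n, i < j → t i.succ ≤ t j.castSucc := fun i j hij =>
      ht (Fin.succ_le_castSucc_iff.2 hij)
    obtain ⟨p, w', rfl⟩ := List.exists_cons_of_ne_nil hw
    refine inner_vacuum_of_mem (alternating_apply_vacuum_mem
      (S := fun i : Fin n => chiSet D (t i.castSucc, t i.succ)) ?_ _ ?_ ?_ (p.1, F p.1 p.2) rfl)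
    · intro i j hij x hx y hy
      rcases lt_or_gt_of_ne hij with h | h
      · exact inner_chiSet (hlt i j h) x hx y hy
      · rw [← inner_conj_symm, inner_chiSet (hlt j i h) y hy x hx, map_zero]
    · exact (List.isChain_map _).2 hc
    · intro q hq
      obtain ⟨r, hr, rfl⟩ := List.mem_map.1 hq
      exact ⟨T.process_mem (ht (Fin.castSucc_le_succ _)) _, h0 r hr⟩

end SchurmannTriple

/-! ### The generator of the Fock space process -/

theorem norm_mul_expansion_le {B : Type*} [NormedRing B] [NormedAlgebra ℂ B] {s K : ℝ} (hs0 : 0 ≤ s)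
    (hs1 : s ≤ 1) {x y X Y : B} (hx : ‖x‖ ≤ K * s) (hy : ‖y‖ ≤ K * s)
    (hX : ‖X‖ ≤ K * s ^ 2) (hY : ‖Y‖ ≤ K * s ^ 2) :
    ‖x * Y + X * y + X * Y‖ ≤ 3 * K ^ 2 * s ^ 3 := by
  have h1 : ∀ {u v : B} {a b : ℝ}, ‖u‖ ≤ a → ‖v‖ ≤ b → ‖u * v‖ ≤ a * b := fun hu hv =>
    (norm_mul_le _ _).trans (mul_le_mul hu hv (norm_nonneg _) ((norm_nonneg _).trans hu))
  have h2 : K ^ 2 * s ^ 4 ≤ K ^ 2 * s ^ 3 :=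
    mul_le_mul_of_nonneg_left (pow_le_pow_of_le_one hs0 hs1 (by norm_num)) (sq_nonneg K)
  calc ‖x * Y + X * y + X * Y‖ ≤ K * s * (K * s ^ 2) + K * s ^ 2 * (K * s) +
        K * s ^ 2 * (K * s ^ 2) :=
        (norm_add₃_le ..).trans (add_le_add (add_le_add (h1 hx hY) (h1 hX hy)) (h1 hX hY))
    _ ≤ _ := by nlinarith

/-- The error is sorted by size for τ = s², with x, y of order s and X, Y of order s². The first
group is O(s²) and inherits the vacuum bounds of X and Y, the second has vacuum expectation 0 when κ
is the covariance of x and y, and the third is O(s³) in norm. -/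
theorem mul_expansion {B : Type*} [Ring B] [Algebra ℂ B] (α β τ ψ χ κ : ℂ) (x y X Y : B) :
    (α • 1 + x + ((τ * ψ) • 1 + X)) * (β • 1 + y + ((τ * χ) • 1 + Y)) -
      ((α * β) • 1 + (α • y + β • x) + (τ * (α * χ + ψ * β + κ)) • 1) =
    (α • Y + β • X) + (x * y - (τ * κ) • 1) +
      (x * ((τ * χ) • 1 + Y) + ((τ * ψ) • 1 + X) * y + ((τ * ψ) • 1 + X) * ((τ * χ) • 1 + Y)) := by
  simp only [mul_add, add_mul, smul_mul_assoc, mul_smul_comm, one_mul, mul_one, smul_add, smul_smul]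
  module

section Fock

variable {H : Type u} [NormedAddCommGroup H] [InnerProductSpace ℂ H]

theorem norm_creation_le (h : H) : ‖creation h‖ ≤ ‖h‖ :=
  LinearMap.mkContinuous_norm_le _ (norm_nonneg h) _

theorem norm_annihilation_le (h : H) : ‖annihilation h‖ ≤ ‖h‖ := by
  exact (LinearIsometryEquiv.norm_map ContinuousLinearMap.adjoint (creation h)).trans_le
    (norm_creation_le h)

theorem vacuumState_star (x : Fock H →L[ℂ] Fock H) :
    vacuumState H (star x) = star (vacuumState H x) := by
  rw [vacuumState_apply, vacuumState_apply, ContinuousLinearMap.star_eq_adjoint,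
    ContinuousLinearMap.adjoint_inner_right]
  exact (inner_conj_symm _ _).symm

end Fock

theorem norm_chi {D : Type u} [NormedAddCommGroup D] [InnerProductSpace ℂ D] {p q : ℝ≥0}
    (h : p ≤ q) (v : D) : ‖chi p q v‖ = √(len (p, q)) * ‖v‖ := by
  have h0 : 0 ≤ len (p, q) := sub_nonneg.2 (by exact_mod_cast h)
  rw [← Real.sqrt_sq (norm_nonneg v), ← Real.sqrt_mul h0, ← Real.sqrt_sq (norm_nonneg (chi p q v)),
    ← inner_self_eq_norm_sq (𝕜 := ℂ) v, ← inner_self_eq_norm_sq (𝕜 := ℂ) (chi p q v),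
    inner_chi_self h, len]
  congr 1
  exact Complex.re_ofReal_mul _ _

namespace SchurmannTriple

variable {d : ℕ} {D : Type u} [NormedAddCommGroup D] [InnerProductSpace ℂ D]
  (T : SchurmannTriple d D)

/-- The first order part `A^*(χ ⊗ η(b)) + A(χ ⊗ η(b^*))`. -/
def linPart (p q : ℝ≥0) (b : K d) : FockOp D :=
  creation (chi p q (T.η b)) + annihilation (chi p q (T.η (star b)))

/-- The approximation of `f_{p,q}(b)` up to terms of order `q - p`. -/
def approx (p q : ℝ≥0) (b : K d) : FockOp D :=
  K.counit d b • 1 + T.linPart p q b + ((len (p, q) : ℂ) * T.Ψ b) • 1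

theorem linPart_add (p q : ℝ≥0) (a b : K d) :
    T.linPart p q (a + b) = T.linPart p q a + T.linPart p q b := by
  simp only [linPart, star_add, map_add, chi_add, creation_add, annihilation_add]
  abel

theorem approx_add (p q : ℝ≥0) (a b : K d) :
    T.approx p q (a + b) = T.approx p q a + T.approx p q b := by
  simp only [approx, linPart_add, map_add, add_smul, mul_add]
  abel

theorem approx_star (p q : ℝ≥0) (b : K d) : T.approx p q (star b) = star (T.approx p q b) := by
  simp only [approx, linPart, star_add, star_star, star_creation, star_annihilation, star_smul,
    star_one, star_mul', K.counit_star, T.isGenerator.map_star]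
  rw [Complex.star_def, Complex.conj_ofReal]
  abel

theorem norm_linPart_le {p q : ℝ≥0} (h : p ≤ q) (b : K d) :
    ‖T.linPart p q b‖ ≤ (‖T.η b‖ + ‖T.η (star b)‖) * √(len (p, q)) := by
  refine (norm_add_le _ _).trans ?_
  rw [add_mul, mul_comm ‖T.η b‖, mul_comm ‖T.η (star b)‖, ← norm_chi h, ← norm_chi h]
  exact add_le_add (norm_creation_le _) (norm_annihilation_le _)

theorem vacuumState_linPart (p q : ℝ≥0) (b : K d) : vacuumState (L2 D) (T.linPart p q b) = 0 := by
  rw [vacuumState_apply, linPart, add_apply, annihilation_vacuum, add_zero, inner_vacuum_creation]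

theorem vacuumState_linPart_mul {p q : ℝ≥0} (h : p ≤ q) (a b : K d) :
    vacuumState (L2 D) (T.linPart p q a * T.linPart p q b) =
      (len (p, q) : ℂ) * inner ℂ (T.η (star a)) (T.η b) := by
  have h1 : T.linPart p q b vacuum = creation (chi p q (T.η b)) vacuum := by
    rw [linPart, add_apply, annihilation_vacuum, add_zero]
  rw [vacuumState_apply, mul_apply_eq_comp, h1, linPart, add_apply, inner_add_right,
    inner_vacuum_creation, zero_add, ← mul_apply_eq_comp, annihilation_mul_creation, smul_apply,
    inner_smul_right, inner_chi_self h]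
  change _ * inner ℂ vacuum vacuum = _
  rw [inner_vacuum_vacuum, mul_one, len]

/-- `f_{p,q}(b)` agrees with its approximation up to `O(q - p)`, and up to `O((q - p)^{3/2})` in the
vacuum state. -/
def HasExpansion (b : K d) : Prop :=
  ∃ C, 0 ≤ C ∧ ∀ p q, p ≤ q → len (p, q) ≤ 1 →
    ‖T.process p q b - T.approx p q b‖ ≤ C * √(len (p, q)) ^ 2 ∧
    ‖vacuumState (L2 D) (T.process p q b - T.approx p q b)‖ ≤ C * √(len (p, q)) ^ 3

variable {T}

theorem HasExpansion.star {b : K d} (hb : T.HasExpansion b) : T.HasExpansion (star b) := by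
  obtain ⟨C, hC, h⟩ := hb
  refine ⟨C, hC, fun p q hpq h1 => ?_⟩
  rw [map_star, approx_star, ← star_sub, norm_star, vacuumState_star, norm_star]
  exact h p q hpq h1

theorem HasExpansion.add {a b : K d} (ha : T.HasExpansion a) (hb : T.HasExpansion b) :
    T.HasExpansion (a + b) := by
  obtain ⟨C, hC, h⟩ := ha
  obtain ⟨C', hC', h'⟩ := hb
  refine ⟨C + C', by positivity, fun p q hpq h1 => ?_⟩
  have e : T.process p q (a + b) - T.approx p q (a + b) =
      (T.process p q a - T.approx p q a) + (T.process p q b - T.approx p q b) := by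
    rw [map_add, approx_add]; abel
  rw [e, map_add, add_mul, add_mul]
  exact ⟨(norm_add_le _ _).trans (add_le_add (h p q hpq h1).1 (h' p q hpq h1).1),
    (norm_add_le _ _).trans (add_le_add (h p q hpq h1).2 (h' p q hpq h1).2)⟩

/-- The norm bound is `Noise.norm_U_sub_g_le`. As the projection P kills Ω, the vacuum state sees
only the compression of the error by 1 - P, which is O(τ²) and hence O(τ^{3/2}) for τ ≤ 1. -/
theorem hasExpansion_x (hρ : ∀ k l : Fin d, T.ρ (K.x k l) = if k = l then 1 else 0) (k l : Fin d) :
    T.HasExpansion (K.x k l) := by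
  have h0 : 0 ≤ T.noise.blockBd := by rw [Noise.blockBd]; positivity
  refine ⟨T.noise.blockBd + T.noise.bd ^ 2 * Real.exp T.noise.bd, by positivity,
    fun p q hpq h1 => ?_⟩
  have hl : 0 ≤ len (p, q) := sub_nonneg.2 (by exact_mod_cast hpq)
  have e : T.process p q (K.x k l) - T.approx p q (K.x k l) =
      (T.noise.U p q - T.noise.g (p, q)) k l := by
    rw [CStarMatrix.sub_apply, process_x, T.unitary_of_le hpq, noise_g hρ, approx, increment,
      linPart, K.counit_x, ite_smul, one_smul, zero_smul, len]
    congr 1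
    simp only [add_assoc]
  rw [e]
  have hb : 0 ≤ T.noise.bd ^ 2 * Real.exp T.noise.bd := by positivity
  constructor
  · refine (CStarMatrix.norm_entry_le_norm ..).trans ((T.noise.norm_U_sub_g_le hpq h1).trans ?_)
    rw [Real.sq_sqrt hl]
    gcongr
    linarith
  · set x := T.noise.U p q - T.noise.g (p, q)
    have h2 : vacuumState (L2 D) (x k l) =
        vacuumState (L2 D) (((1 - T.noise.P (p, q)) * x * (1 - T.noise.P (p, q))) k l) := by
      have e1 : 1 - T.noise.P (p, q) = diag d (1 - creationProj (chiSet D (p, q))) := by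
        refine CStarMatrix.ext fun i j => ?_
        change (if i = j then (1 : FockOp D) else 0) - (if i = j then _ else (0 : FockOp D)) = _
        rw [diag_apply]
        split_ifs
        · rfl
        · rw [sub_zero]
      rw [e1, mul_diag_apply, diag_mul_apply, vacuumState_apply, vacuumState_apply,
        mul_apply_eq_comp, mul_apply_eq_comp]
      have e2 : (1 - creationProj (chiSet D (p, q))) vacuum = (vacuum : Fock (L2 D)) := by
        rw [sub_apply, creationProj_vacuum, sub_zero]; rfl
      have e3 : star (1 - creationProj (chiSet D (p, q))) = 1 - creationProj (chiSet D (p, q)) := by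
        rw [star_sub, star_one, star_creationProj]
      rw [e2, ← e3, ContinuousLinearMap.star_eq_adjoint, ContinuousLinearMap.adjoint_inner_right, e2]
    rw [h2]
    refine (norm_vacuumState_le _).trans ((CStarMatrix.norm_entry_le_norm ..).trans
      ((T.noise.norm_compress_U_sub_g_le hpq h1).trans ?_))
    have h3 : len (p, q) ^ 2 ≤ √(len (p, q)) ^ 3 := by
      nth_rw 1 [← Real.sq_sqrt hl]
      rw [← pow_mul]
      exact pow_le_pow_of_le_one (Real.sqrt_nonneg _) (Real.sqrt_le_one.2 h1) (by norm_num)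
    gcongr
    linarith

set_option maxHeartbeats 400000 in
-- The derivation property matches the first-order parts, and the additional inner product in
-- `Ψ_mul` is exactly the vacuum expectation of the product of the two first-order parts, divided by
-- τ.
theorem HasExpansion.mul (hρ : ∀ k l : Fin d, T.ρ (K.x k l) = if k = l then 1 else 0) {a b : K d}
    (ha : T.HasExpansion a) (hb : T.HasExpansion b) : T.HasExpansion (a * b) := by
  obtain ⟨C, hC, h⟩ := ha
  obtain ⟨C', hC', h'⟩ := hb
  set κ : ℂ := inner ℂ (T.η (Star.star a)) (T.η b) with hκ
  set Ka := ‖T.η a‖ + ‖T.η (Star.star a)‖ with hKa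
  set Kb := ‖T.η b‖ + ‖T.η (Star.star b)‖ with hKb
  -- A single constant bounding the first-order parts by A s and the drift plus error by A s², for
  -- both factors.
  obtain ⟨A, hA⟩ : ∃ A, A = Ka + Kb + (‖T.Ψ a‖ + C) + (‖T.Ψ b‖ + C') := ⟨_, rfl⟩
  have hA0 : 0 ≤ A := by rw [hA]; positivity
  refine ⟨‖K.counit d a‖ * C' + ‖K.counit d b‖ * C + A ^ 2 + ‖κ‖ + 3 * A ^ 2, by positivity,
    fun p q hpq h1 => ?_⟩
  have hl : 0 ≤ len (p, q) := sub_nonneg.2 (by exact_mod_cast hpq)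
  obtain ⟨s, hs⟩ : ∃ s, s = √(len (p, q)) := ⟨_, rfl⟩
  have hs0 : 0 ≤ s := hs ▸ Real.sqrt_nonneg _
  have hs1 : s ≤ 1 := hs ▸ Real.sqrt_le_one.2 h1
  have hs2 : len (p, q) = s ^ 2 := by rw [hs, Real.sq_sqrt hl]
  obtain ⟨ra1, ra2⟩ := h p q hpq h1
  obtain ⟨rb1, rb2⟩ := h' p q hpq h1
  obtain ⟨ca, hca⟩ : ∃ ca, ca = T.linPart p q a := ⟨_, rfl⟩
  obtain ⟨cb, hcb⟩ : ∃ cb, cb = T.linPart p q b := ⟨_, rfl⟩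
  obtain ⟨Ra, hRa⟩ : ∃ R, R = T.process p q a - T.approx p q a := ⟨_, rfl⟩
  obtain ⟨Rb, hRb⟩ : ∃ R, R = T.process p q b - T.approx p q b := ⟨_, rfl⟩
  have nca : ‖ca‖ ≤ A * s := by
    rw [hca, hs]
    refine (T.norm_linPart_le hpq a).trans (mul_le_mul_of_nonneg_right ?_ (Real.sqrt_nonneg _))
    rw [hA, ← hKa]
    have : 0 ≤ Kb + (‖T.Ψ a‖ + C) + (‖T.Ψ b‖ + C') := by positivity
    linarith
  have ncb : ‖cb‖ ≤ A * s := by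
    rw [hcb, hs]
    refine (T.norm_linPart_le hpq b).trans (mul_le_mul_of_nonneg_right ?_ (Real.sqrt_nonneg _))
    rw [hA, ← hKb]
    have : 0 ≤ Ka + (‖T.Ψ a‖ + C) + (‖T.Ψ b‖ + C') := by positivity
    linarith
  have nY : ∀ (R : FockOp D) (ψ : ℂ) (c : ℝ), ‖R‖ ≤ c * s ^ 2 → ‖ψ‖ + c ≤ A →
      ‖((len (p, q) : ℂ) * ψ) • (1 : FockOp D) + R‖ ≤ A * s ^ 2 := by
    intro R ψ c hR hc
    refine (norm_add_le _ _).trans ?_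
    rw [norm_smul, norm_mul, Complex.norm_real, Real.norm_of_nonneg hl, hs2]
    have h1 : ‖(1 : FockOp D)‖ ≤ 1 := ContinuousLinearMap.norm_id_le
    have h2 : s ^ 2 * ‖ψ‖ * ‖(1 : FockOp D)‖ ≤ s ^ 2 * ‖ψ‖ :=
      mul_le_of_le_one_right (by positivity) h1
    nlinarith [mul_le_mul_of_nonneg_right hc (sq_nonneg s)]
  rw [← hRa, ← hs] at ra1 ra2
  rw [← hRb, ← hs] at rb1 rb2
  have nYa := nY Ra (T.Ψ a) C ra1 (by
    rw [hA]
    have : 0 ≤ Ka + Kb + (‖T.Ψ b‖ + C') := by positivity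
    linarith)
  have nYb := nY Rb (T.Ψ b) C' rb1 (by
    rw [hA]
    have : 0 ≤ Ka + Kb + (‖T.Ψ a‖ + C) := by positivity
    linarith)
  have lin : T.linPart p q (a * b) = K.counit d a • cb + K.counit d b • ca := by
    rw [hca, hcb]
    simp only [linPart, star_mul, η_mul_eq hρ, chi_add, chi_smul, creation_add, creation_smul,
      annihilation_add, annihilation_smul, K.counit_star, smul_add]
    simp only [Complex.star_def, Complex.conj_conj]
    abel
  have nrest := norm_mul_expansion_le hs0 hs1 nca ncb nYa nYb
  set Ya := ((len (p, q) : ℂ) * T.Ψ a) • (1 : FockOp D) + Ra with hYa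
  set Yb := ((len (p, q) : ℂ) * T.Ψ b) • (1 : FockOp D) + Rb with hYb
  have e : T.process p q (a * b) - T.approx p q (a * b) =
      (K.counit d a • Rb + K.counit d b • Ra) + (ca * cb - ((len (p, q) : ℂ) * κ) • 1) +
        (ca * Yb + Ya * cb + Ya * Yb) := by
    have ea : T.process p q a = K.counit d a • 1 + ca + Ya := by
      rw [hYa, hRa, hca, approx, ← add_assoc, add_sub_cancel]
    have eb : T.process p q b = K.counit d b • 1 + cb + Yb := by
      rw [hYb, hRb, hcb, approx, ← add_assoc, add_sub_cancel]
    rw [map_mul (T.process p q), approx, lin, map_mul (K.counit d), Ψ_mul, ← hκ, ea, eb]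
    exact mul_expansion ..
  have s32 : s ^ 3 ≤ s ^ 2 := pow_le_pow_of_le_one hs0 hs1 (by norm_num)
  rw [e, ← hs]
  constructor
  · have n1 : ‖K.counit d a • Rb + K.counit d b • Ra‖ ≤
        (‖K.counit d a‖ * C' + ‖K.counit d b‖ * C) * s ^ 2 := by
      refine (norm_add_le _ _).trans ?_
      rw [norm_smul, norm_smul, add_mul, mul_assoc, mul_assoc]
      gcongr
    have n2 : ‖ca * cb - ((len (p, q) : ℂ) * κ) • (1 : FockOp D)‖ ≤ (A ^ 2 + ‖κ‖) * s ^ 2 := by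
      refine (norm_sub_le _ _).trans ?_
      rw [norm_smul, norm_mul (len (p, q) : ℂ), Complex.norm_real, Real.norm_of_nonneg hl, hs2]
      have h1 : ‖(1 : FockOp D)‖ ≤ 1 := ContinuousLinearMap.norm_id_le
      have h2 : s ^ 2 * ‖κ‖ * ‖(1 : FockOp D)‖ ≤ s ^ 2 * ‖κ‖ :=
        mul_le_of_le_one_right (by positivity) h1
      have h3 : ‖ca * cb‖ ≤ A * s * (A * s) :=
        (norm_mul_le _ _).trans (mul_le_mul nca ncb (norm_nonneg _) (by positivity))
      nlinarith
    refine (norm_add₃_le ..).trans ?_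
    have := mul_le_mul_of_nonneg_left s32 (show 0 ≤ 3 * A ^ 2 by positivity)
    linarith
  · have v1 : vacuumState (L2 D) (ca * cb - ((len (p, q) : ℂ) * κ) • (1 : FockOp D)) = 0 := by
      rw [map_sub, map_smul, hca, hcb, T.vacuumState_linPart_mul hpq, isState_vacuumState.map_one,
        smul_eq_mul, mul_one, sub_self]
    rw [map_add, map_add, v1, add_zero, map_add, map_smul, map_smul]
    refine (norm_add₃_le ..).trans ?_
    rw [norm_smul, norm_smul]
    have n3 := (norm_vacuumState_le _).trans nrest
    have n1 := mul_le_mul_of_nonneg_left rb2 (norm_nonneg (K.counit d a))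
    have n2 := mul_le_mul_of_nonneg_left ra2 (norm_nonneg (K.counit d b))
    have n4 : 0 ≤ (A ^ 2 + ‖κ‖) * s ^ 3 := by positivity
    linarith

theorem hasExpansion (hρ : ∀ k l : Fin d, T.ρ (K.x k l) = if k = l then 1 else 0) (b : K d) :
    T.HasExpansion b := by
  induction b using K.induction with
  | h0 c =>
    refine ⟨0, le_rfl, fun p q _ _ => ?_⟩
    have e : T.process p q (algebraMap ℂ (K d) c) - T.approx p q (algebraMap ℂ (K d) c) = 0 := by
      have h1 : ∀ c, T.η (algebraMap ℂ (K d) c) = 0 := fun c => by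
        rw [Algebra.algebraMap_eq_smul_one, map_smul, η_one hρ, smul_zero]
      have h2 : T.Ψ (algebraMap ℂ (K d) c) = 0 := by
        rw [Algebra.algebraMap_eq_smul_one, map_smul, T.isGenerator.map_one, smul_zero]
      have h3 : chi p q (0 : D) = 0 := by
        rw [← zero_smul ℂ (0 : D), chi_smul, zero_smul]
      have h4 : creation (0 : L2 D) = 0 := by
        rw [← zero_smul ℂ (0 : L2 D), creation_smul, zero_smul]
      rw [AlgHomClass.commutes, approx, linPart, K.star_algebraMap, h1, h1, h2, h3, ← star_creation,
        h4, AlgHom.commutes, Algebra.algebraMap_eq_smul_one]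
      simp
    rw [e, map_zero]
    simp
  | hg g =>
    cases g with
    | x k l => exact hasExpansion_x hρ k l
    | xs k l => rw [← K.star_x]; exact (hasExpansion_x hρ k l).star
  | hm a b ha hb => exact ha.mul hρ hb
  | ha a b ha hb => exact ha.add hb

theorem exists_vacuumState_process_le
    (hρ : ∀ k l : Fin d, T.ρ (K.x k l) = if k = l then 1 else 0) (b : K d) :
    ∃ C, 0 ≤ C ∧ ∀ p q, p ≤ q → len (p, q) ≤ 1 →
      ‖vacuumState (L2 D) (T.process p q b) - K.counit d b - (len (p, q) : ℂ) * T.Ψ b‖ ≤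
        C * (len (p, q) * √(len (p, q))) := by
  obtain ⟨C, hC, h⟩ := hasExpansion hρ b
  refine ⟨C, hC, fun p q hpq h1 => ?_⟩
  have hl : 0 ≤ len (p, q) := sub_nonneg.2 (by exact_mod_cast hpq)
  have h2 := (h p q hpq h1).2
  rw [pow_succ, Real.sq_sqrt hl] at h2
  convert h2 using 2
  rw [map_sub, approx, map_add, map_add, vacuumState_linPart, map_smul, map_smul,
    isState_vacuumState.map_one, smul_eq_mul, smul_eq_mul]
  ring

theorem process_hasGenerator (hρ : ∀ k l : Fin d, T.ρ (K.x k l) = if k = l then 1 else 0) :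
    HasGenerator (vacuumState (L2 D)) T.process T.Ψ := by
  intro b
  obtain ⟨C, hC, h⟩ := exists_vacuumState_process_le hρ b
  rw [tendsto_iff_norm_sub_tendsto_zero]
  have h2 : Tendsto (fun t : ℝ≥0 => C * √(t : ℝ)) (𝓝[>] 0) (𝓝 0) := by
    have : Continuous fun t : ℝ≥0 => C * √(t : ℝ) := by fun_prop
    simpa using (this.tendsto 0).mono_left nhdsWithin_le_nhds
  refine squeeze_zero' (Eventually.of_forall fun _ => norm_nonneg _) ?_ h2
  filter_upwards [self_mem_nhdsWithin, nhdsWithin_le_nhds (Iic_mem_nhds (zero_lt_one' ℝ≥0))]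
    with t ht ht1
  have ht0 : (0 : ℝ) < t := by exact_mod_cast ht
  have ht1' : (t : ℝ) ≤ 1 := by exact_mod_cast ht1
  have hl : len (0, t) = t := by simp [len]
  have h3 := h 0 t zero_le (by rw [hl]; exact ht1')
  rw [hl] at h3
  have h4 : ((t : ℝ) : ℂ) ≠ 0 := by exact_mod_cast ht0.ne'
  have e : 1 / ((t : ℝ) : ℂ) * (vacuumState (L2 D) (T.process 0 t b) - K.counit d b) - T.Ψ b =
      (vacuumState (L2 D) (T.process 0 t b) - K.counit d b - ((t : ℝ) : ℂ) * T.Ψ b) / (t : ℝ) := by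
    field_simp
  rw [e, norm_div, Complex.norm_real, Real.norm_of_nonneg ht0.le, div_le_iff₀ ht0]
  linarith

theorem process_continuous (hρ : ∀ k l : Fin d, T.ρ (K.x k l) = if k = l then 1 else 0) (b : K d) :
    Tendsto (fun t => vacuumState (L2 D) (T.process 0 t b)) (𝓝 0) (𝓝 (K.counit d b)) := by
  obtain ⟨C, hC, h⟩ := exists_vacuumState_process_le hρ b
  rw [tendsto_iff_norm_sub_tendsto_zero]
  have h2 : Tendsto (fun t : ℝ≥0 => C * ((t : ℝ) * √(t : ℝ)) + (t : ℝ) * ‖T.Ψ b‖) (𝓝 0) (𝓝 0) := by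
    have : Continuous fun t : ℝ≥0 => C * ((t : ℝ) * √(t : ℝ)) + (t : ℝ) * ‖T.Ψ b‖ := by fun_prop
    simpa using this.tendsto 0
  refine squeeze_zero' (Eventually.of_forall fun _ => norm_nonneg _) ?_ h2
  filter_upwards [Iic_mem_nhds (zero_lt_one' ℝ≥0)] with t ht1
  have ht1' : (t : ℝ) ≤ 1 := by exact_mod_cast ht1
  have hl : len (0, t) = t := by simp [len]
  have h3 := h 0 t zero_le (by rw [hl]; exact ht1')
  rw [hl] at h3
  have h4 := norm_add_le (vacuumState (L2 D) (T.process 0 t b) - K.counit d b -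
    ((t : ℝ) : ℂ) * T.Ψ b) (((t : ℝ) : ℂ) * T.Ψ b)
  have h5 : ‖((t : ℝ) : ℂ)‖ = t := by rw [Complex.norm_real, Real.norm_of_nonneg t.coe_nonneg]
  rw [sub_add_cancel, norm_mul, h5] at h4
  linarith

end SchurmannTriple

/-! ### Free products are smooth functions of the marginals -/

/-- The monomial of a list of indeterminates. -/
def K.mon {d : ℕ} (l : List (KGen d)) : K d := (l.map K.gen).prod

theorem K.mon_append {d : ℕ} (l l' : List (KGen d)) : K.mon (l ++ l') = K.mon l * K.mon l' := by
  simp [K.mon]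

instance (d : ℕ) : Finite (KGen d) :=
  Finite.of_injective (β := Bool × Fin d × Fin d)
    (fun g => match g with
      | KGen.x k l => (true, k, l)
      | KGen.xs k l => (false, k, l))
    (by rintro (⟨k, l⟩ | ⟨k, l⟩) (⟨k', l'⟩ | ⟨k', l'⟩) h <;> simp_all)

/-- The monomials of length at most `N`. -/
abbrev Mon (d N : ℕ) : Type := {l : List (KGen d) // l.length ≤ N}

instance (d N : ℕ) : Fintype (Mon d N) := (List.finite_length_le (KGen d) N).fintype

section Words

variable {I : Type*} [DecidableEq I] {d : ℕ}

/-- The product in the free product given by a list of monomials in given copies. -/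
def word (w : List (I × List (KGen d))) : LinearAlgebra.FreeProduct ℂ (fun _ : I => K d) :=
  (w.map fun p => LinearAlgebra.FreeProduct.ι ℂ (fun _ : I => K d) p.1 (K.mon p.2)).prod

theorem word_append (w w' : List (I × List (KGen d))) : word (w ++ w') = word w * word w' := by
  simp [word]

/-- The total length of the monomials from the `i`-th copy. -/
def legLen (i : I) (w : List (I × List (KGen d))) : ℕ :=
  (w.map fun p => if p.1 = i then p.2.length else 0).sum

theorem legLen_append (i : I) (w w' : List (I × List (KGen d))) :
    legLen i (w ++ w') = legLen i w + legLen i w' := by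
  simp [legLen]

theorem legLen_cons (i : I) (p : I × List (KGen d)) (w : List (I × List (KGen d))) :
    legLen i (p :: w) = (if p.1 = i then p.2.length else 0) + legLen i w := by
  simp [legLen]

/-- The values of a family of functionals on monomials of length at most `N`. -/
def coords (N : ℕ) (φ : I → (K d →ₗ[ℂ] ℂ)) : I → Mon d N → ℂ := fun i l => φ i (K.mon l.1)

/-- The product of the centred monomials of a word. -/
def centredWord (φ : I → (K d →ₗ[ℂ] ℂ)) (w : List (I × List (KGen d))) :
    LinearAlgebra.FreeProduct ℂ (fun _ : I => K d) :=
  (w.map fun p => LinearAlgebra.FreeProduct.ι ℂ (fun _ : I => K d) p.1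
    (K.mon p.2 - algebraMap ℂ (K d) (φ p.1 (K.mon p.2)))).prod

theorem centredWord_cons (φ : I → (K d →ₗ[ℂ] ℂ)) (p : I × List (KGen d))
    (w : List (I × List (KGen d))) : centredWord φ (p :: w) =
      word [p] * centredWord φ w - φ p.1 (K.mon p.2) • centredWord φ w := by
  rw [centredWord, List.map_cons, List.prod_cons, map_sub, AlgHom.commutes, sub_mul,
    ← Algebra.smul_def]
  simp [word, centredWord]

theorem isChain_or_exists (w : List (I × List (KGen d))) :
    (w.IsChain fun p q => p.1 ≠ q.1) ∨ ∃ u i l l' v, w = u ++ (i, l) :: (i, l') :: v := by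
  induction w with
  | nil => exact Or.inl List.IsChain.nil
  | cons p w ih =>
    rcases ih with h | ⟨u, i, l, l', v, rfl⟩
    · cases w with
      | nil => exact Or.inl (List.isChain_singleton p)
      | cons q w =>
        by_cases hpq : p.1 = q.1
        · exact Or.inr ⟨[], p.1, p.2, q.2, w, congrArg (p :: · :: w) (Prod.ext hpq.symm rfl)⟩
        · exact Or.inl (List.isChain_cons_cons.2 ⟨hpq, h⟩)
    · exact Or.inr ⟨p :: u, i, l, l', v, rfl⟩

theorem IsFreeProduct.apply_centredWord {φ : I → (K d →ₗ[ℂ] ℂ)}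
    {Θ : LinearAlgebra.FreeProduct ℂ (fun _ : I => K d) →ₗ[ℂ] ℂ} (h : IsFreeProduct φ Θ)
    (h1 : Θ 1 = 1) {w : List (I × List (KGen d))} (hw : w ≠ [])
    (hc : w.IsChain fun p q => p.1 ≠ q.1) : Θ (centredWord φ w) = 0 := by
  have h2 := h.2 (w.map fun p => (p.1, K.mon p.2 - algebraMap ℂ (K d) (φ p.1 (K.mon p.2))))
    (by simpa using hw) ((List.isChain_map _).2 hc) (by
      intro q hq
      obtain ⟨p, _, rfl⟩ := List.mem_map.1 hq
      have h3 : φ p.1 1 = 1 := by rw [← h.1, map_one, h1]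
      rw [map_sub, Algebra.algebraMap_eq_smul_one, map_smul, h3, smul_eq_mul, mul_one, sub_self])
  rw [List.map_map] at h2
  exact h2

variable [Fintype I]

/-- The element `z` of the free product has, under free products of functionals, an expectation that
is a smooth function of the marginals. -/
def SmoothAt (N : ℕ) (z : LinearAlgebra.FreeProduct ℂ (fun _ : I => K d)) : Prop :=
  ∃ F : (I → Mon d N → ℂ) → ℂ, ContDiff ℝ 2 F ∧
    ∀ (φ : I → (K d →ₗ[ℂ] ℂ)) (Θ : LinearAlgebra.FreeProduct ℂ (fun _ : I => K d) →ₗ[ℂ] ℂ),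
      Θ 1 = 1 → IsFreeProduct φ Θ → Θ z = F (coords N φ)

/-- Strong induction on the number of factors. In a non-alternating word two neighbours from one
copy merge; in an alternating word the centred product has expectation 0, and expanding it expresses
the word through shorter ones and marginal moments. The bound on the total length in each copy keeps
merged monomials within degree N. -/
theorem smoothAt_word {N : ℕ} (w : List (I × List (KGen d))) (hw : ∀ i, legLen i w ≤ N) :
    SmoothAt N (word w) := by
  obtain ⟨n, hn⟩ : ∃ n, w.length = n := ⟨_, rfl⟩
  induction n using Nat.strong_induction_on generalizing w with
  | _ n ih =>
  by_cases hnil : w = []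
  · subst hnil
    exact ⟨fun _ => 1, contDiff_const, fun φ Θ h1 _ => by simpa [word] using h1⟩
  rcases isChain_or_exists w with hc | ⟨u, i, l, l', v, rfl⟩
  -- The centred factors are expanded one at a time, u being the prefix already expanded; each
  -- correction term has lost a factor and is covered by the outer induction.
  · have key : ∀ (w' u : List (I × List (KGen d))), (u ++ w').length ≤ n →
        (∀ i, legLen i (u ++ w') ≤ N) → ∃ F : (I → Mon d N → ℂ) → ℂ, ContDiff ℝ 2 F ∧
          ∀ (φ : I → (K d →ₗ[ℂ] ℂ))
            (Θ : LinearAlgebra.FreeProduct ℂ (fun _ : I => K d) →ₗ[ℂ] ℂ), Θ 1 = 1 →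
            IsFreeProduct φ Θ →
            Θ (word u * centredWord φ w') = Θ (word (u ++ w')) + F (coords N φ) := by
      intro w'
      induction w' with
      | nil =>
        intro u _ _
        exact ⟨fun _ => 0, contDiff_const, fun φ Θ _ _ => by simp [centredWord]⟩
      | cons p w' ih' =>
        intro u hu hN
        obtain ⟨F₁, c₁, h₁⟩ := ih' (u ++ [p]) (by simpa using hu) (by simpa using hN)
        have hlt : (u ++ w').length < n := by
          simp only [List.length_append, List.length_cons] at hu ⊢; omega
        have hN' : ∀ i, legLen i (u ++ w') ≤ N := fun i => by
          have := hN i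
          rw [legLen_append, legLen_cons] at this
          rw [legLen_append]; omega
        obtain ⟨F₂, c₂, h₂⟩ := ih' u hlt.le hN'
        obtain ⟨F₃, c₃, h₃⟩ := ih _ hlt (u ++ w') hN' rfl
        have hp : p.2.length ≤ N := by
          have := hN p.1
          rw [legLen_append, legLen_cons, if_pos rfl] at this
          omega
        have cp : ContDiff ℝ 2 fun y : I → Mon d N → ℂ => y p.1 ⟨p.2, hp⟩ :=
          (contDiff_apply ℝ ℂ (⟨p.2, hp⟩ : Mon d N)).comp (contDiff_apply ℝ (Mon d N → ℂ) p.1)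
        refine ⟨fun y => F₁ y - y p.1 ⟨p.2, hp⟩ * (F₃ y + F₂ y), c₁.sub (cp.mul (c₃.add c₂)),
          fun φ Θ h1 hΘ => ?_⟩
        have e1 := h₁ φ Θ h1 hΘ
        have e2 := h₂ φ Θ h1 hΘ
        rw [h₃ φ Θ h1 hΘ] at e2
        rw [centredWord_cons, mul_sub, mul_smul_comm, ← mul_assoc, ← word_append, map_sub, map_smul,
          e1, e2, List.append_assoc, List.singleton_append, smul_eq_mul]
        simp only [coords]
        ring
    obtain ⟨F, cF, hF⟩ := key w [] hn.le hw
    refine ⟨fun y => -F y, cF.neg, fun φ Θ h1 hΘ => ?_⟩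
    have e := hF φ Θ h1 hΘ
    rw [List.nil_append] at e
    have e0 : word ([] : List (I × List (KGen d))) * centredWord φ w = centredWord φ w := by
      simp [word]
    rw [e0, hΘ.apply_centredWord h1 hnil hc] at e
    exact eq_neg_of_add_eq_zero_left e.symm
  -- Merging shortens the word and leaves the total length in each copy unchanged.
  · have e : word (u ++ (i, l) :: (i, l') :: v) = word (u ++ (i, l ++ l') :: v) := by
      simp [word, K.mon_append, mul_assoc]
    rw [e]
    refine ih (u ++ (i, l ++ l') :: v).length ?_ _ (fun j => ?_) rfl
    · simp only [List.length_append, List.length_cons] at hn ⊢; omega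
    · have := hw j
      simp only [legLen_append, legLen_cons, List.length_append] at this ⊢
      split_ifs at this ⊢ <;> omega

theorem SmoothAt.of_mem_span {N : ℕ} {z : LinearAlgebra.FreeProduct ℂ (fun _ : I => K d)}
    (hz : z ∈ Submodule.span ℂ {z | ∃ w : List (I × List (KGen d)),
      (∀ i, legLen i w ≤ N) ∧ z = word w}) : SmoothAt N z := by
  induction hz using Submodule.span_induction with
  | mem z hz =>
    obtain ⟨w, hw, rfl⟩ := hz
    exact smoothAt_word w hw
  | zero => exact ⟨fun _ => 0, contDiff_const, fun φ Θ _ _ => map_zero Θ⟩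
  | add x y _ _ hx hy =>
    obtain ⟨F, cF, hF⟩ := hx
    obtain ⟨G, cG, hG⟩ := hy
    exact ⟨fun y => F y + G y, cF.add cG, fun φ Θ h1 h => by rw [map_add, hF φ Θ h1 h, hG φ Θ h1 h]⟩
  | smul c x _ hx =>
    obtain ⟨F, cF, hF⟩ := hx
    exact ⟨fun y => c * F y, contDiff_const.mul cF, fun φ Θ h1 h => by
      rw [map_smul, hF φ Θ h1 h, smul_eq_mul]⟩

end Words

/-! ### The convolution of functionals -/

theorem word_pair {d : ℕ} (i j : Fin 2) (g g' : KGen d) :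
    KK.inj d i (K.gen g) * KK.inj d j (K.gen g') = word [(i, [g]), (j, [g'])] := by
  simp [word, K.mon, KK.inj]

/-- Each indeterminate has a comultiplication with one letter in each leg, so a monomial of degree n
contributes at most n letters per leg. Convolution thus closes on the finitely many moments of
degree at most N. -/
theorem K.comul_mon_mem {d : ℕ} (l : List (KGen d)) : K.comul d (K.mon l) ∈
    Submodule.span ℂ {z | ∃ w : List (Fin 2 × List (KGen d)),
      (∀ i, legLen i w ≤ l.length) ∧ z = word w} := by
  induction l with
  | nil =>
    refine Submodule.subset_span ⟨[], fun i => by simp [legLen], ?_⟩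
    simp [K.mon, word]
  | cons g l ih =>
    have e : K.mon (g :: l) = K.gen g * K.mon l := by simp [K.mon]
    have key : ∀ (w : List (Fin 2 × List (KGen d))), (∀ i, legLen i w ≤ 1) →
        word w * K.comul d (K.mon l) ∈ Submodule.span ℂ {z | ∃ w : List (Fin 2 × List (KGen d)),
          (∀ i, legLen i w ≤ (g :: l).length) ∧ z = word w} := by
      intro w hw
      generalize K.comul d (K.mon l) = z at ih ⊢
      induction ih using Submodule.span_induction with
      | mem z hz =>
        obtain ⟨w', hw', rfl⟩ := hz
        refine Submodule.subset_span ⟨w ++ w', fun i => ?_, (word_append _ _).symm⟩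
        rw [legLen_append, List.length_cons, add_comm]
        exact add_le_add (hw' i) (hw i)
      | zero => rw [mul_zero]; exact zero_mem _
      | add x y _ _ hx hy => rw [mul_add]; exact add_mem hx hy
      | smul c x _ hx => rw [mul_smul_comm]; exact Submodule.smul_mem _ _ hx
    rw [e, map_mul]
    cases g with
    | x k m =>
      rw [K.comul, K.lift_gen, Finset.sum_mul]
      refine sum_mem fun n _ => ?_
      rw [word_pair]
      exact key _ fun i => by fin_cases i <;> simp [legLen]
    | xs k m =>
      rw [K.comul, K.lift_gen, Finset.sum_mul]
      refine sum_mem fun n _ => ?_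
      rw [word_pair]
      exact key _ fun i => by fin_cases i <;> simp [legLen]

/-- On monomials of length at most `N`, the convolution of free homomorphisms is given by a smooth
function. -/
theorem exists_convFun (d N : ℕ) : ∃ F : (Fin 2 → Mon d N → ℂ) → Mon d N → ℂ, ContDiff ℝ 2 F ∧
    ∀ (φ : Fin 2 → (K d →ₗ[ℂ] ℂ)) (Θ : KK d →ₗ[ℂ] ℂ), Θ 1 = 1 → IsFreeProduct φ Θ →
      (fun l : Mon d N => Θ (K.comul d (K.mon l.1))) = F (coords N φ) := by
  have h : ∀ l : Mon d N, SmoothAt N (K.comul d (K.mon l.1)) := fun l =>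
    SmoothAt.of_mem_span (Submodule.span_mono (by
      rintro z ⟨w, hw, rfl⟩
      exact ⟨w, fun i => (hw i).trans l.2, rfl⟩) (K.comul_mon_mem l.1))
  choose F cF hF using h
  exact ⟨fun y l => F l y, contDiff_pi.2 cF, fun φ Θ h1 hΘ => funext fun l => hF l φ Θ h1 hΘ⟩

/-- The counit as a homomorphism to an algebra. -/
def counitHom (d : ℕ) (A : Type*) [Ring A] [Algebra ℂ A] : K d →ₐ[ℂ] A :=
  (Algebra.ofId ℂ A).comp (K.counit d)

section Conv

variable {d : ℕ} {A : Type*} [Ring A] [Algebra ℂ A]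

theorem counitHom_apply (b : K d) : counitHom d A b = algebraMap ℂ A (K.counit d b) := rfl

theorem conv_counitHom (f : K d →ₐ[ℂ] A) : conv f (counitHom d A) = f := by
  refine K.algHom_ext fun g => ?_
  cases g with
  | x k l =>
    rw [conv_x]
    simp [counitHom_apply, K.gen_x, K.counit_x, apply_ite (algebraMap ℂ A)]
  | xs k l =>
    rw [conv_xs]
    simp [counitHom_apply, K.counit_xs, apply_ite (algebraMap ℂ A)]

theorem counitHom_conv (f : K d →ₐ[ℂ] A) : conv (counitHom d A) f = f := by
  refine K.algHom_ext fun g => ?_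
  cases g with
  | x k l =>
    rw [conv_x]
    simp [counitHom_apply, K.gen_x, K.counit_x, apply_ite (algebraMap ℂ A)]
  | xs k l =>
    rw [conv_xs]
    simp [counitHom_apply, K.counit_xs, apply_ite (algebraMap ℂ A)]

/-- A centred element of the trivial leg is mapped to 0, and an alternating word avoiding that leg
has a single factor. This covers increments over degenerate intervals. -/
theorem isFreeProduct_of_counitHom {Φ : A →ₗ[ℂ] ℂ} (h1 : Φ 1 = 1) (f : Fin 2 → (K d →ₐ[ℂ] A))
    (i₀ : Fin 2) (h : f i₀ = counitHom d A) :
    IsFreeProduct (fun i => Φ ∘ₗ (f i).toLinearMap) (Φ ∘ₗ (freeLift f).toLinearMap) := by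
  refine ⟨fun i b => ?_, fun w hw hc h0 => ?_⟩
  · rw [LinearMap.comp_apply, LinearMap.comp_apply, AlgHom.toLinearMap_apply, freeLift_ι]
    rfl
  · rw [LinearMap.comp_apply, AlgHom.toLinearMap_apply, map_list_prod, List.map_map]
    have e : (w.map (freeLift f ∘ fun p =>
        LinearAlgebra.FreeProduct.ι ℂ (fun _ : Fin 2 => K d) p.1 p.2)) =
        w.map fun p => f p.1 p.2 := List.map_congr_left fun p _ => freeLift_ι _ _ _
    rw [e]
    by_cases hi : ∃ p ∈ w, p.1 = i₀
    · obtain ⟨p, hp, hpi⟩ := hi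
      have h2 := h0 p hp
      rw [LinearMap.comp_apply, AlgHom.toLinearMap_apply, hpi, h, counitHom_apply,
        Algebra.algebraMap_eq_smul_one, map_smul, h1, smul_eq_mul, mul_one] at h2
      have h3 : f p.1 p.2 = 0 := by rw [hpi, h, counitHom_apply, h2, map_zero]
      rw [List.prod_eq_zero (List.mem_map.2 ⟨p, hp, h3⟩), map_zero]
    · push Not at hi
      match w, hw, hc, h0, hi with
      | [p], _, _, h0, _ => simpa using h0 p (by simp)
      | p :: q :: w, _, hc, _, hi =>
        have h2 := (List.isChain_cons_cons.1 hc).1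
        have h3 := hi p (by simp)
        have h4 := hi q (by simp)
        omega

end Conv

/-! ### States are bounded on monomials -/

section State

variable {A : Type*} [Ring A] [Algebra ℂ A] [StarRing A] [StarModule ℂ A] {φ : A →ₗ[ℂ] ℂ}

/-- Positivity at a + c. The values c = 1 and c = i give hermiticity, and c = -φ(a) gives the
Cauchy-Schwarz bound. -/
theorem IsState.nonneg_add_smul (hφ : IsState φ) (a : A) (c : ℂ) :
    0 ≤ φ (star a * a) + c * φ (star a) + star c * φ a + star c * c := by
  have h := hφ.nonneg (a + c • 1)
  rw [star_add, star_smul, star_one, add_mul, mul_add, mul_add, map_add, map_add, map_add,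
    mul_smul_comm, mul_one, map_smul, smul_mul_assoc, one_mul, map_smul, smul_mul_smul_comm, one_mul,
    map_smul, hφ.map_one] at h
  simpa [add_assoc] using h

theorem IsState.map_star (hφ : IsState φ) (a : A) : φ (star a) = star (φ a) := by
  have h0 := (Complex.nonneg_iff.1 (hφ.nonneg a)).2
  have h1 := (Complex.nonneg_iff.1 (hφ.nonneg_add_smul a 1)).2
  have h2 := (Complex.nonneg_iff.1 (hφ.nonneg_add_smul a Complex.I)).2
  simp at h1 h2
  apply Complex.ext
  · simp; linarith
  · simp; linarith

theorem IsState.norm_sq_le (hφ : IsState φ) (a : A) : ‖φ a‖ ^ 2 ≤ (φ (star a * a)).re := by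
  have h := (Complex.nonneg_iff.1 (hφ.nonneg_add_smul a (-φ a))).1
  rw [hφ.map_star] at h
  simp at h
  rw [← Complex.normSq_eq_norm_sq, Complex.normSq_apply]
  linarith

end State

/-- An indeterminate belongs to a family with ∑ y_p^* y_p = 1, by unitarity of X. Dropping the other
nonnegative summands removes the leading letter of the monomial. -/
theorem IsState.star_mon_mul_mon_le {d : ℕ} {φ : K d →ₗ[ℂ] ℂ} (hφ : IsState φ)
    (l : List (KGen d)) : φ (star (K.mon l) * K.mon l) ≤ 1 := by
  induction l with
  | nil => simp [K.mon, hφ.map_one]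
  | cons g l ih =>
    refine le_trans ?_ ih
    have e : K.mon (g :: l) = K.gen g * K.mon l := by simp [K.mon]
    have key : ∀ (y : Fin d → K d) (n : Fin d), ∑ p, star (y p) * y p = 1 →
        φ (star (y n * K.mon l) * (y n * K.mon l)) ≤ φ (star (K.mon l) * K.mon l) := by
      intro y n hy
      have h1 : φ (star (K.mon l) * K.mon l) =
          ∑ p, φ (star (y p * K.mon l) * (y p * K.mon l)) := by
        rw [← map_sum]
        simp only [star_mul, mul_assoc]
        rw [← Finset.mul_sum]
        simp only [← mul_assoc (star (y _))]
        rw [← Finset.sum_mul, hy, one_mul]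
      rw [h1]
      exact Finset.single_le_sum (f := fun p => φ (star (y p * K.mon l) * (y p * K.mon l)))
        (fun p _ => hφ.nonneg _) (Finset.mem_univ n)
    rw [e]
    cases g with
    | x k m =>
      refine key (fun p => K.gen (KGen.x p m)) k ?_
      simp only [K.star_gen]
      exact (K.star_mul_rel m m).trans (if_pos rfl)
    | xs k m =>
      refine key (fun p => K.gen (KGen.xs k p)) m ?_
      simp only [K.star_gen]
      exact (K.mul_star_rel k k).trans (if_pos rfl)

theorem IsState.norm_mon_le {d : ℕ} {φ : K d →ₗ[ℂ] ℂ} (hφ : IsState φ) (l : List (KGen d)) :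
    ‖φ (K.mon l)‖ ≤ 1 := by
  have h1 := hφ.norm_sq_le (K.mon l)
  have h2 := (Complex.le_def.1 (hφ.star_mon_mul_mon_le l)).1
  rw [Complex.one_re] at h2
  nlinarith [norm_nonneg (φ (K.mon l))]

/-! ### Uniqueness of evolutions with a given generator -/

section Evolution

variable {W : Type*} [NormedAddCommGroup W] [NormedSpace ℝ W]

/-- An evolution `Y` in `W`, with composition law `F`, unit `e` and generator `ψ`. -/
structure IsEvolution (F : W × W → W) (e ψ : W) (Y : ℝ≥0 → ℝ≥0 → W) : Prop where
  flow : ∀ {p q r}, p ≤ q → q ≤ r → Y p r = F (Y p q, Y q r)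
  self : ∀ p, Y p p = e
  bound : ∀ {p q}, p ≤ q → ‖Y p q‖ ≤ 1
  deriv : ∀ ε : ℝ, 0 < ε → ∃ δ : ℝ, 0 < δ ∧ ∀ p h : ℝ≥0, (h : ℝ) ≤ δ →
    ‖Y p (p + h) - e - (h : ℝ) • ψ‖ ≤ ε * h

variable {F : W × W → W} {e ψ : W} {Y Y' : ℝ≥0 → ℝ≥0 → W}

/-- All values stay in the unit ball, where F is Lipschitz; the values at t and s are F(Y(p, p + s),
·) taken at Y(p + s, p + t) and at the unit e, which differ by O(t - s). -/
theorem IsEvolution.continuous [ProperSpace W] (hF : ContDiff ℝ 2 F) (hY : IsEvolution F e ψ Y)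
    (p : ℝ≥0) : Continuous fun t => Y p (p + t) := by
  have he : ‖e‖ ≤ 1 := by rw [← hY.self 0]; exact hY.bound le_rfl
  obtain ⟨L, hL⟩ := (hF.contDiffOn (s := Metric.closedBall (0 : W × W) 1)).exists_lipschitzOnWith
    (by norm_num) (convex_closedBall _ _) (isCompact_closedBall _ _)
  obtain ⟨δ, hδ, h⟩ := hY.deriv 1 one_pos
  have key : ∀ s t : ℝ≥0, s ≤ t → (t : ℝ) - s ≤ δ →
      dist (Y p (p + t)) (Y p (p + s)) ≤ L * (1 + ‖ψ‖) * (t - s) := by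
    intro s t hst hd
    have hst' : ((t - s : ℝ≥0) : ℝ) = t - s := NNReal.coe_sub hst
    have e1 : Y p (p + t) = F (Y p (p + s), Y (p + s) (p + t)) :=
      hY.flow le_self_add (add_le_add_right hst p)
    have e2 : Y p (p + s) = F (Y p (p + s), e) := by
      rw [← hY.self (p + s)]
      exact hY.flow le_self_add le_rfl
    have b1 : ‖Y p (p + s)‖ ≤ 1 := hY.bound le_self_add
    have b2 : ‖Y (p + s) (p + t)‖ ≤ 1 := hY.bound (add_le_add_right hst p)
    have h1 := h (p + s) (t - s) (by rw [hst']; exact hd)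
    rw [add_assoc, add_tsub_cancel_of_le hst, hst'] at h1
    have h2 : ‖Y (p + s) (p + t) - e‖ ≤ (1 + ‖ψ‖) * (t - s) := by
      have h3 := norm_add_le (Y (p + s) (p + t) - e - ((t : ℝ) - s) • ψ) (((t : ℝ) - s) • ψ)
      have h4 : (0 : ℝ) ≤ t - s := sub_nonneg.2 (by exact_mod_cast hst)
      rw [sub_add_cancel, norm_smul, Real.norm_of_nonneg h4] at h3
      linarith
    rw [e1]
    nth_rw 2 [e2]
    refine (hL.dist_le_mul _ ?_ _ ?_).trans ?_
    · rw [mem_closedBall_zero_iff, Prod.norm_mk]; exact max_le b1 b2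
    · rw [mem_closedBall_zero_iff, Prod.norm_mk]; exact max_le b1 he
    · rw [Prod.dist_eq, dist_self, max_eq_right dist_nonneg, dist_eq_norm, mul_assoc]
      gcongr
  rw [Metric.continuous_iff]
  intro b ε hε
  obtain ⟨C, hC⟩ : ∃ C : ℝ, C = L * (1 + ‖ψ‖) := ⟨_, rfl⟩
  have hC0 : 0 ≤ C := by rw [hC]; positivity
  refine ⟨min δ (ε / (C + 1)), by positivity, fun a ha => ?_⟩
  rw [NNReal.dist_eq, lt_min_iff] at ha
  rw [← hC] at key
  have h2 : |(a : ℝ) - b| * (C + 1) < ε := (lt_div_iff₀ (by positivity)).1 ha.2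
  have h3 := abs_nonneg ((a : ℝ) - b)
  rcases le_total b a with hab | hab
  · have h4 : (0 : ℝ) ≤ a - b := sub_nonneg.2 (by exact_mod_cast hab)
    rw [abs_of_nonneg h4] at ha h2 h3
    have := key b a hab ha.1.le
    nlinarith
  · have h4 : (a : ℝ) - b ≤ 0 := sub_nonpos.2 (by exact_mod_cast hab)
    rw [abs_of_nonpos h4] at ha h2 h3
    rw [dist_comm]
    have := key a b hab (by linarith [ha.1])
    nlinarith

/-- The generator controls short increments appended on the right, so the composition law and the
chain rule give a right derivative. -/
theorem IsEvolution.hasDerivWithinAt (hF : ContDiff ℝ 2 F) (hY : IsEvolution F e ψ Y)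
    (p : ℝ≥0) {t : ℝ} (ht : 0 ≤ t) :
    HasDerivWithinAt (fun s : ℝ => Y p (p + s.toNNReal))
      (fderiv ℝ F (Y p (p + t.toNNReal), e) (0, ψ)) (Set.Ici t) t := by
  set q := p + t.toNNReal with hq
  have hs : ∀ s, t ≤ s → q + (s - t).toNNReal = p + s.toNNReal := fun s hts => by
    rw [hq, add_assoc, ← Real.toNNReal_add ht (sub_nonneg.2 hts), add_sub_cancel]
  have hz : HasDerivWithinAt (fun s : ℝ => Y q (q + (s - t).toNNReal)) ψ (Set.Ici t) t := by
    rw [hasDerivWithinAt_iff_isLittleO, Asymptotics.isLittleO_iff]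
    intro c hc
    obtain ⟨δ, hδ, h⟩ := hY.deriv c hc
    have h1 : ∀ᶠ s in 𝓝[Set.Ici t] t, s ≤ t + δ :=
      nhdsWithin_le_nhds (Iic_mem_nhds (by linarith))
    filter_upwards [h1, self_mem_nhdsWithin] with s hs1 hs2
    have h2 : 0 ≤ s - t := sub_nonneg.2 hs2
    have h3 := h q (s - t).toNNReal (by rw [Real.coe_toNNReal _ h2]; linarith)
    rw [Real.coe_toNNReal _ h2] at h3
    rw [sub_self, Real.toNNReal_zero, add_zero, hY.self, Real.norm_of_nonneg h2]
    exact h3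
  have hd : HasFDerivAt F (fderiv ℝ F (Y p q, e)) (Y p q, e) :=
    (hF.differentiable (by norm_num)).differentiableAt.hasFDerivAt
  have hpair : HasDerivWithinAt (fun s : ℝ => (Y p q, Y q (q + (s - t).toNNReal))) (0, ψ)
      (Set.Ici t) t := (hasDerivWithinAt_const t (Set.Ici t) (Y p q)).prodMk hz
  have e0 : (Y p q, Y q (q + (t - t).toNNReal)) = (Y p q, e) := by
    rw [sub_self, Real.toNNReal_zero, add_zero, hY.self]
  rw [← e0] at hd
  have h4 := hd.comp_hasDerivWithinAt t hpair
  rw [e0] at h4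
  refine h4.congr_of_mem (fun s hs2 => ?_) Set.self_mem_Ici
  rw [← hs s hs2]
  exact hY.flow le_self_add le_self_add

/-- Both curves solve the autonomous equation y' = DF(y, e)(0, ψ) with y(0) = e, and the right-hand
side is Lipschitz on the unit ball because F is C². Allowing different starting times makes the same
statement yield stationarity. -/
theorem IsEvolution.eq [ProperSpace W] (hF : ContDiff ℝ 2 F) (hY : IsEvolution F e ψ Y)
    (hY' : IsEvolution F e ψ Y') (p p' t : ℝ≥0) : Y p (p + t) = Y' p' (p' + t) := by
  set G : W → W := fun y => fderiv ℝ F (y, e) (0, ψ) with hG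
  have cG : ContDiff ℝ 1 G := by
    have h1 : ContDiff ℝ 1 (fderiv ℝ F) := hF.fderiv_right (by norm_num)
    exact (h1.comp (contDiff_id.prodMk contDiff_const)).clm_apply contDiff_const
  obtain ⟨L, hL⟩ := (cG.contDiffOn (s := Metric.closedBall (0 : W) 1)).exists_lipschitzOnWith
    one_ne_zero (convex_closedBall _ _) (isCompact_closedBall _ _)
  have h := ODE_solution_unique_of_mem_Icc_right (v := fun _ => G) (a := 0) (b := (t : ℝ) + 1)
    (s := fun _ => Metric.closedBall (0 : W) 1) (fun _ _ => hL)
    ((hY.continuous hF p).comp continuous_real_toNNReal).continuousOn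
    (fun s hs => hY.hasDerivWithinAt hF p hs.1)
    (fun s _ => mem_closedBall_zero_iff.2 (hY.bound le_self_add))
    ((hY'.continuous hF p').comp continuous_real_toNNReal).continuousOn
    (fun s hs => hY'.hasDerivWithinAt hF p' hs.1)
    (fun s _ => mem_closedBall_zero_iff.2 (hY'.bound le_self_add))
    (by simp [hY.self, hY'.self])
  have := h ⟨t.coe_nonneg, by linarith⟩
  simpa using this

end Evolution

/-! ### The marginal distributions -/

theorem K.mem_span_mon {d : ℕ} (b : K d) : b ∈ Submodule.span ℂ (Set.range (K.mon (d := d))) := by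
  induction b using K.induction with
  | h0 c =>
    rw [Algebra.algebraMap_eq_smul_one]
    exact Submodule.smul_mem _ _ (Submodule.subset_span ⟨[], by simp [K.mon]⟩)
  | hg g => exact Submodule.subset_span ⟨[g], by simp [K.mon]⟩
  | hm a b ha hb =>
    have h := Submodule.mul_mem_mul ha hb
    rw [Submodule.span_mul_span] at h
    refine Submodule.span_mono ?_ h
    rintro _ ⟨_, ⟨l, rfl⟩, _, ⟨l', rfl⟩, rfl⟩
    exact ⟨l ++ l', K.mon_append l l'⟩
  | ha a b ha hb => exact add_mem ha hb

theorem K.linearMap_ext {d : ℕ} {φ φ' : K d →ₗ[ℂ] ℂ} (h : ∀ l, φ (K.mon l) = φ' (K.mon l)) :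
    φ = φ' :=
  LinearMap.ext_on_range (Submodule.eq_top_iff'.2 K.mem_span_mon) h

instance (d N : ℕ) : Nonempty (Mon d N) := ⟨⟨[], Nat.zero_le N⟩⟩

section Marginals

variable {d : ℕ} {A : Type*} [Ring A] [Algebra ℂ A] [StarRing A] {Φ : A →ₗ[ℂ] ℂ}
  {f : ℝ≥0 → ℝ≥0 → (K d →⋆ₐ[ℂ] A)} {Ψ : K d →ₗ[ℂ] ℂ}

theorem IsState.comp_starAlgHom (hΦ : IsState Φ) (g : K d →⋆ₐ[ℂ] A) :
    IsState (Φ ∘ₗ g.toAlgHom.toLinearMap) where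
  map_one := by
    change Φ (g 1) = 1
    rw [_root_.map_one g, hΦ.map_one]
  nonneg a := by
    change 0 ≤ Φ (g (star a * a))
    rw [map_mul g, StarHomClass.map_star g]
    exact hΦ.nonneg _

/-- The marginal distributions have generator `Ψ`, uniformly in the starting time. -/
def HasUniformGenerator (Φ : A →ₗ[ℂ] ℂ) (f : ℝ≥0 → ℝ≥0 → (K d →⋆ₐ[ℂ] A))
    (Ψ : K d →ₗ[ℂ] ℂ) : Prop :=
  ∀ b, ∀ ε : ℝ, 0 < ε → ∃ δ : ℝ, 0 < δ ∧ ∀ p h : ℝ≥0, (h : ℝ) ≤ δ →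
    ‖Φ (f p (p + h) b) - K.counit d b - (h : ℂ) * Ψ b‖ ≤ ε * h

/-- A multiplicative family of homomorphisms with free successive increments. -/
structure IsFreeEvolution (Φ : A →ₗ[ℂ] ℂ) (f : ℝ≥0 → ℝ≥0 → (K d →⋆ₐ[ℂ] A)) : Prop where
  isState : IsState Φ
  self : ∀ r, (f r r).toAlgHom = counitHom d A
  evolution : ∀ {r s t}, r < s → s < t →
    (f r t).toAlgHom = conv (f r s).toAlgHom (f s t).toAlgHom
  free : ∀ {r s t}, r < s → s < t →
    IsFreeProduct (fun i => Φ ∘ₗ (![(f r s).toAlgHom, (f s t).toAlgHom] i).toLinearMap)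
      (Φ ∘ₗ (freeLift ![(f r s).toAlgHom, (f s t).toAlgHom]).toLinearMap)

theorem IsFreeEvolution.conv_of_le (hf : IsFreeEvolution Φ f) {r s t : ℝ≥0} (h : r ≤ s)
    (h' : s ≤ t) : (f r t).toAlgHom = conv (f r s).toAlgHom (f s t).toAlgHom := by
  obtain rfl | h := h.eq_or_lt
  · rw [hf.self, counitHom_conv]
  obtain rfl | h' := h'.eq_or_lt
  · rw [hf.self, conv_counitHom]
  exact hf.evolution h h'

theorem IsFreeEvolution.free_of_le (hf : IsFreeEvolution Φ f) {r s t : ℝ≥0} (h : r ≤ s)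
    (h' : s ≤ t) :
    IsFreeProduct (fun i => Φ ∘ₗ (![(f r s).toAlgHom, (f s t).toAlgHom] i).toLinearMap)
      (Φ ∘ₗ (freeLift ![(f r s).toAlgHom, (f s t).toAlgHom]).toLinearMap) := by
  obtain rfl | h := h.eq_or_lt
  · exact isFreeProduct_of_counitHom hf.isState.map_one _ 0 (hf.self r)
  obtain rfl | h' := h'.eq_or_lt
  · exact isFreeProduct_of_counitHom hf.isState.map_one _ 1 (hf.self s)
  exact hf.free h h'

/-- For moments of degree at most N: freeness gives the composition law, the state bound on
monomials keeps them in the unit ball, and finiteness of the set of monomials gives one δ for all of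
them. -/
theorem IsFreeEvolution.isEvolution (hf : IsFreeEvolution Φ f) (hg : HasUniformGenerator Φ f Ψ)
    {N : ℕ} {F : (Fin 2 → Mon d N → ℂ) → Mon d N → ℂ}
    (hF : ∀ (φ : Fin 2 → (K d →ₗ[ℂ] ℂ)) (Θ : KK d →ₗ[ℂ] ℂ), Θ 1 = 1 → IsFreeProduct φ Θ →
      (fun l : Mon d N => Θ (K.comul d (K.mon l.1))) = F (coords N φ)) :
    IsEvolution (fun x => F ![x.1, x.2]) (fun l : Mon d N => K.counit d (K.mon l.1))
      (fun l : Mon d N => Ψ (K.mon l.1)) (fun p q l => Φ (f p q (K.mon l.1))) where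
  flow {p q r} h h' := by
    have h1 := hF _ _ (by
      rw [LinearMap.comp_apply, AlgHom.toLinearMap_apply, map_one, hf.isState.map_one])
      (hf.free_of_le h h')
    have e1 : (fun l : Mon d N => Φ (f p r (K.mon l.1))) = fun l : Mon d N =>
        Φ (conv (f p q).toAlgHom (f q r).toAlgHom (K.mon l.1)) := by
      rw [← hf.conv_of_le h h']; rfl
    refine e1.trans (h1.trans (congrArg F ?_))
    funext i l
    fin_cases i <;> rfl
  self p := by
    funext l
    have h1 := DFunLike.congr_fun (hf.self p) (K.mon l.1)
    change Φ ((f p p).toAlgHom (K.mon l.1)) = _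
    rw [h1, counitHom_apply, Algebra.algebraMap_eq_smul_one, map_smul, hf.isState.map_one,
      smul_eq_mul, mul_one]
  bound {p q} _ := by
    rw [pi_norm_le_iff_of_nonneg zero_le_one]
    exact fun l => (hf.isState.comp_starAlgHom (f p q)).norm_mon_le l.1
  deriv ε hε := by
    have h1 := fun l : Mon d N => hg (K.mon l.1) ε hε
    choose δ hδ h using h1
    obtain ⟨l₀, hl₀⟩ := Finite.exists_min δ
    refine ⟨δ l₀, hδ l₀, fun p t ht => ?_⟩
    rw [pi_norm_le_iff_of_nonneg (by positivity)]
    intro l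
    exact h l p t (ht.trans (hl₀ l))

end Marginals

/-- Free evolutions with the same generator have the same marginal distributions, which depend on
the length of the interval only. -/
theorem IsFreeEvolution.marginal_eq {d : ℕ} {A A' : Type*} [Ring A] [Algebra ℂ A] [StarRing A]
    [Ring A'] [Algebra ℂ A'] [StarRing A'] {Φ : A →ₗ[ℂ] ℂ} {f : ℝ≥0 → ℝ≥0 → (K d →⋆ₐ[ℂ] A)}
    {Φ' : A' →ₗ[ℂ] ℂ} {f' : ℝ≥0 → ℝ≥0 → (K d →⋆ₐ[ℂ] A')} {Ψ : K d →ₗ[ℂ] ℂ}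
    (hf : IsFreeEvolution Φ f) (hg : HasUniformGenerator Φ f Ψ)
    (hf' : IsFreeEvolution Φ' f') (hg' : HasUniformGenerator Φ' f' Ψ) (p p' t : ℝ≥0) :
    Φ ∘ₗ (f p (p + t)).toAlgHom.toLinearMap = Φ' ∘ₗ (f' p' (p' + t)).toAlgHom.toLinearMap := by
  refine K.linearMap_ext fun l => ?_
  obtain ⟨F, cF, hF⟩ := exists_convFun d l.length
  have cF' : ContDiff ℝ 2 fun x : (Mon d l.length → ℂ) × (Mon d l.length → ℂ) => F ![x.1, x.2] := by
    refine cF.comp (contDiff_pi.2 fun i => ?_)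
    fin_cases i
    · exact contDiff_fst
    · exact contDiff_snd
  exact congrFun ((hf.isEvolution hg hF).eq cF' (hf'.isEvolution hg' hF) p p' t) ⟨l, le_rfl⟩

/-! ### Free Lévy processes as free evolutions -/

section Levy

variable {d : ℕ} {A : Type*} [Ring A] [Algebra ℂ A] [StarRing A] {Φ : A →ₗ[ℂ] ℂ}
  {f : ℝ≥0 → ℝ≥0 → (K d →⋆ₐ[ℂ] A)} {Ψ : K d →ₗ[ℂ] ℂ}

theorem IsFreeLevy.isFreeEvolution (hf : IsFreeLevy Φ f) : IsFreeEvolution Φ f where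
  isState := hf.isState
  self r := AlgHom.ext fun b => hf.evolution_self r b
  evolution h h' := hf.evolution _ _ _ h h'
  free {r s t} h h' := by
    have h1 := hf.freeness 2 ![r, s, t] (by norm_num) (by
      rw [Fin.strictMono_iff_lt_succ]
      intro i
      fin_cases i
      · exact h
      · exact h')
    have e : (fun i : Fin 2 => (f (![r, s, t] i.castSucc) (![r, s, t] i.succ)).toAlgHom) =
        ![(f r s).toAlgHom, (f s t).toAlgHom] := by
      funext i
      fin_cases i <;> rfl
    rw [← e]
    exact h1

/-- Stationarity moves every starting time to 0. -/
theorem IsFreeLevy.hasUniformGenerator (hf : IsFreeLevy Φ f) (hg : HasGenerator Φ f Ψ) :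
    HasUniformGenerator Φ f Ψ := by
  intro b ε hε
  have h1 := Metric.tendsto_nhds.1 (hg b) ε hε
  rw [eventually_nhdsWithin_iff, Metric.eventually_nhds_iff] at h1
  obtain ⟨δ, hδ, h⟩ := h1
  refine ⟨δ / 2, by positivity, fun p t ht => ?_⟩
  obtain rfl | ht0 := eq_zero_or_pos t
  · rw [add_zero, hf.evolution_self, Algebra.algebraMap_eq_smul_one, map_smul, hf.isState.map_one]
    simp
  have ht0' : (0 : ℝ) < t := by exact_mod_cast ht0
  have h2 := h (y := t) (by
    rw [NNReal.dist_eq, NNReal.coe_zero, sub_zero, abs_of_pos ht0']; linarith) ht0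
  have h3 : ((t : ℝ) : ℂ) ≠ 0 := by exact_mod_cast ht0'.ne'
  rw [hf.stationary p (p + t) (lt_add_of_pos_right p ht0), add_tsub_cancel_left]
  have e : Φ (f 0 t b) - K.counit d b - ((t : ℝ) : ℂ) * Ψ b =
      ((t : ℝ) : ℂ) * (1 / ((t : ℝ) : ℂ) * (Φ (f 0 t b) - K.counit d b) - Ψ b) := by
    field_simp
  rw [dist_eq_norm] at h2
  rw [e, norm_mul, Complex.norm_real, Real.norm_of_nonneg ht0'.le, mul_comm]
  gcongr

end Levy

/-! ### Stochastic equivalence -/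

theorem freeProduct_algHom_ext {I : Type*} [DecidableEq I] {d : ℕ} {A : Type*} [Semiring A]
    [Algebra ℂ A] {f g : LinearAlgebra.FreeProduct ℂ (fun _ : I => K d) →ₐ[ℂ] A}
    (h : ∀ i b, f (LinearAlgebra.FreeProduct.ι ℂ (fun _ : I => K d) i b) =
      g (LinearAlgebra.FreeProduct.ι ℂ (fun _ : I => K d) i b)) : f = g := by
  have key : ∀ k : LinearAlgebra.FreeProduct ℂ (fun _ : I => K d) →ₐ[ℂ] A,
      (∀ i b, k (LinearAlgebra.FreeProduct.ι ℂ (fun _ : I => K d) i b) =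
        g (LinearAlgebra.FreeProduct.ι ℂ (fun _ : I => K d) i b)) →
      k = freeLift fun i => g.comp (LinearAlgebra.FreeProduct.ι ℂ (fun _ : I => K d) i) :=
    fun k hk => LinearAlgebra.FreeProduct.lift_unique ℂ (fun _ : I => K d)
      (fun {i} => g.comp (LinearAlgebra.FreeProduct.ι ℂ (fun _ : I => K d) i)) k
      fun i => AlgHom.ext fun b => hk i b
  exact (key f h).trans (key g fun _ _ => rfl).symm

theorem freeProduct_adjoin_eq_top (I : Type*) [DecidableEq I] (d : ℕ) :
    Algebra.adjoin ℂ (Set.range fun p : I × KGen d =>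
      LinearAlgebra.FreeProduct.ι ℂ (fun _ : I => K d) p.1 (K.gen p.2)) = ⊤ := by
  set S := Algebra.adjoin ℂ (Set.range fun p : I × KGen d =>
      LinearAlgebra.FreeProduct.ι ℂ (fun _ : I => K d) p.1 (K.gen p.2)) with hS
  have h : ∀ i b, LinearAlgebra.FreeProduct.ι ℂ (fun _ : I => K d) i b ∈ S := by
    intro i b
    induction b using K.induction with
    | h0 c => rw [AlgHom.commutes]; exact Subalgebra.algebraMap_mem _ _
    | hg g => exact Algebra.subset_adjoin ⟨(i, g), rfl⟩
    | hm a b ha hb => rw [map_mul]; exact mul_mem ha hb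
    | ha a b ha hb => rw [map_add]; exact add_mem ha hb
  have e : S.val.comp (freeLift fun i =>
      (LinearAlgebra.FreeProduct.ι ℂ (fun _ : I => K d) i).codRestrict S (h i)) =
      AlgHom.id ℂ _ := freeProduct_algHom_ext fun i b => by
    rw [AlgHom.comp_apply, freeLift_ι]; rfl
  rw [eq_top_iff]
  intro z _
  rw [← AlgHom.id_apply (R := ℂ) z, ← e]
  exact Subtype.prop _

theorem freeProduct_linearMap_ext {I : Type*} [DecidableEq I] {d : ℕ}
    {Θ Θ' : LinearAlgebra.FreeProduct ℂ (fun _ : I => K d) →ₗ[ℂ] ℂ}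
    (h : ∀ w : List (I × KGen d),
      Θ (w.map fun p => LinearAlgebra.FreeProduct.ι ℂ (fun _ : I => K d) p.1 (K.gen p.2)).prod =
      Θ' (w.map fun p => LinearAlgebra.FreeProduct.ι ℂ (fun _ : I => K d) p.1 (K.gen p.2)).prod) :
    Θ = Θ' := by
  ext z
  have hz : z ∈ Subalgebra.toSubmodule (Algebra.adjoin ℂ (Set.range fun p : I × KGen d =>
      LinearAlgebra.FreeProduct.ι ℂ (fun _ : I => K d) p.1 (K.gen p.2))) := by
    rw [freeProduct_adjoin_eq_top]; trivial
  rw [Algebra.adjoin_eq_span] at hz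
  induction hz using Submodule.span_induction with
  | mem z hz =>
    obtain ⟨l, hl, rfl⟩ := Submonoid.exists_list_of_mem_closure hz
    have hl' : l ∈ Set.range (List.map fun p : I × KGen d =>
        LinearAlgebra.FreeProduct.ι ℂ (fun _ : I => K d) p.1 (K.gen p.2)) := by
      rw [Set.range_list_map]; exact hl
    obtain ⟨w, rfl⟩ := hl'
    exact h w
  | zero => rw [map_zero, map_zero]
  | add x y _ _ hx hy => rw [map_add, map_add, hx, hy]
  | smul c x _ hx => rw [map_smul, map_smul, hx]

/-- The free product of functionals is unique. -/
theorem IsFreeProduct.unique {I : Type*} [DecidableEq I] [Fintype I] {d : ℕ}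
    {φ : I → (K d →ₗ[ℂ] ℂ)} {Θ Θ' : LinearAlgebra.FreeProduct ℂ (fun _ : I => K d) →ₗ[ℂ] ℂ}
    (h : IsFreeProduct φ Θ) (h' : IsFreeProduct φ Θ') (h1 : Θ 1 = 1) (h1' : Θ' 1 = 1) :
    Θ = Θ' := by
  refine freeProduct_linearMap_ext fun w => ?_
  set w' : List (I × List (KGen d)) := w.map fun p => (p.1, [p.2]) with hw'
  have e : (w.map fun p => LinearAlgebra.FreeProduct.ι ℂ (fun _ : I => K d) p.1 (K.gen p.2)).prod =
      word w' := by
    rw [word, hw', List.map_map]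
    congr 1
    refine List.map_congr_left fun p _ => ?_
    simp [K.mon]
  obtain ⟨F, -, hF⟩ := smoothAt_word (N := ∑ i, legLen i w') w' fun i =>
    Finset.single_le_sum (f := fun i => legLen i w') (fun _ _ => Nat.zero_le _) (Finset.mem_univ i)
  rw [e, hF φ Θ h1 h, hF φ Θ' h1' h']

theorem comp_conv {d : ℕ} {A B : Type*} [Semiring A] [Algebra ℂ A] [Semiring B] [Algebra ℂ B]
    (θ : A →ₐ[ℂ] B) (f g : K d →ₐ[ℂ] A) : θ.comp (conv f g) = conv (θ.comp f) (θ.comp g) := by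
  refine K.algHom_ext fun x => ?_
  cases x with
  | x k l => rw [AlgHom.comp_apply, conv_x, conv_x, map_sum]; simp only [map_mul]; rfl
  | xs k l => rw [AlgHom.comp_apply, conv_xs, conv_xs, map_sum]; simp only [map_mul]; rfl

/-! ### Joint distributions over a common grid -/

section Joint

variable {d : ℕ} {A A' : Type*} [Ring A] [Algebra ℂ A] [StarRing A]
  [Ring A'] [Algebra ℂ A'] [StarRing A'] {Φ : A →ₗ[ℂ] ℂ} {f : ℝ≥0 → ℝ≥0 → (K d →⋆ₐ[ℂ] A)}
  {Φ' : A' →ₗ[ℂ] ℂ} {f' : ℝ≥0 → ℝ≥0 → (K d →⋆ₐ[ℂ] A')}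

/-- The homomorphism induced by the increments over a grid. -/
def gridLift {n : ℕ} (t : Fin (n + 1) → ℝ≥0) (f : ℝ≥0 → ℝ≥0 → (K d →⋆ₐ[ℂ] A)) :
    LinearAlgebra.FreeProduct ℂ (fun _ : Fin n => K d) →ₐ[ℂ] A :=
  freeLift fun i : Fin n => (f (t i.castSucc) (t i.succ)).toAlgHom

/-- An increment over several grid intervals is the convolution of the increments over each, so h is
an iterated comultiplication. It does not depend on the process, and therefore serves both at once.
-/
theorem exists_gridHom (hf : IsFreeEvolution Φ f) (hf' : IsFreeEvolution Φ' f') {n : ℕ}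
    {t : Fin (n + 1) → ℝ≥0} (ht : Monotone t) (a b : Fin (n + 1)) (hab : a ≤ b) :
    ∃ h : K d →ₐ[ℂ] LinearAlgebra.FreeProduct ℂ (fun _ : Fin n => K d),
      (gridLift t f).comp h = (f (t a) (t b)).toAlgHom ∧
      (gridLift t f').comp h = (f' (t a) (t b)).toAlgHom := by
  obtain ⟨b, hb⟩ := b
  obtain ⟨k, rfl⟩ : ∃ k, b = a + k := ⟨b - a, by have : (a : ℕ) ≤ b := hab; omega⟩
  clear hab
  induction k with
  | zero =>
    refine ⟨counitHom d _, ?_, ?_⟩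
    · rw [show (⟨(a : ℕ) + 0, hb⟩ : Fin (n + 1)) = a from rfl, hf.self]
      exact AlgHom.ext fun b => AlgHom.commutes _ _
    · rw [show (⟨(a : ℕ) + 0, hb⟩ : Fin (n + 1)) = a from rfl, hf'.self]
      exact AlgHom.ext fun b => AlgHom.commutes _ _
  | succ k ih =>
    obtain ⟨h, h1, h2⟩ := ih (by omega)
    set i : Fin n := ⟨a + k, by omega⟩ with hi
    have le1 : t a ≤ t i.castSucc := ht (Fin.le_def.2 (Nat.le_add_right _ _))
    have le2 : t i.castSucc ≤ t i.succ := ht (Fin.castSucc_le_succ i)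
    refine ⟨conv h (LinearAlgebra.FreeProduct.ι ℂ (fun _ : Fin n => K d) i), ?_, ?_⟩
    · have e : (gridLift t f).comp (LinearAlgebra.FreeProduct.ι ℂ (fun _ : Fin n => K d) i) =
          (f (t i.castSucc) (t i.succ)).toAlgHom := AlgHom.ext fun b => freeLift_ι _ i b
      rw [comp_conv, h1, e]
      exact (hf.conv_of_le le1 le2).symm
    · have e : (gridLift t f').comp (LinearAlgebra.FreeProduct.ι ℂ (fun _ : Fin n => K d) i) =
          (f' (t i.castSucc) (t i.succ)).toAlgHom := AlgHom.ext fun b => freeLift_ι _ i b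
      rw [comp_conv, h2, e]
      exact (hf'.conv_of_le le1 le2).symm

/-- The endpoints in a word form one grid, over which the word is the image of a single element of
the free product of the grid increments. There both functionals are the free product of the same
marginals. -/
theorem IsFreeLevy.stochasticallyEquivalent {Ψ : K d →ₗ[ℂ] ℂ} (hf : IsFreeLevy Φ f)
    (hg : HasGenerator Φ f Ψ) (hf' : IsFreeLevy Φ' f') (hg' : HasGenerator Φ' f' Ψ) :
    StochasticallyEquivalent Φ f Φ' f' := by
  refine freeProduct_linearMap_ext fun w => ?_
  -- The points 0, 1, 2 guarantee at least two grid intervals, since freeness is postulated only for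
  -- n > 1.
  set E : Finset ℝ≥0 := (w.map fun p => p.1.1.1).toFinset ∪ (w.map fun p => p.1.1.2).toFinset ∪
    {0, 1, 2} with hE
  have hcard : 3 ≤ E.card := by
    have h3 : ({0, 1, 2} : Finset ℝ≥0).card = 3 := by
      rw [Finset.card_eq_three]
      exact ⟨0, 1, 2, by norm_num, by norm_num, by norm_num, rfl⟩
    rw [← h3]
    exact Finset.card_le_card Finset.subset_union_right
  obtain ⟨n, hn⟩ : ∃ n, E.card = n + 1 := ⟨E.card - 1, by omega⟩
  set t : Fin (n + 1) → ℝ≥0 := fun i => E.orderEmbOfFin hn i with ht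
  have hmono : StrictMono t := (E.orderEmbOfFin hn).strictMono
  have hrange : ∀ x ∈ E, ∃ a, t a = x := fun x hx => by
    have : x ∈ Set.range (E.orderEmbOfFin hn) := by rw [Finset.range_orderEmbOfFin]; exact hx
    exact this
  have hE1 : ∀ p ∈ w, p.1.1.1 ∈ E ∧ p.1.1.2 ∈ E := fun p hp => by
    simp only [hE, Finset.mem_union, List.mem_toFinset, List.mem_map]
    exact ⟨Or.inl (Or.inl ⟨p, hp, rfl⟩), Or.inl (Or.inr ⟨p, hp, rfl⟩)⟩
  have ef := hf.isFreeEvolution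
  have ef' := hf'.isFreeEvolution
  have hz : ∃ z, gridLift t f z = (w.map fun p => f p.1.1.1 p.1.1.2 (K.gen p.2)).prod ∧
      gridLift t f' z = (w.map fun p => f' p.1.1.1 p.1.1.2 (K.gen p.2)).prod := by
    clear_value E t
    clear hE
    induction w with
    | nil => exact ⟨1, map_one _, map_one _⟩
    | cons p w ih =>
      obtain ⟨z, z1, z2⟩ := ih fun q hq => hE1 q (by simp [hq])
      obtain ⟨⟨a, ha⟩, ⟨b, hb⟩⟩ := (hE1 p (by simp)).imp (hrange _) (hrange _)
      have hab : a ≤ b := hmono.le_iff_le.1 (by rw [ha, hb]; exact p.1.2)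
      obtain ⟨h, h1, h2⟩ := exists_gridHom ef ef' hmono.monotone a b hab
      refine ⟨h (K.gen p.2) * z, ?_, ?_⟩
      · rw [map_mul, z1, List.map_cons, List.prod_cons, ← AlgHom.comp_apply, h1, ha, hb]; rfl
      · rw [map_mul, z2, List.map_cons, List.prod_cons, ← AlgHom.comp_apply, h2, ha, hb]; rfl
  obtain ⟨z, z1, z2⟩ := hz
  have d1 : distribution Φ f (w.map fun p => LinearAlgebra.FreeProduct.ι ℂ
      (fun _ : {p : ℝ≥0 × ℝ≥0 // p.1 ≤ p.2} => K d) p.1 (K.gen p.2)).prod = Φ (gridLift t f z) := by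
    rw [z1, distribution, LinearMap.comp_apply, AlgHom.toLinearMap_apply, map_list_prod,
      List.map_map]
    exact congrArg (fun l => Φ (List.prod l)) (List.map_congr_left fun p _ => freeLift_ι _ _ _)
  have d2 : distribution Φ' f' (w.map fun p => LinearAlgebra.FreeProduct.ι ℂ
      (fun _ : {p : ℝ≥0 × ℝ≥0 // p.1 ≤ p.2} => K d) p.1 (K.gen p.2)).prod =
      Φ' (gridLift t f' z) := by
    rw [z2, distribution, LinearMap.comp_apply, AlgHom.toLinearMap_apply, map_list_prod,
      List.map_map]
    exact congrArg (fun l => Φ' (List.prod l)) (List.map_congr_left fun p _ => freeLift_ι _ _ _)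
  rw [d1, d2]
  have f1 := hf.freeness n t (by omega) hmono
  have f2 := hf'.freeness n t (by omega) hmono
  have e : (fun i : Fin n => Φ ∘ₗ (f (t i.castSucc) (t i.succ)).toAlgHom.toLinearMap) =
      fun i : Fin n => Φ' ∘ₗ (f' (t i.castSucc) (t i.succ)).toAlgHom.toLinearMap := by
    funext i
    have h := ef.marginal_eq (hf.hasUniformGenerator hg) ef' (hf'.hasUniformGenerator hg')
      (t i.castSucc) (t i.castSucc) (t i.succ - t i.castSucc)
    rwa [add_tsub_cancel_of_le (hmono.monotone (Fin.castSucc_le_succ i))] at h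
  rw [e] at f1
  have hu := f1.unique f2
    (by rw [LinearMap.comp_apply, AlgHom.toLinearMap_apply, map_one, hf.isState.map_one])
    (by rw [LinearMap.comp_apply, AlgHom.toLinearMap_apply, map_one, hf'.isState.map_one])
  exact DFunLike.congr_fun hu z

end Joint

/-! ### The Fock space process is a free Lévy process -/

namespace SchurmannTriple

variable {d : ℕ} {D : Type u} [NormedAddCommGroup D] [InnerProductSpace ℂ D]
  {T : SchurmannTriple d D}

theorem process_isFreeEvolution (T : SchurmannTriple d D) :
    IsFreeEvolution (vacuumState (L2 D)) T.process where
  isState := isState_vacuumState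
  self r := AlgHom.ext fun b => T.process_self r b
  evolution h h' := T.process_conv h.le h'.le
  free {r s t} h h' := by
    have h1 := T.process_free (t := ![r, s, t]) (by
      rw [Fin.monotone_iff_le_succ]
      intro i
      fin_cases i
      · exact h.le
      · exact h'.le)
    have e : (fun i : Fin 2 =>
        (T.process (![r, s, t] i.castSucc) (![r, s, t] i.succ)).toAlgHom) =
        ![(T.process r s).toAlgHom, (T.process s t).toAlgHom] := by
      funext i
      fin_cases i <;> rfl
    rw [← e]
    exact h1

theorem process_hasUniformGenerator
    (hρ : ∀ k l : Fin d, T.ρ (K.x k l) = if k = l then 1 else 0) :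
    HasUniformGenerator (vacuumState (L2 D)) T.process T.Ψ := by
  intro b ε hε
  obtain ⟨C, hC, h⟩ := exists_vacuumState_process_le hρ b
  -- This makes C √t ≤ ε; the summand 1 covers C = 0, and the minimum keeps the length in the range
  -- of the expansion.
  refine ⟨min 1 ((ε / (C + 1)) ^ 2), by positivity, fun p t ht => ?_⟩
  have hl : len (p, p + t) = t := by simp [len]
  have h1 := h p (p + t) le_self_add (by rw [hl]; exact ht.trans (min_le_left _ _))
  rw [hl] at h1
  refine h1.trans ?_
  have h2 : √(t : ℝ) ≤ ε / (C + 1) :=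
    Real.sqrt_le_iff.2 ⟨by positivity, ht.trans (min_le_right _ _)⟩
  rw [le_div_iff₀ (by positivity)] at h2
  have h3 : C * √(t : ℝ) ≤ ε := by nlinarith [Real.sqrt_nonneg (t : ℝ)]
  nlinarith [mul_le_mul_of_nonneg_right h3 t.coe_nonneg]

theorem process_isFreeLevy (hρ : ∀ k l : Fin d, T.ρ (K.x k l) = if k = l then 1 else 0) :
    IsFreeLevy (vacuumState (L2 D)) T.process where
  isState := isState_vacuumState
  evolution _ _ _ h h' := T.process_conv h.le h'.le
  evolution_self := T.process_self
  freeness _ _ _ ht := T.process_free ht.monotone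
  -- The process is compared with itself, started at r and at 0.
  stationary r s h b := by
    have h1 := T.process_isFreeEvolution.marginal_eq (process_hasUniformGenerator hρ)
      T.process_isFreeEvolution (process_hasUniformGenerator hρ) r 0 (s - r)
    rw [add_tsub_cancel_of_le h.le, zero_add] at h1
    exact DFunLike.congr_fun h1 b
  continuous := process_continuous hρ

end SchurmannTriple

end

end FreeLevy

theorem mainTheorem4 {d : ℕ} {D : Type u} [NormedAddCommGroup D] [InnerProductSpace ℂ D]
    (T : FreeLevy.SchurmannTriple d D)
    (hρ : ∀ k l : Fin d, T.ρ (FreeLevy.K.x k l) = if k = l then 1 else 0) :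
    ∃ f : ℝ≥0 → ℝ≥0 → (FreeLevy.K d →⋆ₐ[ℂ]
        (FreeLevy.Fock (FreeLevy.L2 D) →L[ℂ] FreeLevy.Fock (FreeLevy.L2 D))),
      T.IsFockConstruction f ∧
      FreeLevy.IsFreeLevy (FreeLevy.vacuumState (FreeLevy.L2 D)) f ∧
      FreeLevy.HasGenerator (FreeLevy.vacuumState (FreeLevy.L2 D)) f T.Ψ ∧
      ∀ (A : Type v) [Ring A] [Algebra ℂ A] [StarRing A] [StarModule ℂ A]
        (Φ : A →ₗ[ℂ] ℂ) (j : ℝ≥0 → ℝ≥0 → (FreeLevy.K d →⋆ₐ[ℂ] A)),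
        FreeLevy.IsFreeLevy Φ j → FreeLevy.HasGenerator Φ j T.Ψ →
        FreeLevy.StochasticallyEquivalent Φ j (FreeLevy.vacuumState (FreeLevy.L2 D)) f := by
  exact ⟨T.process, T.process_isFockConstruction hρ,
    FreeLevy.SchurmannTriple.process_isFreeLevy hρ,
    FreeLevy.SchurmannTriple.process_hasGenerator hρ,
    fun A _ _ _ _ Φ j hj hg => hj.stochasticallyEquivalent hg
      (FreeLevy.SchurmannTriple.process_isFreeLevy hρ)
      (FreeLevy.SchurmannTriple.process_hasGenerator hρ)⟩
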